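/- **Setting.** Let $S,A,B$ be Borel spaces (Borel subsets of complete separable metric spaces). For $t\ge 0$, $x\in S$ let $A(t,x)\subset A$, $B(t,x)\subset B$ be Borel sets of admissible actions such that $K=\{(t,x,a,b): t\ge 0, x\in S, a\in A(t,x), b\in B(t,x)\}$ is Borel; put $K_{[0,T]}=\{(t,x,a,b)\in K: t\le T\}$. Let $q(\cdot\,|\,t,x,a,b)$ be a finite signed kernel on $S$ given $K$ with $q(D|t,x,a,b)\ge 0$ for $x\notin D$, $q(S|t,x,a,b)=0$, and $\sup_{t,a,b}q(t,x,a,b)<\infty$ for every $x$, where $q(t,x,a,b)=-q(\{x\}|t,x,a,b)$. Let $\phi:S\times\mathbb R\to S$ be a measurable flow: $\phi(x,0)=x$, $\phi(x,s+t)=\phi(\phi(x,s),t)$, $t\mapsto\phi(x,t)$ continuous. Let $c:K\to\mathbb R$ and $g:[0,\infty)\times S\to\mathbb R$ be measurable, and fix $T>0$ and $\lambda\in(0,1]$. *Process and strategies.* Let $\Omega$ be the space of sequences $\omega=(x_0,\theta_1,x_1,\theta_2,x_2,\dots)$ with $x_0\in S$ which either stay in $S\times(0,\infty)$ for ever or,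 from some index on, continue as $(\infty,\Delta),(\infty,\Delta),\dots$, with $\Delta\notin S$ isolated. Put $X_k=x_k$, $T_k=\theta_1+\dots+\theta_k$, $T_\infty=\lim_k T_k$, $\xi_t=\phi(X_n,t-T_n)$ for $T_n\le t<T_{n+1}$ and $\xi_t=\Delta$ for $t\ge T_\infty$. For $t<T_\infty$, let $\xi_{t-}$ be the left limit ($\xi_{0-}=X_0$); put $\xi_{t-}=\Delta$ for $t\ge T_\infty$. Let $\mathcal F_t=\sigma(\{T_k\le s,X_k\in D\}:D\in\mathcal B(S),s\le t,k\ge 0)$. In $\Delta$ each player only has an extra isolated action, and $q$, $c$, $g$ are extended by $0$. A *feedback strategy* of player 1 is a predictable (with respect to $(\mathcal F_t)$) transition probability $\pi^1(da|\omega,t)$ concentrated on $A(t,\xi_{t-}(\omega))$; it is *Markov* if $\pi^1(da|\omega,t)=\pi^1(da|\xi_{t-}(\omega),t)$ for a transition probability $\pi^1(da|x,t)$. Strategies $\pi^2$ of player 2 are defined in the same way, with $B$. For feedback strategies, $P_x^{\pi^1,\pi^2}$ is the probability measure on $\Omega$ with $X_0=x$ a.s. under which $m(dy|\omega,t)\,dt$,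 with $$m(D|\omega,t)=\int_B\int_A q(D\setminus\{\xi_{t-}\}\,|\,t,\xi_{t-},a,b)\,\pi^1(da|\omega,t)\,\pi^2(db|\omega,t),$$ is the dual predictable projection of $\sum_{n\ge1,\,T_n<\infty}\delta_{(T_n,X_n)}$ on $(0,\infty)\times S$. For Markov strategies, $P_{(s,x)}^{\pi^1,\pi^2}$ is the law of the same process started at time $s$ in state $x$ (so that jump times and rates are counted from time $s$). Let $$J^{\pi^1,\pi^2}(0,x)=E_x^{\pi^1,\pi^2}\Big[e^{\lambda\int_0^T\int_B\int_A c(t,\xi_t,a,b)\pi^1(da|\omega,t)\pi^2(db|\omega,t)dt+\lambda g(T,\xi_T)}\Big]$$ for feedback strategies and, for Markov strategies and $s\in[0,T]$, $$J^{\pi^1,\pi^2}(s,x)=E_{(s,x)}^{\pi^1,\pi^2}\Big[e^{\lambda\int_s^T\int_B\int_A c(t,\xi_t,a,b)\pi^1(da|\xi_t,t)\pi^2(db|\xi_t,t)dt+\lambda g(T,\xi_T)}\Big].$$ *Assumptions.* There are measurable $V,V_1:S\to[1,\infty)$ and constants $\rho_1,b_1\ge0$, $M_2,M_3\ge 1$,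 $\kappa,\rho_2,b_2>0$ such that 1. $\int_S V(\phi(y,t))q(dy|s,x,a,b)\le\rho_1V(\phi(x,t))+b_1$ for $(s,x,a,b)\in K$, $t\ge0$; 2. there are measurable $S_n\uparrow S$ with $\sup_{(t,x,a,b)\in K,x\in S_n}q(t,x,a,b)<\infty$ for each $n$ and $\lim_n\inf_{x\notin S_n}V(\phi(x,t))=\infty$ for all $t\ge 0$; 3. $e^{2(T+1)|c(t,x,a,b)|}\le M_2V(\phi(x,T-t))$ and $e^{2(T+1)|g(t,x)|}\le M_2V(\phi(x,T-t))$ on $K_{[0,T]}$; 4. $q(s,x,a,b)\le\kappa V(\phi(x,T-s))$ on $K_{[0,T]}$, and $V^2\le M_3V_1$; 5. $\int_S V_1^2(\phi(y,t))q(dy|s,x,a,b)\le\rho_2V_1^2(\phi(x,t))+b_2$ for $(s,x,a,b)\in K_{[0,T]}$, $t\in[0,T-s]$. *Function class.* Let $\varphi\in\mathbb B^{ac}_{V,V_1}([0,T]\times S)$, that is: $\varphi:[0,T]\times S\to\mathbb R$ is measurable, $\sup_{t,x}|\varphi(t,x)|/V(\phi(x,T-t))<\infty$, $t\mapsto\varphi(s+t,\phi(x,t))$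 is absolutely continuous on $[0,T-s]$ for all $(s,x)\in[0,T]\times S$, and there is a set $\mathscr D^\varphi\subset[0,T]\times S$ such that $(s+t,\phi(x,t))\in\mathscr D^\varphi$ for almost all $t\in[0,T-s]$, for every $(s,x)\in[0,T]\times S$; such that the derivative along the flow $$L^\phi\varphi(t,x)=\lim_{h\to0}\frac{\varphi(t+h,\phi(x,h))-\varphi(t,x)}{h}\qquad(t+h\in[0,T])$$ exists on $\mathscr D^\varphi$; and such that $\sup_{(t,x)\in\mathscr D^\varphi}|L^\phi\varphi(t,x)|/V_1(\phi(x,T-t))<\infty$. Fix such a set $\mathscr D^\varphi$. **Corollary 3.1.** Suppose that $\varphi(T,x)=e^{\lambda g(T,x)}$ for all $x\in S$ and that, for all $(t,x)\in\mathscr D^\varphi$ and all probability measures $\mu$ on $A(t,x)$ and $\nu$ on $B(t,x)$, $$L^\phi\varphi(t,x)+\lambda\,c(t,x,\mu,\nu)\,\varphi(t,x)+\int_S\varphi(t,y)\,q(dy|t,x,\mu,\nu)\ \ge\ 0\quad(\text{respectively}\ \le 0),$$ where $c(t,x,\mu,\nu)=\int_B\int_A c(t,x,a,b)\mu(da)\nu(db)$,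 and likewise for $q$. Then the expectations below are finite and (a) $\varphi(0,x)\le J^{\pi^1,\pi^2}(0,x)$ (respectively $\ge$) for all feedback strategies $\pi^1,\pi^2$ and all $x\in S$; (b) $\varphi(t,x)\le J^{\pi^1,\pi^2}(t,x)$ (respectively $\ge$) for all Markov strategies $\pi^1,\pi^2$ and all $(t,x)\in[0,T]\times S$. -/

import Mathlib

open MeasureTheory ProbabilityTheory Set Filter Topology
open scoped NNReal ENNReal

noncomputable section

namespace PDGame

/-! ### The canonical path space -/

/-- A space `α` with one isolated extra point `Δ = Sum.inr ()` adjoined. -/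
abbrev Ext (α : Type*) := α ⊕ Unit

/-- The cemetery point `Δ`. -/
abbrev cem {α : Type*} : Ext α := Sum.inr ()

/-- The sample space `Ω`: sequences `(x₀, θ₁, x₁, θ₂, x₂, …)` with `x₀` in `S` and sojourn times
`θₖ > 0`, which either stay in `S × (0, ∞)` for ever or are equal to `(∞, Δ)` from some
index on. The first component of the pair lists the `xₖ`, the second one lists
`θ₁, θ₂, …` (so that its entry with index `k` is `θₖ₊₁`). -/
def Path (S : Type*) :=
  {w : (ℕ → Ext S) × (ℕ → ℝ≥0∞) //
    w.1 0 ≠ cem ∧ ∀ k, 0 < w.2 k ∧ (w.2 k = ∞ ↔ w.1 (k + 1) = cem) ∧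
      (w.1 k = cem → w.1 (k + 1) = cem)}

instance (S : Type*) [MeasurableSpace S] : MeasurableSpace (Path S) :=
  inferInstanceAs (MeasurableSpace {w : (ℕ → Ext S) × (ℕ → ℝ≥0∞) //
    w.1 0 ≠ cem ∧ ∀ k, 0 < w.2 k ∧ (w.2 k = ∞ ↔ w.1 (k + 1) = cem) ∧
      (w.1 k = cem → w.1 (k + 1) = cem)})

section PathSpace

variable {S : Type*}

/-- The post-jump states `Xₖ`. -/
def mark (ω : Path S) (k : ℕ) : Ext S := ω.1.1 k

/-- The jump times `Tₖ = θ₁ + ⋯ + θₖ`, with `T₀ = 0`. -/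
def jumpTime (ω : Path S) (k : ℕ) : ℝ≥0∞ := ∑ i ∈ Finset.range k, ω.1.2 i

variable [MeasurableSpace S]

theorem measurable_mark (k : ℕ) : Measurable fun ω : Path S => mark ω k :=
  (measurable_pi_apply k).comp (measurable_fst.comp measurable_subtype_coe)

theorem measurable_jumpTime (k : ℕ) : Measurable fun ω : Path S => jumpTime ω k :=
  Finset.measurable_sum _ fun i _ =>
    (measurable_pi_apply i).comp (measurable_snd.comp measurable_subtype_coe)

variable (S) in
/-- The filtration `ℱ_t = σ({T_k ≤ s, X_k ∈ D} : D ∈ 𝓑(S), 0 ≤ s ≤ t, k ≥ 0)`. The predictable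
σ-algebra on `[0, ∞) × Ω` is Mathlib's `(pathFiltration S).predictable`. -/
def pathFiltration : Filtration ℝ≥0 (inferInstance : MeasurableSpace (Path S)) where
  seq t := MeasurableSpace.generateFrom
    {E | ∃ (k : ℕ) (s : ℝ≥0) (D : Set S), s ≤ t ∧ MeasurableSet D ∧
      E = {ω | jumpTime ω k ≤ s ∧ mark ω k ∈ (Sum.inl '' D : Set (Ext S))}}
  mono' := by
    intro t t' h
    apply MeasurableSpace.generateFrom_mono
    rintro E ⟨k, s, D, hs, hD, rfl⟩
    exact ⟨k, s, D, hs.trans h, hD, rfl⟩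
  le' := by
    intro t
    apply MeasurableSpace.generateFrom_le
    rintro E ⟨k, s, D, hs, hD, rfl⟩
    exact (measurableSet_le (measurable_jumpTime k) measurable_const).inter
      (measurable_mark k hD.inl_image)

end PathSpace

/-! ### The game model -/

/-- The game model: a flow on `S`, admissible action sets, transition rates (a conservative and
stable signed kernel on the set `K` of admissible quadruples), running and terminal costs. All
functions of time are only meaningful for times `t ≥ 0`, and `rate` and `cost` only on `K`. -/
structure Game (S A B : Type*) [TopologicalSpace S] [MeasurableSpace S] [MeasurableSpace A]
    [MeasurableSpace B] where
  actA : ℝ → S → Set A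
  actB : ℝ → S → Set B
  rate : ℝ → S → A → B → SignedMeasure S
  flow : S → ℝ → S
  cost : ℝ → S → A → B → ℝ
  term : ℝ → S → ℝ
  measurableSet_actA : ∀ t x, 0 ≤ t → MeasurableSet (actA t x)
  measurableSet_actB : ∀ t x, 0 ≤ t → MeasurableSet (actB t x)
  measurableSet_K : MeasurableSet
    {p : ℝ × S × A × B | 0 ≤ p.1 ∧ p.2.2.1 ∈ actA p.1 p.2.1 ∧ p.2.2.2 ∈ actB p.1 p.2.1}
  measurable_rate : ∀ D : Set S, MeasurableSet D → Measurable
    fun p : {p : ℝ × S × A × B | 0 ≤ p.1 ∧ p.2.2.1 ∈ actA p.1 p.2.1 ∧ p.2.2.2 ∈ actB p.1 p.2.1} =>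
      rate p.1.1 p.1.2.1 p.1.2.2.1 p.1.2.2.2 D
  rate_nonneg : ∀ t x a b, 0 ≤ t → a ∈ actA t x → b ∈ actB t x →
    ∀ D : Set S, MeasurableSet D → x ∉ D → 0 ≤ rate t x a b D
  rate_conservative : ∀ t x a b, 0 ≤ t → a ∈ actA t x → b ∈ actB t x → rate t x a b univ = 0
  rate_stable : ∀ x, ∃ C : ℝ, ∀ t a b, 0 ≤ t → a ∈ actA t x → b ∈ actB t x →
    -rate t x a b {x} ≤ C
  measurable_flow : Measurable fun p : S × ℝ => flow p.1 p.2
  flow_add : ∀ x s t, flow x (s + t) = flow (flow x s) t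
  flow_zero : ∀ x, flow x 0 = x
  continuous_flow : ∀ x, Continuous (flow x)
  measurable_cost : Measurable
    fun p : {p : ℝ × S × A × B | 0 ≤ p.1 ∧ p.2.2.1 ∈ actA p.1 p.2.1 ∧ p.2.2.2 ∈ actB p.1 p.2.1} =>
      cost p.1.1 p.1.2.1 p.1.2.2.1 p.1.2.2.2
  measurable_term : Measurable fun p : {p : ℝ × S | 0 ≤ p.1} => term p.1.1 p.1.2

variable {S A B : Type*} [TopologicalSpace S] [MeasurableSpace S] [MeasurableSpace A]
  [MeasurableSpace B]

namespace Game

/-- `(t, x, a, b) ∈ K`. -/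
def InK (M : Game S A B) (t : ℝ) (x : S) (a : A) (b : B) : Prop :=
  0 ≤ t ∧ a ∈ M.actA t x ∧ b ∈ M.actB t x

/-- The total jump rate `q(t, x, a, b) = -q({x} | t, x, a, b)`. -/
def exitRate (M : Game S A B) (t : ℝ) (x : S) (a : A) (b : B) : ℝ := -M.rate t x a b {x}

/-- The measure `D ↦ q(D \ {x} | t, x, a, b)` of jumps out of `x`: on `K` the signed measure
`q(· | t, x, a, b)` is nonnegative off `x`, so there it agrees with its positive part. -/
def jumpMeasure (M : Game S A B) (t : ℝ) (x : S) (a : A) (b : B) : Measure S :=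
  (M.rate t x a b).toJordanDecomposition.posPart.restrict {x}ᶜ

/-- The jump measure, extended by `0` to the cemetery. -/
def jumpMeasureExt (M : Game S A B) (t : ℝ) : Ext S → Ext A → Ext B → Measure S
  | Sum.inl x, Sum.inl a, Sum.inl b => M.jumpMeasure t x a b
  | _, _, _ => 0

/-- The running cost, extended by `0` to the cemetery. -/
def costExt (M : Game S A B) (t : ℝ) : Ext S → Ext A → Ext B → ℝ
  | Sum.inl x, Sum.inl a, Sum.inl b => M.cost t x a b
  | _, _, _ => 0

/-- The terminal cost, extended by `0` to the cemetery. -/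
def termExt (M : Game S A B) (t : ℝ) : Ext S → ℝ
  | Sum.inl x => M.term t x
  | Sum.inr _ => 0

/-! ### The state process -/

open Classical in
/-- The state process: `ξ_t = φ(X_n, t - T_n)` for `T_n ≤ t < T_{n+1}`, and `ξ_t = Δ` for
`t ≥ T_∞`. -/
def state (M : Game S A B) (ω : Path S) (t : ℝ≥0) : Ext S :=
  if h : ∃ n, jumpTime ω n ≤ t ∧ (t : ℝ≥0∞) < jumpTime ω (n + 1) then
    Sum.map (fun y => M.flow y (t - (jumpTime ω (Nat.find h)).toReal)) id (mark ω (Nat.find h))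
  else cem

open Classical in
/-- The left limit `ξ_{t-}` of the state process. As the flow is continuous in time, it is
`φ(X_n, t - T_n)` for `T_n < t ≤ T_{n+1}`; moreover `ξ_{0-} = X_0`, and `ξ_{t-} = Δ` for
`t ≥ T_∞`. -/
def leftState (M : Game S A B) (ω : Path S) (t : ℝ≥0) : Ext S :=
  if t = 0 then mark ω 0
  else if h : ∃ n, jumpTime ω n < t ∧ (t : ℝ≥0∞) ≤ jumpTime ω (n + 1) then
    Sum.map (fun y => M.flow y (t - (jumpTime ω (Nat.find h)).toReal)) id (mark ω (Nat.find h))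
  else cem

/-- The actions admissible at time `t` in a state of `S ∪ {Δ}`, for an action set `act` of one of
the players: only the extra action is admissible in `Δ`. -/
def _root_.PDGame.admissible {Act : Type*} (act : ℝ → S → Set Act) (t : ℝ≥0) :
    Ext S → Set (Ext Act)
  | Sum.inl x => Sum.inl '' act t x
  | Sum.inr _ => {cem}

/-! ### Strategies -/

/-- An admissible feedback strategy of a player with action sets `act`: a predictable transition
probability `π(da | ω, t)` which is concentrated on the actions admissible in `ξ_{t-}`. -/
structure FeedbackStrategy (M : Game S A B) {Act : Type*} [MeasurableSpace Act]
    (act : ℝ → S → Set Act) where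
  toKernel : @Kernel (ℝ≥0 × Path S) (Ext Act) (pathFiltration S).predictable inferInstance
  prob : ∀ t ω, IsProbabilityMeasure (toKernel (t, ω))
  adm : ∀ t ω, toKernel (t, ω) (admissible act t (M.leftState ω t)) = 1

/-- The action law at time `t` in a state of `S ∪ {Δ}` given by a kernel `π(da | x, t)`. -/
def _root_.PDGame.markovLaw {Act : Type*} [MeasurableSpace Act] (k : Kernel (ℝ≥0 × S) Act)
    (t : ℝ≥0) : Ext S → Measure (Ext Act)
  | Sum.inl x => (k (t, x)).map Sum.inl
  | Sum.inr _ => Measure.dirac cem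

/-- A Markov strategy: a feedback strategy with `π(da | ω, t) = π(da | ξ_{t-}(ω), t)`. -/
structure MarkovStrategy (M : Game S A B) {Act : Type*} [MeasurableSpace Act]
    (act : ℝ → S → Set Act) extends M.FeedbackStrategy act where
  markov : Kernel (ℝ≥0 × S) Act
  eq_markov : ∀ t ω, toKernel (t, ω) = markovLaw markov t (M.leftState ω t)

/-! ### The law of the process -/

/-- `∫∫∫_{S \ {z}} h(y) q(dy | t, z, a, b) α(da) β(db)`, the integral of `h` against the jump
intensity at time `t` in the state `z` under the action laws `α` and `β`. -/
def jumpIntegral (M : Game S A B) (t : ℝ) (z : Ext S) (α : Measure (Ext A))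
    (β : Measure (Ext B)) (h : S → ℝ≥0∞) : ℝ≥0∞ :=
  ∫⁻ b, (∫⁻ a, (∫⁻ y, h y ∂(M.jumpMeasureExt t z a b)) ∂α) ∂β

/-- `P` is the law of the controlled process which starts at time `s` in the state `x`, where
the players act at time `s + u` according to the (random) action laws `α ω u` and `β ω u`. The path
`ω` is run in the time `u ≥ 0` that has elapsed since `s`.

Under `P` the initial state is `x`, and the random measure
`m(dy | ω, u) du`, with `m(D | ω, u) = ∫∫ q(D \ {ξ_{u-}} | s + u, ξ_{u-}, a, b) α(da) β(db)`,
is the dual predictable projection of the random measure `∑_{n ≥ 1} δ_{(T_n, X_n)}` on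
`(0, ∞) × S`, that is,
`E ∑_{n ≥ 1, T_n < ∞} Y(T_n, X_n) = E ∫_0^∞ ∫_S Y(u, y) m(dy | u) du`
for every nonnegative predictable `Y`. -/
structure IsLaw (M : Game S A B) (s : ℝ≥0) (x : S)
    (α : Path S → ℝ≥0 → Measure (Ext A)) (β : Path S → ℝ≥0 → Measure (Ext B))
    (P : Measure (Path S)) : Prop where
  prob : IsProbabilityMeasure P
  init : ∀ᵐ ω ∂P, mark ω 0 = Sum.inl x
  compensator : ∀ Y : ℝ≥0 → Path S → S → ℝ≥0∞,
    @Measurable ((ℝ≥0 × Path S) × S) ℝ≥0∞ ((pathFiltration S).predictable.prod inferInstance) _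
      (fun p => Y p.1.1 p.1.2 p.2) →
    ∫⁻ ω, ∑' n : ℕ, Sum.elim (fun y => Y (jumpTime ω (n + 1)).toNNReal ω y) (fun _ => 0)
        (mark ω (n + 1)) ∂P =
      ∫⁻ ω, (∫⁻ u in Ioi (0 : ℝ), M.jumpIntegral (s + u) (M.leftState ω u.toNNReal)
        (α ω u.toNNReal) (β ω u.toNNReal) (Y u.toNNReal ω)) ∂P

/-- `P = P_x^{π¹, π²}` for feedback strategies. -/
def IsFeedbackLaw (M : Game S A B) (x : S) (π₁ : M.FeedbackStrategy M.actA)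
    (π₂ : M.FeedbackStrategy M.actB) (P : Measure (Path S)) : Prop :=
  M.IsLaw 0 x (fun ω t => π₁.toKernel (t, ω)) (fun ω t => π₂.toKernel (t, ω)) P

/-- `P = P_{(s, x)}^{π¹, π²}` for Markov strategies. -/
def IsMarkovLaw (M : Game S A B) (s : ℝ≥0) (x : S) (π₁ : M.MarkovStrategy M.actA)
    (π₂ : M.MarkovStrategy M.actB) (P : Measure (Path S)) : Prop :=
  M.IsLaw s x (fun ω u => markovLaw π₁.markov (s + u) (M.leftState ω u))
    (fun ω u => markovLaw π₂.markov (s + u) (M.leftState ω u)) P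

/-! ### The risk-sensitive cost -/

/-- The random variable `exp (λ ∫_s^T ∫∫ c(t, ξ_t, a, b) α(da) β(db) dt + λ g(T, ξ_T))`, for a
process started at time `s`, where `α` and `β` are evaluated at the elapsed time `t - s`. -/
def riskCost (M : Game S A B) (T lam : ℝ) (s : ℝ≥0)
    (α : Path S → ℝ≥0 → Measure (Ext A)) (β : Path S → ℝ≥0 → Measure (Ext B)) (ω : Path S) : ℝ :=
  Real.exp (lam * (∫ t in (s : ℝ)..T, (∫ b, (∫ a, M.costExt t (M.state ω (t - s).toNNReal) a b
      ∂(α ω (t - s).toNNReal)) ∂(β ω (t - s).toNNReal)))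
    + lam * M.termExt T (M.state ω (T - s).toNNReal))

/-- The random variable whose `P_x^{π¹, π²}`-expectation is `J^{π¹, π²}(0, x)`. -/
def feedbackCost (M : Game S A B) (T lam : ℝ) (π₁ : M.FeedbackStrategy M.actA)
    (π₂ : M.FeedbackStrategy M.actB) : Path S → ℝ :=
  M.riskCost T lam 0 (fun ω t => π₁.toKernel (t, ω)) (fun ω t => π₂.toKernel (t, ω))

/-- The random variable whose `P_{(s, x)}^{π¹, π²}`-expectation is `J^{π¹, π²}(s, x)`. -/
def markovCost (M : Game S A B) (T lam : ℝ) (s : ℝ≥0) (π₁ : M.MarkovStrategy M.actA)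
    (π₂ : M.MarkovStrategy M.actB) : Path S → ℝ :=
  M.riskCost T lam s (fun ω u => markovLaw π₁.markov (s + u) (M.state ω u))
    (fun ω u => markovLaw π₂.markov (s + u) (M.state ω u))

/-! ### The standing assumptions -/

/-- The drift, non-explosion and growth conditions on `V`. -/
structure Drift (M : Game S A B) (T : ℝ) (V : S → ℝ) : Prop where
  measurable : Measurable V
  one_le : ∀ x, 1 ≤ V x
  drift : ∃ ρ₁ b₁ : ℝ, 0 ≤ ρ₁ ∧ 0 ≤ b₁ ∧ ∀ s x a b t, M.InK s x a b → 0 ≤ t →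
    (M.rate s x a b).Integrable (fun y => V (M.flow y t)) ∧
    ∫ᵛ y, V (M.flow y t) ∂<•(M.rate s x a b) ≤ ρ₁ * V (M.flow x t) + b₁
  exhaust : ∃ Sn : ℕ → Set S, (∀ n, MeasurableSet (Sn n)) ∧ Monotone Sn ∧ ⋃ n, Sn n = univ ∧
    (∀ n, ∃ C : ℝ, ∀ t x a b, M.InK t x a b → x ∈ Sn n → M.exitRate t x a b ≤ C) ∧
    ∀ t : ℝ, 0 ≤ t →
      Tendsto (fun n => ⨅ x ∈ (Sn n)ᶜ, ((V (M.flow x t) : ℝ) : EReal)) atTop (𝓝 ⊤)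
  growth : ∃ M₂ : ℝ, 1 ≤ M₂ ∧ ∀ t x a b, M.InK t x a b → t ≤ T →
    Real.exp (2 * (T + 1) * |M.cost t x a b|) ≤ M₂ * V (M.flow x (T - t)) ∧
    Real.exp (2 * (T + 1) * |M.term t x|) ≤ M₂ * V (M.flow x (T - t))

/-- The conditions relating the weights `V` and `V₁`. -/
structure SecondDrift (M : Game S A B) (T : ℝ) (V V₁ : S → ℝ) : Prop where
  measurable : Measurable V₁
  one_le : ∀ x, 1 ≤ V₁ x
  exitRate_le : ∃ κ : ℝ, 0 < κ ∧ ∀ s x a b, M.InK s x a b → s ≤ T →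
    M.exitRate s x a b ≤ κ * V (M.flow x (T - s))
  sq_le : ∃ M₃ : ℝ, 1 ≤ M₃ ∧ ∀ x, V x ^ 2 ≤ M₃ * V₁ x
  drift : ∃ ρ₂ b₂ : ℝ, 0 < ρ₂ ∧ 0 < b₂ ∧ ∀ s x a b t, M.InK s x a b → s ≤ T →
    t ∈ Icc 0 (T - s) →
    (M.rate s x a b).Integrable (fun y => V₁ (M.flow y t) ^ 2) ∧
    ∫ᵛ y, V₁ (M.flow y t) ^ 2 ∂<•(M.rate s x a b) ≤ ρ₂ * V₁ (M.flow x t) ^ 2 + b₂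

/-! ### The function class and the Shapley operator -/

/-- The derivative along the flow,
`L φ (t, x) = lim_{h → 0} (φ(t + h, φ(x, h)) - φ(t, x)) / h`, where `t + h` stays in `[0, T]`. -/
def flowDeriv (M : Game S A B) (T : ℝ) (f : ℝ → S → ℝ) (t : ℝ) (x : S) : ℝ :=
  derivWithin (fun h => f (t + h) (M.flow x h)) (Icc (-t) (T - t)) 0

/-- `f` belongs to `B^{ac}_{V, V₁}([0, T] × S)`, where `D ⊆ [0, T] × S` is a set on which the
derivative along the flow exists and whose complement meets every trajectory of the flow in a
null set of times. -/
structure MemBac (M : Game S A B) (T : ℝ) (V V₁ : S → ℝ) (D : Set (ℝ × S)) (f : ℝ → S → ℝ) :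
    Prop where
  measurable : Measurable fun p : {p : ℝ × S | p.1 ∈ Icc 0 T} => f p.1.1 p.1.2
  bounded : ∃ C : ℝ, ∀ t ∈ Icc 0 T, ∀ x, |f t x| ≤ C * V (M.flow x (T - t))
  absCont : ∀ s ∈ Icc 0 T, ∀ x,
    AbsolutelyContinuousOnInterval (fun t => f (s + t) (M.flow x t)) 0 (T - s)
  time_mem : ∀ p ∈ D, p.1 ∈ Icc 0 T
  differentiable : ∀ p ∈ D, DifferentiableWithinAt ℝ (fun h => f (p.1 + h) (M.flow p.2 h))
    (Icc (-p.1) (T - p.1)) 0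
  ae_mem : ∀ s ∈ Icc 0 T, ∀ x,
    ∀ᵐ t ∂(volume.restrict (Icc 0 (T - s))), (s + t, M.flow x t) ∈ D
  deriv_bounded : ∃ C : ℝ, ∀ p ∈ D,
    |M.flowDeriv T f p.1 p.2| ≤ C * V₁ (M.flow p.2 (T - p.1))

/-- `L f(t, x) + λ c(t, x, μ, ν) f(t, x) + ∫_S f(t, y) q(dy | t, x, μ, ν)`. -/
def shapley (M : Game S A B) (T lam : ℝ) (f : ℝ → S → ℝ) (t : ℝ) (x : S) (μ : Measure A)
    (ν : Measure B) : ℝ :=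
  M.flowDeriv T f t x + (lam * (∫ b, (∫ a, M.cost t x a b ∂μ) ∂ν) * f t x
    + ∫ b, (∫ a, (∫ᵛ y, f t y ∂<•(M.rate t x a b)) ∂μ) ∂ν)

/-- `μ ∈ P(A(t, x))` and `ν ∈ P(B(t, x))`. -/
def MixedActions (M : Game S A B) (t : ℝ) (x : S) (μ : Measure A) (ν : Measure B) : Prop :=
  IsProbabilityMeasure μ ∧ IsProbabilityMeasure ν ∧ μ (M.actA t x) = 1 ∧ ν (M.actB t x) = 1

end Game

end PDGame

end

/-! The argument is a Dynkin formula with inequality for Z_u = exp(λ ∫₀ᵘ c) φ(s + u, ξ_u), where u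
is the time elapsed since the start s and τ = T - s. Between jumps the state follows the flow, so Z
is absolutely continuous there. By the product rule, the Shapley inequality bounds its derivative
below by minus the discounted integral of φ(·, z) - φ(·, ξ_{u-}) against the jump intensity. At a
jump, Z changes by exactly this discounted difference. Adding up the pieces (`Subsolution.le_path`)
shows that Z_τ is at least φ(s, x) plus the discounted jumps minus the time integral of their
intensity. The discounted jump is a predictable integrand, so the last two terms have equal
expectations by the definition of the dual predictable projection, and φ(s, x) ≤ E Z_τ follows
(`Subsolution.le_integral`). Almost surely no jump occurs at τ, hence Z_τ is the exponential cost
(`riskCost_eq`).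

The cancellation requires finite expectations. The intensity of |φ(·, z) - φ(·, ξ_{u-})| is at most
a multiple of V², and Jensen's inequality with the exponential growth condition on c bounds the
square of the discount by 1 plus a time integral of V (`Controlled.discount_sq_le`). Then discount ·
V² ≤ discount² + V⁴, and V⁴ is dominated by V₁². It remains to bound the means of V and V₁² along
the process.

These moments come from the drift conditions (`lintegral_flowValue_le`). A weight evaluated at
φ(ξ_u, τ - u) is constant between jumps, so only jumps and the discount e^{-ρu} change it. The
estimate is proved for truncated weights up to the n-th jump, where everything is finite, and then
passed to the limit. As the total jump rate is bounded by a multiple of V, its mean is integrable in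
time, which excludes infinitely many jumps before τ.

All this is done for an abstract predictable intensity kernel. The game enters by averaging rates
and costs over the action laws (`gameIntensity`, `gameCost`), which covers feedback and Markov
strategies at once. The reverse inequality is the same statement for -φ. -/

noncomputable section

namespace PDGame

/-! ### Jump times and the pieces between them -/

section Paths

variable {S : Type*}

theorem jumpTime_zero (ω : Path S) : jumpTime ω 0 = 0 := by simp [jumpTime]

theorem jumpTime_succ (ω : Path S) (k : ℕ) : jumpTime ω (k + 1) = jumpTime ω k + ω.1.2 k := by
  simp [jumpTime, Finset.sum_range_succ]

theorem jumpTime_mono (ω : Path S) : Monotone (jumpTime ω) :=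
  monotone_nat_of_le_succ fun k => by rw [jumpTime_succ]; exact le_self_add

theorem jumpTime_lt_succ (ω : Path S) {k : ℕ} (h : jumpTime ω k ≠ ∞) :
    jumpTime ω k < jumpTime ω (k + 1) := by
  rw [jumpTime_succ]
  exact ENNReal.lt_add_right h (ω.2.2 k).1.ne'

/-- Finiteness of a jump time and membership of the mark in `S` propagate together, because a
sojourn time is infinite exactly when the next mark is the cemetery. -/
theorem mark_ne_cem_iff (ω : Path S) (k : ℕ) : mark ω k ≠ cem ↔ jumpTime ω k ≠ ∞ := by
  induction k with
  | zero => exact ⟨fun _ => by simp [jumpTime_zero], fun _ => ω.2.1⟩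
  | succ k ih =>
    have h := ω.2.2 k
    rw [jumpTime_succ, ENNReal.add_ne_top, ← ih]
    constructor
    · intro h'
      exact ⟨fun h2 => h' (h.2.2 h2), fun h2 => h' (h.2.1.1 h2)⟩
    · rintro ⟨-, h2⟩ h3
      exact h2 (h.2.1.2 h3)

theorem exists_mark_eq {ω : Path S} {k : ℕ} (h : jumpTime ω k ≠ ∞) :
    ∃ y, mark ω k = Sum.inl y := by
  rw [← mark_ne_cem_iff] at h
  rcases hm : mark ω k with y | z
  · exact ⟨y, rfl⟩
  · exact absurd hm h

theorem jumpTime_ne_top_of_mark {ω : Path S} {k : ℕ} {y : S} (h : mark ω k = Sum.inl y) :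
    jumpTime ω k ≠ ∞ := by
  rw [← mark_ne_cem_iff, h]
  simp

/-- `u` lies in the `N`-th interval `(T_N, T_{N+1}]` between jumps, where `0` belongs to the first
one. -/
def OnPiece (ω : Path S) (u : ℝ≥0) (N : ℕ) : Prop :=
  (N = 0 ∨ jumpTime ω N < u) ∧ (u : ℝ≥0∞) ≤ jumpTime ω (N + 1)

theorem OnPiece.jumpTime_le {ω : Path S} {u : ℝ≥0} {N : ℕ} (h : OnPiece ω u N) :
    jumpTime ω N ≤ u := by
  rcases h.1 with rfl | h
  · simp [jumpTime_zero]
  · exact h.le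

theorem OnPiece.ne_top {ω : Path S} {u : ℝ≥0} {N : ℕ} (h : OnPiece ω u N) :
    jumpTime ω N ≠ ∞ := (h.jumpTime_le.trans_lt ENNReal.coe_lt_top).ne

theorem OnPiece.unique {ω : Path S} {u : ℝ≥0} {N N' : ℕ} (h : OnPiece ω u N)
    (h' : OnPiece ω u N') : N = N' := by
  have key : ∀ {i j : ℕ}, OnPiece ω u i → OnPiece ω u j → ¬ i < j := by
    intro i j hi hj hij
    rcases hj.1 with rfl | h3
    · omega
    · exact absurd (hi.2.trans (jumpTime_mono ω hij)) (not_le.2 h3)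
  have h1 := key h h'
  have h2 := key h' h
  omega

theorem OnPiece.lt_iff {ω : Path S} {u : ℝ≥0} {N : ℕ} (h : OnPiece ω u N) (k : ℕ) :
    jumpTime ω (k + 1) < u ↔ k < N := by
  constructor
  · intro hk
    by_contra hN
    exact absurd (h.2.trans (jumpTime_mono ω (by omega : N + 1 ≤ k + 1))) (not_le.2 hk)
  · intro hk
    rcases h.1 with rfl | h3
    · omega
    · exact (jumpTime_mono ω (by omega : k + 1 ≤ N)).trans_lt h3

theorem onPiece_jumpTime {ω : Path S} {N : ℕ} (h : jumpTime ω (N + 1) ≠ ∞) :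
    OnPiece ω (jumpTime ω (N + 1)).toNNReal N := by
  have h0 : jumpTime ω N ≠ ∞ := ne_top_of_le_ne_top h (jumpTime_mono ω N.le_succ)
  rw [OnPiece, ENNReal.coe_toNNReal h]
  exact ⟨Or.inr (jumpTime_lt_succ ω h0), le_rfl⟩

/-- Only finitely many jumps before `u` means that `u` lies between two jumps. -/
theorem exists_onPiece {ω : Path S} {u : ℝ≥0} (h : ∃ n, (u : ℝ≥0∞) ≤ jumpTime ω n) :
    ∃ N, OnPiece ω u N := by
  classical
  rcases hn : Nat.find h with _ | N
  · have := Nat.find_spec h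
    rw [hn, jumpTime_zero] at this
    exact ⟨0, Or.inl rfl, this.trans zero_le⟩
  · have h1 := Nat.find_spec h
    rw [hn] at h1
    exact ⟨N, Or.inr (not_le.1 (Nat.find_min h (by omega))), h1⟩

end Paths

/-! ### The state and its left limit on a piece -/

section LeftState

variable {S A B : Type*} [TopologicalSpace S] [MeasurableSpace S] [MeasurableSpace A]
  [MeasurableSpace B] (M : Game S A B)

/-- A time lies on at most one piece, so the index found by `Nat.find` is the given one. Time 0 is
counted in piece 0, where the flow has not yet moved the initial state. -/
theorem leftState_of_onPiece {ω : Path S} {u : ℝ≥0} {N : ℕ} (h : OnPiece ω u N) :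
    M.leftState ω u =
      Sum.map (fun y => M.flow y (u - (jumpTime ω N).toReal)) id (mark ω N) := by
  classical
  unfold Game.leftState
  split_ifs with h0 h1
  · have hN : N = 0 := by
      rcases h.1 with h2 | h2
      · exact h2
      · simp [h0] at h2
    subst hN
    obtain ⟨y, hy⟩ := exists_mark_eq h.ne_top
    simp [h0, jumpTime_zero, hy, M.flow_zero]
  · have h2 : OnPiece ω u (Nat.find h1) := ⟨Or.inr (Nat.find_spec h1).1, (Nat.find_spec h1).2⟩
    rw [h.unique h2]
  · refine absurd ⟨N, ?_, h.2⟩ h1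
    rcases h.1 with rfl | h2
    · rw [jumpTime_zero]; exact_mod_cast pos_iff_ne_zero.2 h0
    · exact h2

theorem leftState_of_onPiece_of_mark {ω : Path S} {u : ℝ≥0} {N : ℕ} {y : S} (h : OnPiece ω u N)
    (hy : mark ω N = Sum.inl y) :
    M.leftState ω u = Sum.inl (M.flow y (u - (jumpTime ω N).toReal)) := by
  rw [leftState_of_onPiece M h, hy]; rfl

theorem exists_onPiece_of_leftState {ω : Path S} {u : ℝ≥0} {y : S}
    (h : M.leftState ω u = Sum.inl y) : ∃ N, OnPiece ω u N := by
  classical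
  unfold Game.leftState at h
  split_ifs at h with h0 h1
  · exact ⟨0, Or.inl rfl, by simp [h0]⟩
  · obtain ⟨N, h2, h3⟩ := h1
    exact ⟨N, Or.inr h2, h3⟩

theorem leftState_eq_inl_iff {ω : Path S} {u : ℝ≥0} {z : S} :
    M.leftState ω u = Sum.inl z ↔ ∃ N y, OnPiece ω u N ∧ mark ω N = Sum.inl y ∧
      z = M.flow y (u - (jumpTime ω N).toReal) := by
  constructor
  · intro h
    obtain ⟨N, hN⟩ := exists_onPiece_of_leftState M h
    obtain ⟨y, hy⟩ := exists_mark_eq hN.ne_top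
    refine ⟨N, y, hN, hy, ?_⟩
    rw [leftState_of_onPiece_of_mark M hN hy] at h
    exact (Sum.inl.inj h).symm
  · rintro ⟨N, y, hN, hy, rfl⟩
    exact leftState_of_onPiece_of_mark M hN hy

/-- The state and its left limit differ at jump times only. -/
theorem state_eq_leftState {ω : Path S} {u : ℝ≥0} (h : ∀ k, jumpTime ω (k + 1) ≠ u) :
    M.state ω u = M.leftState ω u := by
  classical
  by_cases h1 : ∃ N, OnPiece ω u N
  · obtain ⟨N, hN⟩ := h1
    have h2 : ∃ n, jumpTime ω n ≤ u ∧ (u : ℝ≥0∞) < jumpTime ω (n + 1) :=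
      ⟨N, hN.jumpTime_le, lt_of_le_of_ne hN.2 (h N).symm⟩
    have h3 : OnPiece ω u (Nat.find h2) := by
      refine ⟨?_, (Nat.find_spec h2).2.le⟩
      rcases hn : Nat.find h2 with _ | n
      · exact Or.inl rfl
      · refine Or.inr (lt_of_le_of_ne ?_ (h n))
        have := (Nat.find_spec h2).1
        rwa [hn] at this
    rw [leftState_of_onPiece M h3, Game.state, dif_pos h2]
  · have h2 : ¬ ∃ n, jumpTime ω n ≤ u ∧ (u : ℝ≥0∞) < jumpTime ω (n + 1) := by
      rintro ⟨n, -, h3⟩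
      exact h1 (exists_onPiece ⟨n + 1, h3.le⟩)
    rw [Game.state, dif_neg h2]
    rcases h3 : M.leftState ω u with y | z
    · exact absurd (exists_onPiece_of_leftState M h3) h1
    · rfl

end LeftState

/-- The product `[0, ∞) × Ω` with its predictable σ-algebra. -/
structure TimePath (S : Type*) where
  /-- The time. -/
  time : ℝ≥0
  /-- The sample path. -/
  path : Path S

/-! ### Predictability of jump times and marks -/

section Predictable

variable {S : Type*} [MeasurableSpace S]

/-- The pairs in `ℝ≥0 × Path S` already carry the product σ-algebra as an instance. A separate type
lets the predictable one be the instance, so that kernels and measurability on it are predictable by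
default. -/
instance : MeasurableSpace (TimePath S) :=
  (pathFiltration S).predictable.comap fun p => (p.time, p.path)

theorem measurable_mk_predictable :
    Measurable[(pathFiltration S).predictable] fun p : ℝ≥0 × Path S => TimePath.mk p.1 p.2 := by
  rw [measurable_iff_comap_le]
  exact (MeasurableSpace.comap_comp).le.trans MeasurableSpace.comap_id.le

theorem measurableSet_timePath_Ioi {r : ℝ≥0} {s : Set (Path S)}
    (hs : MeasurableSet[pathFiltration S r] s) :
    MeasurableSet {p : TimePath S | r < p.time ∧ p.path ∈ s} :=
  ⟨Ioi r ×ˢ s, measurableSet_predictable_Ioi_prod hs, rfl⟩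

theorem measurableSet_timePath_zero {s : Set (Path S)}
    (hs : MeasurableSet[pathFiltration S 0] s) :
    MeasurableSet {p : TimePath S | p.time = 0 ∧ p.path ∈ s} :=
  ⟨{⊥} ×ˢ s, measurableSet_predictable_singleton_bot_prod hs, rfl⟩

theorem measurable_time : Measurable fun p : TimePath S => p.time := by
  refine measurable_of_Ioi fun r => ?_
  convert measurableSet_timePath_Ioi (S := S) (r := r) MeasurableSet.univ using 1
  ext p
  simp

theorem predictable_le_prod :
    (pathFiltration S).predictable ≤ (inferInstance : MeasurableSpace (ℝ≥0 × Path S)) :=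
  measurableSpace_le_predictable_of_measurableSet
    (fun _ hs => (measurableSet_singleton _).prod ((pathFiltration S).le _ _ hs))
    (fun _ _ hs => measurableSet_Ioi.prod ((pathFiltration S).le _ _ hs))

theorem measurable_toTimePath {X : Type*} [MeasurableSpace X] {f : X → ℝ≥0} {g : X → Path S}
    (hf : Measurable f) (hg : Measurable g) :
    Measurable fun x => TimePath.mk (f x) (g x) :=
  (measurable_mk_predictable.mono predictable_le_prod le_rfl).comp (hf.prodMk hg)

theorem measurableSet_jump_event (k : ℕ) (r : ℝ≥0) {D : Set S} (hD : MeasurableSet D) :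
    MeasurableSet[pathFiltration S r]
      {ω | jumpTime ω k ≤ r ∧ mark ω k ∈ (Sum.inl '' D : Set (Ext S))} :=
  MeasurableSpace.measurableSet_generateFrom ⟨k, r, D, le_rfl, hD, rfl⟩

/-- The event `T_k < u`, `T_k ≤ r`, `X_k ∈ D` is predictable. -/
theorem measurableSet_jump_before (k : ℕ) (r : ℝ≥0) {D : Set S} (hD : MeasurableSet D) :
    MeasurableSet {p : TimePath S | jumpTime p.path k < p.time ∧ jumpTime p.path k ≤ r ∧
      mark p.path k ∈ (Sum.inl '' D : Set (Ext S))} := by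
  -- A rational q between T_k and u splits the event: {T_k ≤ min(q, r), X_k ∈ D} is known at time q,
  -- and the product of (q, ∞) with such an event is predictable.
  have h : {p : TimePath S | jumpTime p.path k < p.time ∧ jumpTime p.path k ≤ r ∧
      mark p.path k ∈ (Sum.inl '' D : Set (Ext S))} =
      ⋃ q : ℚ, {p : TimePath S | Real.toNNReal q < p.time ∧
        p.path ∈ {ω | jumpTime ω k ≤ (min (Real.toNNReal q) r : ℝ≥0) ∧
          mark ω k ∈ (Sum.inl '' D : Set (Ext S))}} := by
    ext ⟨u, ω⟩
    simp only [mem_ofPred_eq, mem_iUnion]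
    constructor
    · rintro ⟨h1, h2, h3⟩
      obtain ⟨q, -, hq1, hq2⟩ := ENNReal.lt_iff_exists_rat_btwn.1 h1
      refine ⟨q, by exact_mod_cast hq2, ?_, h3⟩
      rw [ENNReal.coe_min]
      exact le_min hq1.le h2
    · rintro ⟨q, h1, h2, h3⟩
      rw [ENNReal.coe_min] at h2
      refine ⟨(h2.trans (min_le_left _ _)).trans_lt (by exact_mod_cast h1),
        h2.trans (min_le_right _ _), h3⟩
  rw [h]
  refine MeasurableSet.iUnion fun q => measurableSet_timePath_Ioi ?_
  exact (pathFiltration S).mono (min_le_left _ _) _ (measurableSet_jump_event k _ hD)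

theorem measurableSet_mark_before (k : ℕ) {D : Set S} (hD : MeasurableSet D) :
    MeasurableSet {p : TimePath S | jumpTime p.path k < p.time ∧
      mark p.path k ∈ (Sum.inl '' D : Set (Ext S))} := by
  have h : {p : TimePath S | jumpTime p.path k < p.time ∧
      mark p.path k ∈ (Sum.inl '' D : Set (Ext S))} =
      ⋃ n : ℕ, {p : TimePath S | jumpTime p.path k < p.time ∧ jumpTime p.path k ≤ ((n : ℝ≥0) : ℝ≥0∞) ∧
      mark p.path k ∈ (Sum.inl '' D : Set (Ext S))} := by
    ext ⟨u, ω⟩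
    simp only [mem_ofPred_eq, mem_iUnion]
    constructor
    · rintro ⟨h1, h2⟩
      obtain ⟨n, hn⟩ := ENNReal.exists_nat_gt (h1.trans ENNReal.coe_lt_top).ne
      exact ⟨n, h1, by simpa using hn.le, h2⟩
    · rintro ⟨n, h1, -, h2⟩
      exact ⟨h1, h2⟩
  rw [h]
  exact MeasurableSet.iUnion fun n => measurableSet_jump_before k n hD

omit [MeasurableSpace S] in
theorem mark_mem_range {ω : Path S} {k : ℕ} (h : jumpTime ω k ≠ ∞) :
    mark ω k ∈ (Sum.inl '' (univ : Set S) : Set (Ext S)) := by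
  obtain ⟨y, hy⟩ := exists_mark_eq h
  exact ⟨y, mem_univ _, hy.symm⟩

theorem measurableSet_jumpTime_lt (k : ℕ) :
    MeasurableSet {p : TimePath S | jumpTime p.path k < p.time} := by
  convert measurableSet_mark_before (S := S) k MeasurableSet.univ using 3 with p
  exact ⟨fun h => ⟨h, mark_mem_range (h.trans ENNReal.coe_lt_top).ne⟩, fun h => h.1⟩

theorem measurableSet_onPiece (N : ℕ) :
    MeasurableSet {p : TimePath S | OnPiece p.path p.time N} := by
  have h1 : MeasurableSet {p : TimePath S | N = 0 ∨ jumpTime p.path N < p.time} :=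
    (MeasurableSet.const _).union (measurableSet_jumpTime_lt N)
  have h2 : MeasurableSet {p : TimePath S | (p.time : ℝ≥0∞) ≤ jumpTime p.path (N + 1)} := by
    convert (measurableSet_jumpTime_lt (S := S) (N + 1)).compl using 1
    ext p
    simp
  exact h1.inter h2

/-- The time of the last jump but `N`, as a predictable process on `{T_N < u}`. -/
def lastTime (N : ℕ) (p : TimePath S) : ℝ≥0 :=
  open Classical in if jumpTime p.path N < p.time then (jumpTime p.path N).toNNReal else 0

theorem measurable_lastTime (N : ℕ) : Measurable (lastTime (S := S) N) := by
  refine measurable_of_Iic fun r => ?_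
  -- Before the N-th jump the default value 0 always lies in `Iic r`, which contributes the
  -- complement.
  have h : lastTime (S := S) N ⁻¹' Iic r =
      {p : TimePath S | jumpTime p.path N < p.time ∧ jumpTime p.path N ≤ r ∧
        mark p.path N ∈ (Sum.inl '' (univ : Set S) : Set (Ext S))} ∪
      {p : TimePath S | jumpTime p.path N < p.time}ᶜ := by
    ext ⟨u, ω⟩
    simp only [mem_preimage, lastTime, mem_Iic, mem_union, mem_ofPred_eq, mem_compl_iff]
    split_ifs with h
    · have h1 := (h.trans ENNReal.coe_lt_top).ne
      simp only [h, true_and, not_true_eq_false, or_false, mark_mem_range h1, and_true]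
      rw [← ENNReal.coe_le_coe, ENNReal.coe_toNNReal h1]
    · simp [h]
  rw [h]
  exact (measurableSet_jump_before N r MeasurableSet.univ).union
    (measurableSet_jumpTime_lt N).compl

/-- The post-jump state `X_N`, as a predictable process on the `N`-th piece. -/
def lastMark (x₀ : S) (N : ℕ) (p : TimePath S) : S :=
  open Classical in if OnPiece p.path p.time N then Sum.elim id (fun _ => x₀) (mark p.path N) else x₀

theorem measurable_lastMark (x₀ : S) (N : ℕ) : Measurable (lastMark x₀ N) := by
  classical
  intro D hD
  have h1 : MeasurableSet {p : TimePath S | OnPiece p.path p.time N ∧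
      mark p.path N ∈ (Sum.inl '' D : Set (Ext S))} := by
    -- Piece 0 contains time 0, where no strictly earlier jump is available. There the event {X_0 ∈
    -- D} is known at time 0, and the two kinds of predictable rectangles treat u = 0 and u > 0
    -- separately.
    rcases N with _ | N
    · have h : {p : TimePath S | OnPiece p.path p.time 0 ∧
          mark p.path 0 ∈ (Sum.inl '' D : Set (Ext S))} =
          {p : TimePath S | OnPiece p.path p.time 0} ∩
          ({p : TimePath S | p.time = 0 ∧ p.path ∈ {ω | jumpTime ω 0 ≤ (0 : ℝ≥0) ∧
            mark ω 0 ∈ (Sum.inl '' D : Set (Ext S))}} ∪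
          {p : TimePath S | 0 < p.time ∧ p.path ∈ {ω | jumpTime ω 0 ≤ (0 : ℝ≥0) ∧
            mark ω 0 ∈ (Sum.inl '' D : Set (Ext S))}}) := by
        ext ⟨u, ω⟩
        rcases eq_or_ne u 0 with rfl | hu
        · simp [jumpTime_zero]
        · simp [jumpTime_zero, hu, pos_iff_ne_zero.2 hu]
      rw [h]
      exact (measurableSet_onPiece 0).inter
        ((measurableSet_timePath_zero (measurableSet_jump_event 0 0 hD)).union
        (measurableSet_timePath_Ioi (measurableSet_jump_event 0 0 hD)))
    · convert (measurableSet_onPiece (S := S) (N + 1)).inter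
        (measurableSet_mark_before (N + 1) hD) using 1
      ext p
      simp only [mem_ofPred_eq, mem_inter_iff]
      constructor
      · rintro ⟨h1, h2⟩
        exact ⟨h1, h1.1.resolve_left (by omega), h2⟩
      · rintro ⟨h1, -, h2⟩
        exact ⟨h1, h2⟩
  have h : lastMark x₀ N ⁻¹' D = {p : TimePath S | OnPiece p.path p.time N ∧
      mark p.path N ∈ (Sum.inl '' D : Set (Ext S))} ∪
      ({p : TimePath S | OnPiece p.path p.time N}ᶜ ∩ {_p | x₀ ∈ D}) := by
    ext ⟨u, ω⟩
    simp only [mem_preimage, lastMark, mem_union, mem_ofPred_eq, mem_inter_iff, mem_compl_iff]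
    split_ifs with h
    · obtain ⟨y, hy⟩ := exists_mark_eq h.ne_top
      simp [hy, h]
    · simp [h]
  rw [h]
  exact h1.union ((measurableSet_onPiece N).compl.inter (MeasurableSet.const _))

end Predictable

/-! ### Predictability of the left limit -/

section LeftState

variable {S A B : Type*} [TopologicalSpace S] [MeasurableSpace S] [MeasurableSpace A]
  [MeasurableSpace B] (M : Game S A B)

/-- The left limit of the state process is predictable. -/
theorem measurable_leftState : Measurable fun p : TimePath S => M.leftState p.path p.time := by
  have key : ∀ D : Set S, MeasurableSet D →
      MeasurableSet {p : TimePath S | M.leftState p.path p.time ∈ (Sum.inl '' D : Set (Ext S))} := by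
    intro D hD
    by_cases hS : Nonempty S
    · obtain ⟨x₀⟩ := hS
      -- On each piece the left limit is the jointly measurable flow applied to the predictable pair
      -- of post-jump state and elapsed time. There are countably many pieces.
      have h : {p : TimePath S | M.leftState p.path p.time ∈ (Sum.inl '' D : Set (Ext S))} =
          ⋃ N, ({p : TimePath S | OnPiece p.path p.time N} ∩
            (fun p => M.flow (lastMark x₀ N p) (p.time - lastTime N p)) ⁻¹' D) := by
        ext ⟨u, ω⟩
        simp only [mem_ofPred_eq, mem_iUnion, mem_inter_iff, mem_preimage]
        have h2 : ∀ {N y}, OnPiece ω u N → mark ω N = Sum.inl y →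
            M.flow (lastMark x₀ N ⟨u, ω⟩) (u - lastTime N ⟨u, ω⟩) =
              M.flow y (u - (jumpTime ω N).toReal) := by
          intro N y h3 h4
          have h5 : lastMark x₀ N ⟨u, ω⟩ = y := by simp [lastMark, h3, h4]
          have h6 : ((lastTime N (TimePath.mk u ω) : ℝ≥0) : ℝ) = (jumpTime ω N).toReal := by
            unfold lastTime
            split_ifs with h7
            · rfl
            · have h8 : N = 0 := h3.1.resolve_right h7
              simp [h8, jumpTime_zero]
          rw [h5, h6]
        constructor
        · rintro ⟨z, hz, h1⟩
          obtain ⟨N, y, h3, h4, rfl⟩ := (leftState_eq_inl_iff M).1 h1.symm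
          refine ⟨N, h3, ?_⟩
          rwa [h2 h3 h4]
        · rintro ⟨N, h3, h1⟩
          obtain ⟨y, h4⟩ := exists_mark_eq h3.ne_top
          rw [h2 h3 h4] at h1
          exact ⟨_, h1, (leftState_of_onPiece_of_mark M h3 h4).symm⟩
      rw [h]
      refine MeasurableSet.iUnion fun N => (measurableSet_onPiece N).inter ?_
      refine (M.measurable_flow.comp ((measurable_lastMark x₀ N).prodMk ?_)) hD
      exact (measurable_time.coe_nnreal_real).sub (measurable_lastTime N).coe_nnreal_real
    · have : IsEmpty S := not_nonempty_iff.1 hS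
      convert MeasurableSet.empty (α := TimePath S) using 1
      ext p
      simp
  intro D hD
  have h : (fun p : TimePath S => M.leftState p.path p.time) ⁻¹' D =
      {p : TimePath S | M.leftState p.path p.time ∈ (Sum.inl '' (Sum.inl ⁻¹' D) : Set (Ext S))} ∪
      ({p : TimePath S | M.leftState p.path p.time ∈ (Sum.inl '' univ : Set (Ext S))}ᶜ ∩
        {_p | cem ∈ D}) := by
    ext ⟨u, ω⟩
    simp only [mem_preimage, mem_union, mem_ofPred_eq, mem_inter_iff, mem_compl_iff]
    rcases M.leftState ω u with y | ⟨⟩ <;> simp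
  rw [h]
  exact (key _ (measurable_inl hD)).union ((key _ MeasurableSet.univ).compl.inter
    (MeasurableSet.const _))

end LeftState

/-! ### Time integrals of predictable processes -/

section TimeIntegral

variable {S : Type*} [MeasurableSpace S]

/-- The image of Lebesgue measure on `(0, u]` under `r ↦ (r, ω)`. -/
def pastMeasure (p : TimePath S) : Measure (TimePath S) :=
  (volume.restrict (Ioc (0 : ℝ) p.time)).map fun r => TimePath.mk r.toNNReal p.path

theorem measurable_section (ω : Path S) :
    Measurable fun r : ℝ => TimePath.mk r.toNNReal ω :=
  measurable_toTimePath measurable_real_toNNReal measurable_const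

instance (p : TimePath S) : IsFiniteMeasure (pastMeasure p) := by
  unfold pastMeasure; infer_instance

/-- Lebesgue measure on the past is a predictable kernel. -/
theorem measurable_pastMeasure : Measurable (pastMeasure (S := S)) := by
  have hgen : (inferInstance : MeasurableSpace (TimePath S)) = .generateFrom
      ({s | ∃ A, MeasurableSet[pathFiltration S 0] A ∧
        s = {p : TimePath S | p.time = 0 ∧ p.path ∈ A}} ∪
      {s | ∃ i A, MeasurableSet[pathFiltration S i] A ∧
        s = {p : TimePath S | i < p.time ∧ p.path ∈ A}}) := by
    apply le_antisymm
    · refine MeasurableSpace.comap_le_iff_le_map.2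
        (measurableSpace_le_predictable_of_measurableSet ?_ ?_)
      · exact fun A hA => MeasurableSpace.measurableSet_generateFrom (Or.inl ⟨A, hA, rfl⟩)
      · exact fun i A hA => MeasurableSpace.measurableSet_generateFrom (Or.inr ⟨i, A, hA, rfl⟩)
    · refine MeasurableSpace.generateFrom_le ?_
      rintro _ (⟨A, hA, rfl⟩ | ⟨i, A, hA, rfl⟩)
      · exact measurableSet_timePath_zero hA
      · exact measurableSet_timePath_Ioi hA
  -- The predictable rectangles form a π-system once empty intersections are disregarded: a
  -- rectangle at time 0 never meets one over (i, ∞).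
  refine Measurable.measure_of_isPiSystem hgen ?_ ?_ ?_
  · rintro _ (⟨A, hA, rfl⟩ | ⟨i, A, hA, rfl⟩) _ (⟨A', hA', rfl⟩ | ⟨i', A', hA', rfl⟩) hne
    · refine Or.inl ⟨A ∩ A', hA.inter hA', ?_⟩
      ext p; simp only [mem_inter_iff, mem_ofPred_eq]; tauto
    · obtain ⟨p, h1, h2⟩ := hne
      have h3 : i' < p.time := h2.1
      rw [h1.1] at h3
      exact absurd h3 (not_lt.2 zero_le)
    · obtain ⟨p, h1, h2⟩ := hne
      have h3 : i < p.time := h1.1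
      rw [h2.1] at h3
      exact absurd h3 (not_lt.2 zero_le)
    · refine Or.inr ⟨max i i', A ∩ A', ((pathFiltration S).mono (le_max_left _ _) _ hA).inter
        ((pathFiltration S).mono (le_max_right _ _) _ hA'), ?_⟩
      ext p; simp only [mem_inter_iff, mem_ofPred_eq, max_lt_iff]; tauto
  · rintro _ (⟨A, hA, rfl⟩ | ⟨i, A, hA, rfl⟩)
    · convert measurable_const (α := ℝ≥0∞) (a := 0) using 2 with p
      rw [pastMeasure, Measure.map_apply (measurable_section _) (measurableSet_timePath_zero hA),
        Measure.restrict_apply (measurable_section _ (measurableSet_timePath_zero hA))]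
      convert measure_empty (μ := (volume : Measure ℝ))
      ext r
      simp only [preimage_ofPred_eq, mem_inter_iff, mem_ofPred_eq, mem_Ioc, mem_empty_iff_false,
        iff_false]
      rintro ⟨⟨h1, -⟩, h2, -⟩
      exact absurd (Real.toNNReal_eq_zero.1 h1) (not_le.2 h2)
    -- The past up to u charges (i, ∞) × A with mass (u - i)⁺ on A, which is again predictable since
    -- A is known at time i.
    · have hm := measurableSet_timePath_Ioi hA
      have h : (fun p : TimePath S => pastMeasure p {p : TimePath S | i < p.time ∧ p.path ∈ A}) =
          ({p : TimePath S | i < p.time ∧ p.path ∈ A}).indicator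
            fun p => ENNReal.ofReal ((p.time : ℝ) - i) := by
        ext ⟨u, ω⟩
        rw [pastMeasure, Measure.map_apply (measurable_section _) hm,
          Measure.restrict_apply (measurable_section _ hm)]
        by_cases hω : ω ∈ A
        · have h2 : ((fun r : ℝ => TimePath.mk r.toNNReal ω) ⁻¹'
              {p : TimePath S | i < p.time ∧ p.path ∈ A} ∩ Ioc (0 : ℝ) u) = Ioc (i : ℝ) u := by
            ext r
            simp only [preimage_ofPred_eq, mem_inter_iff, mem_ofPred_eq, mem_Ioc, hω, and_true]
            rw [Real.lt_toNNReal_iff_coe_lt]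
            constructor
            · rintro ⟨h1, h2, h3⟩
              exact ⟨h1, h3⟩
            · rintro ⟨h1, h3⟩
              exact ⟨h1, i.2.trans_lt h1, h3⟩
          show volume ((fun r : ℝ => TimePath.mk r.toNNReal ω) ⁻¹'
              {p : TimePath S | i < p.time ∧ p.path ∈ A} ∩ Ioc (0 : ℝ) u) = _
          rw [h2, Real.volume_Ioc]
          by_cases hi : i < u
          · have hm' : TimePath.mk u ω ∈ {p : TimePath S | i < p.time ∧ p.path ∈ A} := ⟨hi, hω⟩
            rw [indicator_of_mem hm']
          · rw [indicator_of_notMem (fun h => hi h.1), ENNReal.ofReal_eq_zero]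
            have : (u : ℝ) ≤ i := by exact_mod_cast not_lt.1 hi
            linarith
        · rw [indicator_of_notMem (fun h => hω h.2)]
          convert measure_empty (μ := (volume : Measure ℝ))
          ext r
          simp only [preimage_ofPred_eq, mem_inter_iff, mem_ofPred_eq, mem_empty_iff_false,
            iff_false]
          exact fun h => hω h.1.2
      rw [h]
      exact (ENNReal.measurable_ofReal.comp
        (measurable_time.coe_nnreal_real.sub_const _)).indicator hm
  · convert (ENNReal.measurable_ofReal.comp
      (measurable_time (S := S)).coe_nnreal_real) using 2 with p
    rw [pastMeasure, Measure.map_apply (measurable_section _) MeasurableSet.univ]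
    simp

/-- The time integral of a predictable process is predictable. -/
theorem measurable_timeIntegral {c : TimePath S → ℝ} (hc : Measurable c) :
    Measurable fun p : TimePath S => ∫ r in (0 : ℝ)..p.time, c ⟨r.toNNReal, p.path⟩ := by
  let κ : Kernel (TimePath S) (TimePath S) := ⟨pastMeasure, measurable_pastMeasure⟩
  have hκ : ∀ p, κ p = pastMeasure p := fun p => rfl
  have h1 : Measurable fun p : TimePath S =>
      (∫⁻ q, ENNReal.ofReal (c q) ∂(κ p)).toReal - (∫⁻ q, ENNReal.ofReal (-c q) ∂(κ p)).toReal :=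
    (hc.ennreal_ofReal.lintegral_kernel).ennreal_toReal.sub
      (hc.neg.ennreal_ofReal.lintegral_kernel).ennreal_toReal
  have h2 : Measurable fun p : TimePath S => ∫ q, c q ∂(κ p) := by
    have h3 : MeasurableSet {p : TimePath S | Integrable c (κ p)} := by
      have h4 : {p : TimePath S | Integrable c (κ p)} =
          {p | ∫⁻ q, ‖c q‖ₑ ∂(κ p) < ∞} := by
        ext p
        exact ⟨fun h => h.2, fun h => ⟨hc.aestronglyMeasurable, h⟩⟩
      rw [h4]
      exact measurableSet_lt (hc.enorm.lintegral_kernel) measurable_const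
    -- Off the set of integrability the Bochner integral is 0 by convention, whereas the difference
    -- of the two parts need not be. The indicator reconciles them.
    convert h1.indicator h3 using 1
    ext p
    by_cases hp : Integrable c (κ p)
    · rw [indicator_of_mem (by exact hp), integral_eq_lintegral_pos_part_sub_lintegral_neg_part hp]
    · rw [indicator_of_notMem (by exact hp), integral_undef hp]
  convert h2 using 2 with p
  rw [hκ, pastMeasure, integral_map (measurable_section _).aemeasurable
    hc.aestronglyMeasurable, intervalIntegral.integral_of_le (NNReal.coe_nonneg _)]

end TimeIntegral

/-! ### Absolute continuity and the product rule -/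

section RealAnalysis

theorem _root_.LipschitzOnWith.comp_absolutelyContinuousOnInterval {g f : ℝ → ℝ} {a b : ℝ}
    {K : ℝ≥0} {s : Set ℝ} (hg : LipschitzOnWith K g s) (hf : AbsolutelyContinuousOnInterval f a b)
    (hs : MapsTo f (uIcc a b) s) : AbsolutelyContinuousOnInterval (fun x => g (f x)) a b := by
  rw [absolutelyContinuousOnInterval_iff] at hf ⊢
  intro ε hε
  obtain ⟨δ, hδ, h⟩ := hf (ε / (K + 1)) (by positivity)
  refine ⟨δ, hδ, fun E hE hE2 => ?_⟩
  have h1 := h E hE hE2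
  rw [lt_div_iff₀ (by positivity)] at h1
  refine lt_of_le_of_lt ?_ h1
  rw [Finset.sum_mul]
  refine Finset.sum_le_sum fun i hi => ?_
  have h2 := hg.dist_le_mul _ (hs (hE.1 i hi).1) _ (hs (hE.1 i hi).2)
  nlinarith [dist_nonneg (x := f (E.2 i).1) (y := f (E.2 i).2)]

/-- An absolutely continuous function is bounded on the interval, and the exponential is Lipschitz
on bounded intervals. -/
theorem _root_.AbsolutelyContinuousOnInterval.rexp {f : ℝ → ℝ} {a b : ℝ}
    (hf : AbsolutelyContinuousOnInterval f a b) :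
    AbsolutelyContinuousOnInterval (fun x => Real.exp (f x)) a b := by
  obtain ⟨C, hC⟩ := hf.exists_bound
  obtain ⟨K, hK⟩ := (Real.contDiff_exp (n := 1)).contDiffOn.exists_lipschitzOnWith (by decide)
    (convex_Icc (-C) C) isCompact_Icc
  exact hK.comp_absolutelyContinuousOnInterval hf fun x hx => by
    have := hC x hx
    rw [Real.norm_eq_abs] at this
    exact abs_le.1 this

/-- The discounting factor `exp (lam ∫₀ᵘ c)`. -/
def expWeight (lam : ℝ) (c : ℝ → ℝ) (u : ℝ) : ℝ := Real.exp (lam * ∫ r in (0 : ℝ)..u, c r)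

/-- The product of the weight and h is absolutely continuous with derivative weight · (h' + lam c h)
almost everywhere, which is at least -weight · R. Integration gives the claim. Here h is the value
along the flow from the last jump at time a, and R is the jump term. -/
theorem expWeight_sub_ge {lam a l : ℝ} {c R h : ℝ → ℝ} (ha : 0 ≤ a) (hl : 0 ≤ l)
    (hc : IntervalIntegrable c volume 0 (a + l)) (hh : AbsolutelyContinuousOnInterval h 0 l)
    (hR : IntervalIntegrable (fun u => expWeight lam c u * R u) volume a (a + l))
    (hd : ∀ᵐ t, t ∈ Ioo 0 l → ∃ d, HasDerivAt h d t ∧ 0 ≤ d + lam * c (a + t) * h t + R (a + t)) :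
    -(∫ u in a..(a + l), expWeight lam c u * R u) ≤
      expWeight lam c (a + l) * h l - expWeight lam c a * h 0 := by
  set c' : ℝ → ℝ := fun r => c (a + r) with hc'
  have hca : IntervalIntegrable c volume a (a + l) :=
    hc.mono_set (by rw [uIcc_of_le (by linarith), uIcc_of_le (by linarith)]; gcongr)
  have hc0 : IntervalIntegrable c volume 0 a :=
    hc.mono_set (by rw [uIcc_of_le (by linarith), uIcc_of_le (by linarith)]; gcongr; linarith)
  have hc'i : IntervalIntegrable c' volume 0 l := by
    have := hca.comp_add_left a
    simpa using this
  have hE : ∀ t ∈ Icc 0 l, expWeight lam c (a + t) =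
      expWeight lam c a * Real.exp (lam * ∫ r in (0 : ℝ)..t, c' r) := by
    intro t ht
    have h1 : ∫ r in (0 : ℝ)..t, c' r = ∫ r in a..(a + t), c r := by
      rw [hc', intervalIntegral.integral_comp_add_left]
      simp
    have h2 : IntervalIntegrable c volume a (a + t) :=
      hca.mono_set (by
        rw [uIcc_of_le (by linarith [ht.1]), uIcc_of_le (by linarith)]
        gcongr; exact ht.2)
    rw [expWeight, expWeight, h1, ← Real.exp_add, ← mul_add,
      intervalIntegral.integral_add_adjacent_intervals hc0 h2]
  set g : ℝ → ℝ := fun t => expWeight lam c a * Real.exp (lam * ∫ r in (0 : ℝ)..t, c' r) with hg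
  have hgAC : AbsolutelyContinuousOnInterval g 0 l :=
    ((hc'i.absolutelyContinuousOnInterval_intervalIntegral (by simp)).const_mul lam).rexp.const_mul _
  have hgh := hgAC.fun_mul hh
  have h1 := hgh.integral_deriv_eq_sub
  have h2 : ∫ u in a..(a + l), expWeight lam c u * R u = ∫ t in (0 : ℝ)..l, g t * R (a + t) := by
    have := intervalIntegral.integral_comp_add_left (a := 0) (b := l)
      (fun u => expWeight lam c u * R u) a
    rw [add_zero] at this
    rw [← this]
    refine intervalIntegral.integral_congr fun t ht => ?_
    rw [uIcc_of_le hl] at ht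
    simp only [hE t ht, hg]
  have h3 : IntervalIntegrable (fun t => g t * R (a + t)) volume 0 l := by
    have h4 := hR.comp_add_left a
    simp only [sub_self, add_sub_cancel_left] at h4
    refine h4.congr fun t ht => ?_
    rw [uIoc_of_le hl] at ht
    show expWeight lam c (a + t) * R (a + t) = g t * R (a + t)
    rw [hE t (Ioc_subset_Icc_self ht)]
  have h4 : expWeight lam c (a + l) * h l - expWeight lam c a * h 0 =
      g l * h l - g 0 * h 0 := by
    have h5 := hE l ⟨hl, le_rfl⟩
    have h6 : g 0 = expWeight lam c a := by simp [hg]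
    rw [h5, h6]
  rw [h4, ← h1, h2, ← intervalIntegral.integral_neg]
  refine intervalIntegral.integral_mono_ae_restrict hl h3.neg hgh.intervalIntegrable_deriv ?_
  rw [EventuallyLE, ae_restrict_iff' measurableSet_Icc]
  -- The differential inequality is only assumed in the open interval, so the endpoints are
  -- discarded as a null set.
  have h7 : ∀ᵐ t : ℝ, t ≠ 0 ∧ t ≠ l := by
    have : ({0, l} : Set ℝ).Countable := by simp
    filter_upwards [this.ae_notMem volume] with t ht
    simpa using ht
  filter_upwards [hd, hc'i.ae_hasDerivAt_integral, h7] with t ht1 ht2 ht3 ht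
  obtain ⟨d, hd1, hd2⟩ := ht1 ⟨lt_of_le_of_ne ht.1 ht3.1.symm, lt_of_le_of_ne ht.2 ht3.2⟩
  have hd3 := ht2 (by rwa [uIcc_of_le hl]) 0 (by simp)
  have hd4 : HasDerivAt g (g t * (lam * c' t)) t := by
    have := ((hd3.const_mul lam).exp).const_mul (expWeight lam c a)
    exact this.congr_deriv (mul_assoc _ _ _).symm
  rw [(hd4.fun_mul hd1).deriv]
  have hgpos : 0 ≤ g t := by simp only [hg, expWeight]; positivity
  nlinarith [mul_nonneg hgpos hd2]

end RealAnalysis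

/-! ### Processes with a predictable jump intensity -/

section Intensity

variable {S A B : Type*} [TopologicalSpace S] [MeasurableSpace S] [MeasurableSpace A]
  [MeasurableSpace B] (M : Game S A B)

/-- The value `w (u, ξ_{u-})`, which is `0` in the cemetery. -/
def leftValue {E : Type*} [Zero E] (w : ℝ≥0 → S → E) (p : TimePath S) : E :=
  Sum.elim (fun y => w p.time y) (fun _ => 0) (M.leftState p.path p.time)

variable {M} in
theorem leftValue_of_inl {E : Type*} [Zero E] {w : ℝ≥0 → S → E} {p : TimePath S} {y : S}
    (h : M.leftState p.path p.time = Sum.inl y) : leftValue M w p = w p.time y := by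
  rw [leftValue, h]; rfl

/-- The left limit of the state, with the default value `x₀` in the cemetery. -/
def leftPos (x₀ : S) (p : TimePath S) : S :=
  Sum.elim id (fun _ => x₀) (M.leftState p.path p.time)

/-- The set where the left limit of the state is not the cemetery. -/
def aliveSet : Set (TimePath S) := {p | M.leftState p.path p.time ≠ cem}

theorem measurableSet_aliveSet : MeasurableSet (aliveSet M) := by
  have h : aliveSet M = (fun p : TimePath S => M.leftState p.path p.time) ⁻¹' (range Sum.inl) := by
    ext p
    simp only [aliveSet, mem_ofPred_eq, mem_preimage, mem_range]
    rcases M.leftState p.path p.time with y | z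
    · simp
    · simp
  rw [h]
  exact measurable_leftState M measurableSet_range_inl

theorem measurable_leftPos (x₀ : S) : Measurable (leftPos M x₀) :=
  (Measurable.sumElim measurable_id measurable_const).comp (measurable_leftState M)

variable {M} in
theorem leftPos_of_inl {x₀ : S} {p : TimePath S} {y : S}
    (h : M.leftState p.path p.time = Sum.inl y) : leftPos M x₀ p = y := by
  rw [leftPos, h]; rfl

variable {M} in
theorem mem_aliveSet_iff {p : TimePath S} :
    p ∈ aliveSet M ↔ ∃ y, M.leftState p.path p.time = Sum.inl y := by
  simp only [aliveSet, mem_ofPred_eq]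
  rcases M.leftState p.path p.time with y | ⟨⟩ <;> simp

theorem measurable_leftValue {E : Type*} [Zero E] [MeasurableSpace E] {w : ℝ≥0 → S → E}
    (hw : Measurable (Function.uncurry w)) : Measurable (leftValue M w) := by
  by_cases hS : Nonempty S
  · obtain ⟨x₀⟩ := hS
    have h : leftValue M w =
        (aliveSet M).indicator fun p => w p.time (leftPos M x₀ p) := by
      ext p
      by_cases hp : p ∈ aliveSet M
      · obtain ⟨y, hy⟩ := mem_aliveSet_iff.1 hp
        rw [indicator_of_mem hp, leftValue_of_inl hy, leftPos_of_inl hy]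
      · have hy : M.leftState p.path p.time = cem := by
          simpa [aliveSet] using hp
        rw [indicator_of_notMem hp, leftValue, hy]; rfl
    rw [h]
    exact (hw.comp (measurable_time.prodMk (measurable_leftPos M x₀))).indicator
      (measurableSet_aliveSet M)
  · have : IsEmpty S := not_nonempty_iff.1 hS
    convert measurable_const (a := (0 : E)) using 2 with p
    rw [leftValue]
    rcases M.leftState p.path p.time with y | z
    · exact isEmptyElim y
    · rfl

/-- The sum `∑_{n ≥ 1, T_n < ∞} Y (T_n, X_n)`. -/
def jumpSum (Y : TimePath S → S → ℝ≥0∞) (ω : Path S) : ℝ≥0∞ :=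
  ∑' n : ℕ, Sum.elim (fun y => Y ⟨(jumpTime ω (n + 1)).toNNReal, ω⟩ y) (fun _ => 0)
    (mark ω (n + 1))

/-- The integral `∫_0^∞ ∫ Y(u, y) Λ(dy | u) du`. -/
def intensityIntegral (Λ : Kernel (TimePath S) S) (Y : TimePath S → S → ℝ≥0∞) (ω : Path S) :
    ℝ≥0∞ :=
  ∫⁻ u in Ioi (0 : ℝ), ∫⁻ y, Y ⟨u.toNNReal, ω⟩ y ∂(Λ ⟨u.toNNReal, ω⟩)

/-- Under the probability measure `P` the process starts at `x` and jumps with intensity `Λ`. -/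
structure HasIntensity (Λ : Kernel (TimePath S) S) (x : S) (P : Measure (Path S)) : Prop where
  prob : IsProbabilityMeasure P
  init : ∀ᵐ ω ∂P, mark ω 0 = Sum.inl x
  dead : ∀ p, M.leftState p.path p.time = cem → Λ p = 0
  compensator : ∀ Y : TimePath S → S → ℝ≥0∞, Measurable (Function.uncurry Y) →
    ∫⁻ ω, jumpSum Y ω ∂P = ∫⁻ ω, intensityIntegral Λ Y ω ∂P

variable {M} in
theorem HasIntensity.eq_zero_of_notMem {Λ : Kernel (TimePath S) S} {x : S} {P : Measure (Path S)}
    (h : HasIntensity M Λ x P) {p : TimePath S} (hp : p ∉ aliveSet M) : Λ p = 0 :=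
  h.dead p (by simpa [aliveSet] using hp)

omit [TopologicalSpace S] in
theorem measurable_pathTime : Measurable fun q : Path S × ℝ => TimePath.mk q.2.toNNReal q.1 :=
  measurable_toTimePath (measurable_real_toNNReal.comp measurable_snd) measurable_fst

omit [TopologicalSpace S] in
theorem measurable_timeLIntegral {g : TimePath S → ℝ≥0∞} (hg : Measurable g) (s : Set ℝ) :
    Measurable fun ω => ∫⁻ u in s, g ⟨u.toNNReal, ω⟩ :=
  (hg.comp measurable_pathTime).lintegral_prod_right'

omit [TopologicalSpace S] in
theorem measurable_intensityIntegral {Λ : Kernel (TimePath S) S} [IsSFiniteKernel Λ]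
    {Y : TimePath S → S → ℝ≥0∞} (hY : Measurable (Function.uncurry Y)) :
    Measurable (intensityIntegral Λ Y) :=
  measurable_timeLIntegral (hY.lintegral_kernel_prod_right (κ := Λ)) _

/-- The value at a post-jump state of a function that is constant along the flow. -/
def markValue (w : S → ℝ≥0) (τ : ℝ≥0) (ω : Path S) (k : ℕ) : ℝ≥0 :=
  Sum.elim (fun y => w (M.flow y (τ - (jumpTime ω k).toReal))) (fun _ => 0) (mark ω k)

/-- The left value of a function that is constant along the flow. -/
def flowValue (w : S → ℝ≥0) (τ : ℝ≥0) (p : TimePath S) : ℝ≥0 :=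
  leftValue M (fun u y => w (M.flow y (τ - u))) p

variable {M} in
theorem flowValue_of_inl {w : S → ℝ≥0} {τ : ℝ≥0} {p : TimePath S} {y : S}
    (h : M.leftState p.path p.time = Sum.inl y) :
    flowValue M w τ p = w (M.flow y (τ - p.time)) :=
  leftValue_of_inl h

theorem measurable_flowValue {w : S → ℝ≥0} (hw : Measurable w) (τ : ℝ≥0) :
    Measurable (flowValue M w τ) :=
  measurable_leftValue M (hw.comp (M.measurable_flow.comp
    (measurable_snd.prodMk (measurable_fst.coe_nnreal_real.const_sub _))))

/-- By the flow property, φ(φ(y, u - T_N), τ - u) = φ(y, τ - T_N) does not involve u. This is why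
weights of the form V(φ(x, T - t)) change only at jumps. -/
theorem flowValue_of_onPiece {w : S → ℝ≥0} {τ : ℝ≥0} {ω : Path S} {u : ℝ≥0} {N : ℕ}
    (h : OnPiece ω u N) :
    flowValue M w τ ⟨u, ω⟩ = markValue M w τ ω N := by
  obtain ⟨y, hy⟩ := exists_mark_eq h.ne_top
  rw [flowValue_of_inl (p := ⟨u, ω⟩) (leftState_of_onPiece_of_mark M h hy), markValue, hy]
  show w (M.flow (M.flow y _) _) = w (M.flow y _)
  rw [← M.flow_add]
  congr 2
  ring

/-- The fundamental theorem of calculus for e^{-ρu}, arranged as a sum so that no subtraction in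
`ℝ≥0∞` occurs. -/
theorem lintegral_exp_add (ρ : ℝ) (hρ : 0 ≤ ρ) {a b : ℝ} (hab : a ≤ b) :
    (∫⁻ u in Ioc a b, ENNReal.ofReal (ρ * Real.exp (-(ρ * u)))) +
      ENNReal.ofReal (Real.exp (-(ρ * b))) = ENNReal.ofReal (Real.exp (-(ρ * a))) := by
  have hc : Continuous fun u : ℝ => ρ * Real.exp (-(ρ * u)) := by fun_prop
  have hd : ∀ u : ℝ, HasDerivAt (fun u => -Real.exp (-(ρ * u))) (ρ * Real.exp (-(ρ * u))) u := by
    intro u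
    have := (((hasDerivAt_id u).const_mul ρ).neg.exp).neg
    exact this.congr_deriv (by simp; ring)
  have h1 : ∫ u in a..b, ρ * Real.exp (-(ρ * u)) =
      Real.exp (-(ρ * a)) - Real.exp (-(ρ * b)) := by
    rw [intervalIntegral.integral_eq_sub_of_hasDerivAt (fun u _ => hd u)
      (hc.intervalIntegrable _ _)]
    ring
  have h2 : Real.exp (-(ρ * b)) ≤ Real.exp (-(ρ * a)) :=
    Real.exp_le_exp.2 (neg_le_neg (mul_le_mul_of_nonneg_left hab hρ))
  rw [← ofReal_integral_eq_lintegral_ofReal ((hc.integrableOn_Icc).mono_set Ioc_subset_Icc_self)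
    (ae_of_all _ fun u => mul_nonneg hρ (Real.exp_pos _).le),
    ← intervalIntegral.integral_of_le hab, h1, ← ENNReal.ofReal_add (sub_nonneg.2 h2)
    (Real.exp_pos _).le]
  ring_nf

/-- The balance of the discounted value of a piecewise constant function, up to the time `t` or the
`n`-th jump. -/
theorem discounted_balance {τ : ℕ → ℝ≥0∞} (hτ : Monotone τ) (hτ0 : τ 0 = 0) {lv : ℝ≥0 → ℝ≥0∞}
    {v : ℕ → ℝ≥0∞}
    (hpiece : ∀ u N, (N = 0 ∨ τ N < (u : ℝ≥0)) → (u : ℝ≥0∞) ≤ τ (N + 1) → lv u = v N)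
    (ρ t : ℝ≥0) {e : ℝ → ℝ≥0∞} (he : ∀ u, e u = ENNReal.ofReal (Real.exp (-(ρ * u))))
    {e' : ℝ → ℝ≥0∞} (he' : ∀ u, e' u = ENNReal.ofReal (ρ * Real.exp (-(ρ * u)))) (n : ℕ) :
    (if (t : ℝ≥0∞) ≤ τ n then e t * lv t else 0) +
    (∑ k ∈ Finset.range n, if τ (k + 1) < t then e (τ (k + 1)).toReal * v k else 0) +
    (∫⁻ u in Ioc (0 : ℝ) t, if ENNReal.ofReal u ≤ τ n then e' u * lv u.toNNReal else 0) +
    (if τ n < t then e (τ n).toReal * v n else 0) =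
    v 0 + ∑ k ∈ Finset.range n,
      if τ (k + 1) < t then e (τ (k + 1)).toReal * v (k + 1) else 0 := by
  have he'm : Measurable e' := by
    rw [show e' = fun u => ENNReal.ofReal (ρ * Real.exp (-(ρ * u))) from funext he']
    fun_prop
  have hee : ∀ {a b : ℝ}, a ≤ b → (∫⁻ u in Ioc a b, e' u) + e b = e a := by
    intro a b hab
    simp only [he, he']
    exact lintegral_exp_add _ ρ.2 hab
  induction n with
  | zero =>
    have h1 : ∫⁻ u in Ioc (0 : ℝ) t, (if ENNReal.ofReal u ≤ τ 0 then
        e' u * lv u.toNNReal else 0) = 0 := by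
      rw [setLIntegral_congr_fun (g := fun _ => 0) measurableSet_Ioc, lintegral_zero]
      intro u hu
      simp [hτ0, not_le.2 hu.1]
    rw [h1]
    simp only [hτ0, Finset.range_zero, Finset.sum_empty, add_zero]
    rcases eq_or_ne t 0 with rfl | ht
    · have : lv 0 = v 0 := hpiece 0 0 (Or.inl rfl) (by simp)
      simp [this, he]
    · have ht' : (0 : ℝ≥0∞) < t := by exact_mod_cast pos_iff_ne_zero.2 ht
      simp [ht', ht, he]
  | succ n ih =>
    rw [Finset.sum_range_succ, Finset.sum_range_succ, ← add_assoc (v 0),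
      ← ih]
    -- Passing from n to n + 1 matters only if t lies beyond τ_n. Then the new piece ends at τ_{n+1}
    -- or at t, whichever comes first. If t ≤ τ_n, neither side changes.
    by_cases hn : τ n < t
    · have hnt : τ n ≠ ∞ := (hn.trans ENNReal.coe_lt_top).ne
      set a : ℝ := (τ n).toReal with ha
      have ha' : ENNReal.ofReal a = τ n := ENNReal.ofReal_toReal hnt
      have ha0 : 0 ≤ a := ENNReal.toReal_nonneg
      have hat : a < t := by
        have := (ENNReal.toReal_lt_toReal hnt ENNReal.coe_ne_top).2 hn
        simpa using this
      -- the end of the piece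
      have hsplit : ∀ b : ℝ, a ≤ b → b ≤ t →
          (∀ u : ℝ, 0 < u → u ≤ t → (ENNReal.ofReal u ≤ τ (n + 1) ↔ u ≤ b)) →
          (∫⁻ u in Ioc (0 : ℝ) t, if ENNReal.ofReal u ≤ τ (n + 1) then
            e' u * lv u.toNNReal else 0) + e b * v n =
          (∫⁻ u in Ioc (0 : ℝ) t, if ENNReal.ofReal u ≤ τ n then
            e' u * lv u.toNNReal else 0) + e a * v n := by
        intro b hab hbt hb
        have h1 : ∫⁻ u in Ioc (0 : ℝ) t, (if ENNReal.ofReal u ≤ τ (n + 1) then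
            e' u * lv u.toNNReal else 0) =
            ∫⁻ u in Ioc (0 : ℝ) b, e' u * lv u.toNNReal := by
          have : Ioc (0 : ℝ) b = Ioc (0 : ℝ) t ∩ Iic b := by
            rw [Ioc_inter_Iic, min_eq_right hbt]
          rw [this, inter_comm, ← setLIntegral_indicator measurableSet_Iic]
          refine setLIntegral_congr_fun measurableSet_Ioc fun u hu => ?_
          simp only [indicator, mem_Iic, hb u hu.1 hu.2]
        have h2 : ∫⁻ u in Ioc (0 : ℝ) t, (if ENNReal.ofReal u ≤ τ n then
            e' u * lv u.toNNReal else 0) =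
            ∫⁻ u in Ioc (0 : ℝ) a, e' u * lv u.toNNReal := by
          have : Ioc (0 : ℝ) a = Ioc (0 : ℝ) t ∩ Iic a := by
            rw [Ioc_inter_Iic, min_eq_right hat.le]
          rw [this, inter_comm, ← setLIntegral_indicator measurableSet_Iic]
          refine setLIntegral_congr_fun measurableSet_Ioc fun u hu => ?_
          simp only [indicator, mem_Iic, ENNReal.ofReal_le_iff_le_toReal hnt, ha]
        have h3 : ∫⁻ u in Ioc a b, e' u * lv u.toNNReal =
            (∫⁻ u in Ioc a b, e' u) * v n := by
          rw [← lintegral_mul_const _ he'm]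
          refine setLIntegral_congr_fun measurableSet_Ioc fun u hu => ?_
          have hu0 : 0 < u := ha0.trans_lt hu.1
          have : lv u.toNNReal = v n := by
            refine hpiece _ _ (Or.inr ?_) ?_
            · rw [← ha']; exact (ENNReal.ofReal_lt_ofReal_iff hu0).2 hu.1
            · exact (hb u hu0 (hu.2.trans hbt)).2 hu.2
          simp only [this]
        rw [h1, h2, ← Ioc_union_Ioc_eq_Ioc ha0 hab, lintegral_union measurableSet_Ioc
          (by rw [Set.disjoint_left]; rintro u ⟨-, h⟩ ⟨h', -⟩; exact absurd h (not_le.2 h')),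
          h3, add_assoc, ← add_mul, hee hab]
      have hn' : ¬ (t : ℝ≥0∞) ≤ τ n := not_le.2 hn
      by_cases hn1 : τ (n + 1) < t
      · have hn1t : τ (n + 1) ≠ ∞ := (hn1.trans ENNReal.coe_lt_top).ne
        have h := hsplit (τ (n + 1)).toReal
          ((ENNReal.toReal_le_toReal hnt hn1t).2 (hτ n.le_succ))
          (by have := (ENNReal.toReal_lt_toReal hn1t ENNReal.coe_ne_top).2 hn1
              simpa using this.le)
          (fun u _ _ => ENNReal.ofReal_le_iff_le_toReal hn1t)
        simp only [hn1, not_le.2 hn1, hn', hn, if_true, if_false, zero_add]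
        rw [add_right_comm (∑ k ∈ _, _), add_assoc (∑ k ∈ _, _), h, ← add_assoc (∑ k ∈ _, _)]
      · have hp : lv t = v n := hpiece t n (Or.inr hn) (not_lt.1 hn1)
        have h := hsplit t hat.le le_rfl (fun u hu0 hu => by
          refine ⟨fun _ => hu, fun _ => le_trans ?_ (not_lt.1 hn1)⟩
          rw [← ENNReal.ofReal_coe_nnreal]
          exact ENNReal.ofReal_le_ofReal hu)
        simp only [hn1, not_lt.1 hn1, hn', hn, if_true, if_false, zero_add, add_zero, hp]
        rw [add_comm (e t * v n), add_right_comm (∑ k ∈ _, _), add_assoc (∑ k ∈ _, _), h,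
          ← add_assoc (∑ k ∈ _, _)]
    · have hle := not_lt.1 hn
      have hle1 := hle.trans (hτ n.le_succ)
      have h1 : ∫⁻ u in Ioc (0 : ℝ) t, (if ENNReal.ofReal u ≤ τ (n + 1) then
            e' u * lv u.toNNReal else 0) =
          ∫⁻ u in Ioc (0 : ℝ) t, (if ENNReal.ofReal u ≤ τ n then
            e' u * lv u.toNNReal else 0) := by
        refine setLIntegral_congr_fun measurableSet_Ioc fun u hu => ?_
        have hu' : ENNReal.ofReal u ≤ t := by
          rw [← ENNReal.ofReal_coe_nnreal]; exact ENNReal.ofReal_le_ofReal hu.2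
        simp only [hu'.trans hle, hu'.trans hle1, if_true]
      simp only [hle, hle1, hn, not_lt.2 hle1, if_true, if_false, add_zero, h1]

end Intensity

/-! ### Moment bounds from drift conditions -/

section Moments

variable {S A B : Type*} [TopologicalSpace S] [MeasurableSpace S] [MeasurableSpace A]
  [MeasurableSpace B] {M : Game S A B}

omit [TopologicalSpace S] in
theorem measurableSet_before_jump (t : ℝ≥0) (n : ℕ) :
    MeasurableSet {p : TimePath S | p.time < t ∧ (p.time : ℝ≥0∞) ≤ jumpTime p.path n} := by
  have h : {p : TimePath S | p.time < t ∧ (p.time : ℝ≥0∞) ≤ jumpTime p.path n} =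
      (fun p : TimePath S => p.time) ⁻¹' Iio t ∩ {p | jumpTime p.path n < p.time}ᶜ := by
    ext p
    simp
  rw [h]
  exact (measurable_time measurableSet_Iio).inter (measurableSet_jumpTime_lt n).compl

omit [TopologicalSpace S] [MeasurableSpace S] in
/-- The sum over the first `n` jumps before `t`. -/
theorem jumpSum_before {F : TimePath S → S → ℝ≥0∞} (t : ℝ≥0) (n : ℕ) (ω : Path S)
    {f : ℕ → ℝ≥0∞} (hf : ∀ k y, mark ω (k + 1) = Sum.inl y →
      F ⟨(jumpTime ω (k + 1)).toNNReal, ω⟩ y = f k) :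
    jumpSum (fun p y => open Classical in
      if p.time < t ∧ (p.time : ℝ≥0∞) ≤ jumpTime p.path n then F p y else 0) ω =
      ∑ k ∈ Finset.range n, if jumpTime ω (k + 1) < t then f k else 0 := by
  classical
  rw [jumpSum, tsum_eq_sum (s := Finset.range n)]
  · refine Finset.sum_congr rfl fun k hk => ?_
    rcases hm : mark ω (k + 1) with y | ⟨⟩
    · have ht := jumpTime_ne_top_of_mark hm
      have h1 : (jumpTime ω (k + 1)).toNNReal < t ↔ jumpTime ω (k + 1) < t := by
        rw [← ENNReal.coe_lt_coe, ENNReal.coe_toNNReal ht]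
      have h2 : jumpTime ω (k + 1) ≤ jumpTime ω n :=
        jumpTime_mono ω (by simpa using hk)
      simp only [Sum.elim_inl, h1, ENNReal.coe_toNNReal ht, h2, and_true, hf k y hm]
    · have ht : jumpTime ω (k + 1) = ∞ := by
        by_contra h
        exact (mark_ne_cem_iff ω _).2 h hm
      simp [ht]
  · intro k hk
    rcases hm : mark ω (k + 1) with y | ⟨⟩
    · have ht := jumpTime_ne_top_of_mark hm
      have hk' : n ≤ k := by simpa using hk
      have h3 : jumpTime ω k ≠ ∞ := ne_top_of_le_ne_top ht (jumpTime_mono ω k.le_succ)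
      have h2 : ¬ jumpTime ω (k + 1) ≤ jumpTime ω n :=
        not_le.2 ((jumpTime_mono ω hk').trans_lt (jumpTime_lt_succ ω h3))
      simp only [Sum.elim_inl, ENNReal.coe_toNNReal ht, h2, and_false, if_false]
    · rfl

/-- The growth bound before the `n`-th jump, for bounded functions. -/
theorem lintegral_flowValue_le_of_bounded {Λ : Kernel (TimePath S) S} [IsSFiniteKernel Λ] {x : S}
    {P : Measure (Path S)} (hP : HasIntensity M Λ x P) {w : S → ℝ≥0} (hw : Measurable w)
    {m : ℝ≥0} (hwm : ∀ y, w y ≤ m) {τ ρ b : ℝ≥0}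
    (hΛ : ∀ p y, M.leftState p.path p.time = Sum.inl y → p.time ≤ τ →
      ∫⁻ z, w (M.flow z (τ - p.time)) ∂(Λ p) ≤
        (ρ + Λ p univ) * w (M.flow y (τ - p.time)) + b) {t : ℝ≥0} (ht : t ≤ τ) (n : ℕ) :
    ∫⁻ ω, (if (t : ℝ≥0∞) ≤ jumpTime ω n then
      ENNReal.ofReal (Real.exp (-(ρ * t))) * (flowValue M w τ ⟨t, ω⟩ : ℝ≥0∞) else 0) ∂P ≤
      w (M.flow x τ) + b * t := by
  classical
  have := hP.prob
  set e : ℝ → ℝ≥0∞ := fun u => ENNReal.ofReal (Real.exp (-(ρ * u))) with he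
  set e' : ℝ → ℝ≥0∞ := fun u => ENNReal.ofReal (ρ * Real.exp (-(ρ * u))) with he'
  have hem : Measurable e := by rw [he]; fun_prop
  have hem' : Measurable e' := by rw [he']; fun_prop
  have hee' : ∀ u, e' u = ρ * e u := by
    intro u
    simp only [he, he']
    rw [ENNReal.ofReal_mul (NNReal.coe_nonneg ρ), ENNReal.ofReal_coe_nnreal]
  have he1 : ∀ u : ℝ, 0 ≤ u → e u ≤ 1 := by
    intro u hu
    rw [he]
    refine ENNReal.ofReal_le_one.2 (Real.exp_le_one_iff.2 ?_)
    have : 0 ≤ ρ * u := mul_nonneg ρ.2 hu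
    linarith
  set lv : TimePath S → ℝ≥0∞ := fun p => (flowValue M w τ p : ℝ≥0∞) with hlv
  have hlvm : Measurable lv := (measurable_flowValue M hw τ).coe_nnreal_ennreal
  have hwτ : Measurable fun q : TimePath S × S => (w (M.flow q.2 (τ - q.1.time)) : ℝ≥0∞) :=
    (hw.comp (M.measurable_flow.comp (measurable_snd.prodMk
      ((measurable_time.comp measurable_fst).coe_nnreal_real.const_sub _)))).coe_nnreal_ennreal
  set G : Path S → ℝ≥0∞ := fun ω => ∫⁻ u in Ioc (0 : ℝ) t,
    if ENNReal.ofReal u ≤ jumpTime ω n then e' u * lv ⟨u.toNNReal, ω⟩ else 0 with hG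
  -- `Y₁` records the discounted weight after a jump and `Y₂` the one before it. Jumps at t itself
  -- are excluded, since the value at t is a left limit.
  set Y₁ : TimePath S → S → ℝ≥0∞ := fun p y =>
    if p.time < t ∧ (p.time : ℝ≥0∞) ≤ jumpTime p.path n then
      e p.time * w (M.flow y (τ - p.time)) else 0 with hY₁
  set Y₂ : TimePath S → S → ℝ≥0∞ := fun p _ =>
    if p.time < t ∧ (p.time : ℝ≥0∞) ≤ jumpTime p.path n then
      e p.time * lv p else 0 with hY₂
  have hetime : Measurable fun p : TimePath S => e p.time :=
    hem.comp measurable_time.coe_nnreal_real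
  have hY₁m : Measurable (Function.uncurry Y₁) :=
    Measurable.ite (measurable_fst (measurableSet_before_jump t n))
      ((hetime.comp measurable_fst).mul hwτ) measurable_const
  have hY₂m : Measurable (Function.uncurry Y₂) :=
    Measurable.ite (measurable_fst (measurableSet_before_jump t n))
      ((hetime.comp measurable_fst).mul (hlvm.comp measurable_fst)) measurable_const
  have hGm : Measurable G := by
    refine Measurable.lintegral_prod_right' (f := fun q : Path S × ℝ =>
      if ENNReal.ofReal q.2 ≤ jumpTime q.1 n then e' q.2 * lv ⟨q.2.toNNReal, q.1⟩ else 0)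
      (Measurable.ite ?_ ?_ measurable_const)
    · exact measurableSet_le (ENNReal.measurable_ofReal.comp measurable_snd)
        ((measurable_jumpTime n).comp measurable_fst)
    · exact (hem'.comp measurable_snd).mul (hlvm.comp measurable_pathTime)
  -- the pathwise identity
  have hbal : ∀ᵐ ω ∂P, (if (t : ℝ≥0∞) ≤ jumpTime ω n then e t * lv ⟨t, ω⟩ else 0) +
      jumpSum Y₂ ω + G ω ≤ w (M.flow x τ) + jumpSum Y₁ ω := by
    filter_upwards [hP.init] with ω hω
    have h1 := discounted_balance (jumpTime_mono ω) (jumpTime_zero ω)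
      (lv := fun u => lv ⟨u, ω⟩) (v := fun k => (markValue M w τ ω k : ℝ≥0∞))
      (fun u N h h' => by simp only [hlv, flowValue_of_onPiece M (show OnPiece ω u N from ⟨h, h'⟩)])
      ρ t (e := e) (fun _ => rfl) (e' := e') (fun _ => rfl) n
    have h2 : jumpSum Y₂ ω = ∑ k ∈ Finset.range n, if jumpTime ω (k + 1) < t then
        e (jumpTime ω (k + 1)).toReal * (markValue M w τ ω k : ℝ≥0∞) else 0 := by
      refine jumpSum_before (F := fun p _ => e p.time * lv p) t n ω fun k y hy => ?_
      have hk := onPiece_jumpTime (jumpTime_ne_top_of_mark hy)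
      simp only [hlv, flowValue_of_onPiece M hk]
      rfl
    have h3 : jumpSum Y₁ ω = ∑ k ∈ Finset.range n, if jumpTime ω (k + 1) < t then
        e (jumpTime ω (k + 1)).toReal * (markValue M w τ ω (k + 1) : ℝ≥0∞) else 0 := by
      refine jumpSum_before (F := fun p y => e p.time * w (M.flow y (τ - p.time))) t n ω
        fun k y hy => ?_
      rw [markValue, hy]
      rfl
    have h4 : markValue M w τ ω 0 = w (M.flow x τ) := by
      simp [markValue, hω, jumpTime_zero]
    rw [h2, h3, ← h4, hG, ← h1]
    exact le_self_add
  -- finiteness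
  have hB : ∫⁻ ω, jumpSum Y₂ ω ∂P ≠ ∞ := by
    have : ∀ ω, jumpSum Y₂ ω ≤ n * m := by
      intro ω
      have h2 : jumpSum Y₂ ω = ∑ k ∈ Finset.range n, if jumpTime ω (k + 1) < t then
          e (jumpTime ω (k + 1)).toReal * (markValue M w τ ω k : ℝ≥0∞) else 0 := by
        refine jumpSum_before (F := fun p _ => e p.time * lv p) t n ω fun k y hy => ?_
        have hk := onPiece_jumpTime (jumpTime_ne_top_of_mark hy)
        simp only [hlv, flowValue_of_onPiece M hk]
        rfl
      rw [h2]
      refine (Finset.sum_le_card_nsmul _ _ (m : ℝ≥0∞) fun k _ => ?_).trans (by simp)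
      split_ifs
      · refine (mul_le_mul' (he1 _ ENNReal.toReal_nonneg) ?_).trans (one_mul _).le
        rw [markValue]
        rcases mark ω k with y | z
        · exact_mod_cast hwm _
        · simp
      · exact zero_le
    refine ne_top_of_le_ne_top ?_ (lintegral_mono this)
    simp only [lintegral_const, measure_univ, mul_one]
    exact ENNReal.mul_ne_top (by simp) (by simp)
  have hlvle : ∀ p, lv p ≤ m := by
    intro p
    rw [hlv]
    simp only [flowValue, leftValue]
    rcases M.leftState p.path p.time with y | z
    · exact_mod_cast hwm _
    · simp
  have hGf : ∫⁻ ω, G ω ∂P ≠ ∞ := by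
    have : ∀ ω, G ω ≤ ∫⁻ _ in Ioc (0 : ℝ) t, (ρ * m : ℝ≥0∞) := by
      intro ω
      refine setLIntegral_mono measurable_const fun u hu => ?_
      split_ifs
      · rw [hee']
        gcongr
        · exact (mul_le_mul' le_rfl (he1 u hu.1.le)).trans (mul_one _).le
        · exact hlvle _
      · exact zero_le
    refine ne_top_of_le_ne_top ?_ (lintegral_mono this)
    simp only [lintegral_const, measure_univ, mul_one, Measure.restrict_apply, MeasurableSet.univ,
      univ_inter, Real.volume_Ioc]
    exact ENNReal.mul_ne_top (ENNReal.mul_ne_top (by simp) (by simp)) (by simp)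
  -- the drift
  have hdrift : ∀ ω, intensityIntegral Λ Y₁ ω ≤ intensityIntegral Λ Y₂ ω + (G ω + b * t) := by
    intro ω
    have hGt : G ω + b * t = ∫⁻ u in Ioi (0 : ℝ), (Ioc (0 : ℝ) t).indicator (fun u =>
        (if ENNReal.ofReal u ≤ jumpTime ω n then e' u * lv ⟨u.toNNReal, ω⟩ else 0) + b) u := by
      rw [setLIntegral_indicator measurableSet_Ioc, Ioc_inter_Ioi, max_self,
        lintegral_add_right _ measurable_const]
      simp [hG]
    rw [hGt, intensityIntegral, intensityIntegral, ← lintegral_add_left]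
    · refine setLIntegral_mono' measurableSet_Ioi fun u hu => ?_
      set p : TimePath S := ⟨u.toNNReal, ω⟩ with hp
      have hu0 : (0 : ℝ) < u := hu
      have hpu : ((p.time : ℝ≥0) : ℝ) = u := by simp [hp, hu0.le]
      by_cases hcond : p.time < t ∧ (p.time : ℝ≥0∞) ≤ jumpTime p.path n
      · have hut : u ∈ Ioc (0 : ℝ) t := by
          refine ⟨hu, ?_⟩
          rw [← hpu]; exact_mod_cast hcond.1.le
        have hcond2 : ENNReal.ofReal u ≤ jumpTime ω n := hcond.2
        rw [indicator_of_mem hut, if_pos hcond2]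
        simp only [hY₁, hY₂, if_pos hcond]
        have hwp : Measurable fun y => (w (M.flow y (τ - p.time)) : ℝ≥0∞) :=
          hwτ.comp (measurable_const.prodMk measurable_id)
        rw [lintegral_const_mul _ hwp, lintegral_const, hpu]
        by_cases hal : p ∈ aliveSet M
        · obtain ⟨y, hy⟩ := mem_aliveSet_iff.1 hal
          have h5 : lv p = w (M.flow y (τ - p.time)) := by
            simp only [hlv, flowValue_of_inl hy]
          have h6 := hΛ p y hy (hcond.1.le.trans ht)
          rw [hpu] at h5 h6
          rw [h5, hee']
          refine (mul_le_mul' le_rfl h6).trans ?_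
          -- The drift bound splits into three parts: the rate times the old weight is the intensity
          -- of `Y₂`, the ρ term is the decay of the discount collected in `G`, and b is left over
          -- with e(u) ≤ 1.
          calc e u * ((ρ + Λ p univ) * w (M.flow y (τ - u)) + b)
              = e u * w (M.flow y (τ - u)) * Λ p univ +
                (ρ * e u * w (M.flow y (τ - u)) + e u * b) := by ring
            _ ≤ _ := by
              gcongr
              exact (mul_le_mul' (he1 u hu0.le) le_rfl).trans (one_mul _).le
        · rw [hP.eq_zero_of_notMem hal]
          simp
      · simp only [hY₁, if_neg hcond, lintegral_zero]
        exact zero_le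
    · exact (hY₂m.lintegral_kernel_prod_right (κ := Λ)).comp (measurable_section ω)
  have ham : Measurable fun ω : Path S =>
      (if (t : ℝ≥0∞) ≤ jumpTime ω n then e t * lv ⟨t, ω⟩ else 0) :=
    Measurable.ite (measurableSet_le measurable_const (measurable_jumpTime n))
      ((hlvm.comp (measurable_toTimePath measurable_const measurable_id)).const_mul _)
      measurable_const
  -- The same two terms stand on both sides of the balance. Truncation of w and stopping at the n-th
  -- jump make them finite, hence cancellable.
  have hfin : ∫⁻ ω, jumpSum Y₂ ω ∂P + ∫⁻ ω, G ω ∂P ≠ ∞ := ENNReal.add_ne_top.2 ⟨hB, hGf⟩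
  refine ENNReal.le_of_add_le_add_right hfin ?_
  calc _ = ∫⁻ ω, ((if (t : ℝ≥0∞) ≤ jumpTime ω n then e t * lv ⟨t, ω⟩ else 0) +
      jumpSum Y₂ ω + G ω) ∂P := by
        rw [lintegral_add_right _ hGm, lintegral_add_left ham, add_assoc]
    _ ≤ ∫⁻ ω, (w (M.flow x τ) + jumpSum Y₁ ω) ∂P := lintegral_mono_ae hbal
    _ = w (M.flow x τ) + ∫⁻ ω, intensityIntegral Λ Y₁ ω ∂P := by
        rw [lintegral_add_left measurable_const, hP.compensator Y₁ hY₁m]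
        simp
    _ ≤ w (M.flow x τ) + ∫⁻ ω, (intensityIntegral Λ Y₂ ω + (G ω + b * t)) ∂P := by
        gcongr with ω
        exact hdrift ω
    _ = w (M.flow x τ) + b * t + (∫⁻ ω, jumpSum Y₂ ω ∂P + ∫⁻ ω, G ω ∂P) := by
        rw [lintegral_add_right _ (hGm.add_const _), lintegral_add_right _ measurable_const,
          hP.compensator Y₂ hY₂m]
        simp only [lintegral_const, measure_univ, mul_one]
        ring

/-- The growth bound: `E w (ξ_t) ≤ e^{ρ t} (w (x) + b t)` along the flow. -/
theorem lintegral_flowValue_le {Λ : Kernel (TimePath S) S} [IsSFiniteKernel Λ] {x : S}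
    {P : Measure (Path S)} (hP : HasIntensity M Λ x P) {w : S → ℝ≥0} (hw : Measurable w)
    {τ ρ b : ℝ≥0}
    (hΛ : ∀ p y, M.leftState p.path p.time = Sum.inl y → p.time ≤ τ →
      ∫⁻ z, w (M.flow z (τ - p.time)) ∂(Λ p) ≤
        (ρ + Λ p univ) * w (M.flow y (τ - p.time)) + b) {t : ℝ≥0} (ht : t ≤ τ) :
    ENNReal.ofReal (Real.exp (-(ρ * t))) * ∫⁻ ω, (flowValue M w τ ⟨t, ω⟩ : ℝ≥0∞) ∂P ≤
      w (M.flow x τ) + b * t := by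
  classical
  set e : ℝ≥0∞ := ENNReal.ofReal (Real.exp (-(ρ * t))) with he
  set wm : ℕ → S → ℝ≥0 := fun m y => min (w y) m with hwm
  have hwmm : ∀ m, Measurable (wm m) := fun m => hw.min measurable_const
  have hval : ∀ m p, flowValue M (wm m) τ p = min (flowValue M w τ p) m := by
    intro m p
    simp only [flowValue, leftValue]
    rcases M.leftState p.path p.time with y | z
    · rfl
    · simp
  have key : ∀ n : ℕ, ∫⁻ ω, (if (t : ℝ≥0∞) ≤ jumpTime ω n then
      e * (flowValue M (wm n) τ ⟨t, ω⟩ : ℝ≥0∞) else 0) ∂P ≤ w (M.flow x τ) + b * t := by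
    intro n
    refine (lintegral_flowValue_le_of_bounded hP (b := b) (hwmm n) (m := n) (fun y => min_le_right _ _)
      ?_ ht n).trans ?_
    · intro p y hy hp
      -- Truncation preserves the drift condition. If the current weight is at most n, the
      -- right-hand side is unchanged and the left-hand side decreases. Otherwise the left-hand side
      -- is at most n times the total rate.
      by_cases hcase : w (M.flow y (τ - p.time)) ≤ n
      · have h1 : wm n (M.flow y (τ - p.time)) = w (M.flow y (τ - p.time)) := min_eq_left hcase
        rw [h1]
        exact le_trans (lintegral_mono fun z => ENNReal.coe_le_coe.2 (min_le_left _ _)) (hΛ p y hy hp)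
      · have h1 : wm n (M.flow y (τ - p.time)) = n := min_eq_right (not_le.1 hcase).le
        rw [h1]
        calc ∫⁻ z, (wm n (M.flow z (τ - p.time)) : ℝ≥0∞) ∂(Λ p) ≤ ∫⁻ _, (n : ℝ≥0∞) ∂(Λ p) :=
              lintegral_mono fun z => ENNReal.coe_le_coe.2 (min_le_right _ _)
          _ = Λ p univ * n := by rw [lintegral_const, mul_comm]
          _ ≤ (ρ + Λ p univ) * n := by gcongr; exact le_add_self
          _ ≤ _ := by simp
    · gcongr
      exact_mod_cast min_le_left _ _
  have hm : Measurable fun ω : Path S => (flowValue M w τ ⟨t, ω⟩ : ℝ≥0∞) :=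
    ((measurable_flowValue M hw τ).comp
      (measurable_toTimePath measurable_const measurable_id)).coe_nnreal_ennreal
  rw [← lintegral_const_mul _ hm]
  -- Monotone convergence in n, which is both the truncation level and the number of jumps allowed.
  -- On a path alive at t the supremum is reached; in the cemetery the weight is 0.
  calc ∫⁻ ω, e * (flowValue M w τ ⟨t, ω⟩ : ℝ≥0∞) ∂P ≤ ∫⁻ ω, ⨆ n : ℕ,
        (if (t : ℝ≥0∞) ≤ jumpTime ω n then
          e * (flowValue M (wm n) τ ⟨t, ω⟩ : ℝ≥0∞) else 0) ∂P := by
        refine lintegral_mono fun ω => ?_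
        rcases hs : M.leftState ω t with y | z
        · obtain ⟨N, hN⟩ := exists_onPiece_of_leftState M hs
          obtain ⟨k, hk⟩ := exists_nat_ge (flowValue M w τ ⟨t, ω⟩)
          have h1 : (t : ℝ≥0∞) ≤ jumpTime ω (max (N + 1) k) :=
            hN.2.trans (jumpTime_mono ω (le_max_left _ _))
          refine le_trans ?_ (le_iSup _ (max (N + 1) k))
          rw [if_pos h1, hval, min_eq_left (hk.trans (by exact_mod_cast le_max_right _ _))]
        · simp [flowValue, leftValue, hs]
    _ = ⨆ n : ℕ, ∫⁻ ω, (if (t : ℝ≥0∞) ≤ jumpTime ω n then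
          e * (flowValue M (wm n) τ ⟨t, ω⟩ : ℝ≥0∞) else 0) ∂P := by
        refine lintegral_iSup (fun n => ?_) ?_
        · exact Measurable.ite (measurableSet_le measurable_const (measurable_jumpTime n))
            (((measurable_flowValue M (hwmm n) τ).comp (measurable_toTimePath measurable_const
              measurable_id)).coe_nnreal_ennreal.const_mul _) measurable_const
        · intro i j hij ω
          simp only
          by_cases h1 : (t : ℝ≥0∞) ≤ jumpTime ω i
          · rw [if_pos h1, if_pos (h1.trans (jumpTime_mono ω hij)), hval, hval]
            gcongr
          · rw [if_neg h1]
            exact zero_le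
    _ ≤ _ := iSup_le key

end Moments

/-! ### Non-explosion, fixed times and Jensen's inequality -/

section Regularity

variable {S A B : Type*} [TopologicalSpace S] [MeasurableSpace S] [MeasurableSpace A]
  [MeasurableSpace B] {M : Game S A B}

omit [TopologicalSpace S] in
theorem measurable_timePath_at (t : ℝ≥0) : Measurable fun ω : Path S => TimePath.mk t ω :=
  measurable_toTimePath measurable_const measurable_id

omit [TopologicalSpace S] in
theorem measurable_jumpSum (x₀ : S) {Y : TimePath S → S → ℝ≥0∞}
    (hY : Measurable (Function.uncurry Y)) : Measurable (jumpSum Y) := by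
  classical
  refine Measurable.tsum fun n => ?_
  have h : (fun ω : Path S => Sum.elim (fun y => Y ⟨(jumpTime ω (n + 1)).toNNReal, ω⟩ y)
      (fun _ => 0) (mark ω (n + 1))) = fun ω => if mark ω (n + 1) ∈ range Sum.inl then
        Y ⟨(jumpTime ω (n + 1)).toNNReal, ω⟩ (Sum.elim id (fun _ => x₀) (mark ω (n + 1))) else 0 := by
    ext ω
    rcases mark ω (n + 1) with y | z <;> simp
  rw [h]
  refine Measurable.ite (measurable_mark _ measurableSet_range_inl) ?_ measurable_const
  exact hY.comp ((measurable_toTimePath (measurable_jumpTime _).ennreal_toNNReal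
    measurable_id).prodMk ((Measurable.sumElim measurable_id measurable_const).comp
    (measurable_mark _)))

/-- The moments of a function satisfying a drift condition are bounded on `[0, τ]`. -/
theorem exists_lintegral_flowValue_bound {Λ : Kernel (TimePath S) S} [IsSFiniteKernel Λ] {x : S}
    {P : Measure (Path S)} (hP : HasIntensity M Λ x P) {w : S → ℝ≥0} (hw : Measurable w)
    {τ ρ b : ℝ≥0}
    (hΛ : ∀ p y, M.leftState p.path p.time = Sum.inl y → p.time ≤ τ →
      ∫⁻ z, w (M.flow z (τ - p.time)) ∂(Λ p) ≤
        (ρ + Λ p univ) * w (M.flow y (τ - p.time)) + b) :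
    ∃ K : ℝ≥0, ∀ t ≤ τ, ∫⁻ ω, (flowValue M w τ ⟨t, ω⟩ : ℝ≥0∞) ∂P ≤ K := by
  refine ⟨(Real.exp (ρ * τ)).toNNReal * (w (M.flow x τ) + b * τ), fun t ht => ?_⟩
  have h := lintegral_flowValue_le hP hw hΛ ht
  set I := ∫⁻ ω, (flowValue M w τ ⟨t, ω⟩ : ℝ≥0∞) ∂P
  have h1 : ENNReal.ofReal (Real.exp (ρ * t)) * ENNReal.ofReal (Real.exp (-(ρ * t))) = 1 := by
    rw [← ENNReal.ofReal_mul (Real.exp_pos _).le, ← Real.exp_add]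
    simp
  calc I = ENNReal.ofReal (Real.exp (ρ * t)) * (ENNReal.ofReal (Real.exp (-(ρ * t))) * I) := by
        rw [← mul_assoc, h1, one_mul]
    _ ≤ ENNReal.ofReal (Real.exp (ρ * τ)) * (w (M.flow x τ) + b * τ) := by
        refine mul_le_mul' (ENNReal.ofReal_le_ofReal (Real.exp_le_exp.2 ?_)) (h.trans ?_)
        · exact mul_le_mul_of_nonneg_left (by exact_mod_cast ht) ρ.2
        · gcongr
    _ = _ := by push_cast; rfl

omit [TopologicalSpace S] in
theorem lintegral_time_lt_top {P : Measure (Path S)} [SFinite P] {w : TimePath S → ℝ≥0∞}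
    (hw : Measurable w) {τ K : ℝ≥0} (hK : ∀ t ≤ τ, ∫⁻ ω, w ⟨t, ω⟩ ∂P ≤ K) :
    ∫⁻ ω, (∫⁻ u in Ioc (0 : ℝ) τ, w ⟨u.toNNReal, ω⟩) ∂P < ∞ := by
  rw [lintegral_lintegral_swap (f := fun (ω : Path S) (u : ℝ) => w ⟨u.toNNReal, ω⟩)
    (hw.comp measurable_pathTime).aemeasurable]
  refine (setLIntegral_mono (g := fun _ => (K : ℝ≥0∞)) measurable_const fun u hu =>
    hK _ ?_).trans_lt ?_
  · exact Real.toNNReal_le_iff_le_coe.2 hu.2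
  · simp only [lintegral_const, Measure.restrict_apply, MeasurableSet.univ, univ_inter,
      Real.volume_Ioc]
    exact ENNReal.mul_lt_top (by simp) (by simp)

/-- If the jump rate has finite mean, there are only finitely many jumps before `τ`. -/
theorem HasIntensity.ae_exists_onPiece {Λ : Kernel (TimePath S) S} [IsSFiniteKernel Λ] {x : S}
    {P : Measure (Path S)} (hP : HasIntensity M Λ x P) {τ : ℝ≥0}
    (hfin : ∫⁻ ω, (∫⁻ u in Ioc (0 : ℝ) τ, Λ ⟨u.toNNReal, ω⟩ univ) ∂P < ∞) :
    ∀ᵐ ω ∂P, ∃ N, OnPiece ω τ N := by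
  classical
  -- This integrand counts the jumps before τ. Their mean number is at most the mean of the
  -- integrated rate, so it is finite.
  set Y : TimePath S → S → ℝ≥0∞ := fun p _ => if p.time < τ then 1 else 0 with hY
  have hYm : Measurable (Function.uncurry Y) :=
    Measurable.ite (measurable_fst (measurable_time measurableSet_Iio)) measurable_const
      measurable_const
  have h1 : ∫⁻ ω, jumpSum Y ω ∂P < ∞ := by
    rw [hP.compensator Y hYm]
    refine (lintegral_mono fun ω => ?_).trans_lt hfin
    rw [intensityIntegral, show Ioc (0 : ℝ) τ = Iic (τ : ℝ) ∩ Ioi 0 by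
      ext; simp [and_comm], ← setLIntegral_indicator measurableSet_Iic]
    refine setLIntegral_mono' measurableSet_Ioi fun u hu => ?_
    by_cases h : u.toNNReal < τ
    · have : u ∈ Iic (τ : ℝ) := Real.toNNReal_le_iff_le_coe.1 h.le
      simp [hY, h, indicator_of_mem this]
    · simp [hY, h]
  filter_upwards [ae_lt_top (measurable_jumpSum x hYm) h1.ne] with ω hω
  refine exists_onPiece ?_
  by_contra hcon
  push Not at hcon
  have h2 : jumpSum Y ω = ∑' _ : ℕ, (1 : ℝ≥0∞) := by
    refine tsum_congr fun n => ?_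
    have h3 : jumpTime ω (n + 1) ≠ ∞ := ((hcon _).trans ENNReal.coe_lt_top).ne
    obtain ⟨y, hy⟩ := exists_mark_eq h3
    have h4 : (jumpTime ω (n + 1)).toNNReal < τ := by
      rw [← ENNReal.coe_lt_coe, ENNReal.coe_toNNReal h3]
      exact hcon _
    rw [hy]
    simp [hY, h4]
  rw [h2, ENNReal.tsum_const_eq_top_of_ne_zero one_ne_zero] at hω
  exact lt_irrefl _ hω

/-- There is no jump at a fixed time. -/
theorem HasIntensity.ae_jumpTime_ne {Λ : Kernel (TimePath S) S} {x : S}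
    {P : Measure (Path S)} (hP : HasIntensity M Λ x P) (τ : ℝ≥0) :
    ∀ᵐ ω ∂P, ∀ k, jumpTime ω (k + 1) ≠ τ := by
  classical
  -- The compensator is absolutely continuous in time, so it does not charge the single instant τ.
  set Y : TimePath S → S → ℝ≥0∞ := fun p _ => if p.time = τ then 1 else 0 with hY
  have hYm : Measurable (Function.uncurry Y) :=
    Measurable.ite (measurable_fst (measurable_time (measurableSet_singleton τ))) measurable_const
      measurable_const
  have h1 : ∫⁻ ω, jumpSum Y ω ∂P = 0 := by
    rw [hP.compensator Y hYm]
    have : ∀ ω, intensityIntegral Λ Y ω = 0 := by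
      intro ω
      rw [intensityIntegral, lintegral_congr_ae (g := fun _ => 0), lintegral_zero]
      have hne : ∀ᵐ u : ℝ, u ≠ τ := by
        simpa using (countable_singleton (τ : ℝ)).ae_notMem volume
      filter_upwards [ae_restrict_of_ae hne, ae_restrict_mem measurableSet_Ioi] with u hu hu0
      have : u.toNNReal ≠ τ := by
        rintro rfl
        exact hu (Real.coe_toNNReal _ (le_of_lt hu0)).symm
      simp [hY, this]
    simp [this]
  filter_upwards [(lintegral_eq_zero_iff (measurable_jumpSum x hYm)).1 h1] with ω hω k hk
  have h2 := (ENNReal.tsum_eq_zero.1 hω) k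
  have h3 : jumpTime ω (k + 1) ≠ ∞ := by rw [hk]; exact ENNReal.coe_ne_top
  obtain ⟨y, hy⟩ := exists_mark_eq h3
  rw [hy, Sum.elim_inl, hk] at h2
  simp [hY] at h2

/-- Jensen's inequality for the exponential of a time integral. -/
theorem exp_two_mul_integral_le {κ τ : ℝ} (hκ : 1 ≤ κ) (hτ : 0 ≤ τ) (hτκ : τ ≤ κ) {g : ℝ → ℝ}
    (hg : IntegrableOn g (Ioc 0 τ)) (hge : IntegrableOn (fun u => Real.exp (2 * κ * g u)) (Ioc 0 τ)) :
    Real.exp (2 * ∫ u in Ioc 0 τ, g u) ≤ 1 + ∫ u in Ioc 0 τ, Real.exp (2 * κ * g u) := by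
  -- Averaging over (0, κ] instead of (0, τ], with g extended by 0, keeps the normalisation away
  -- from 0 when τ is small. The part outside (0, τ] contributes (κ - τ)/κ ≤ 1.
  set μ : Measure ℝ := volume.restrict (Ioc 0 κ) with hμ
  set h : ℝ → ℝ := (Ioc 0 τ).indicator fun u => 2 * κ * g u with hh
  have hsub : Ioc 0 τ ⊆ Ioc 0 κ := Ioc_subset_Ioc_right hτκ
  have hμuniv : μ.real univ = κ := by
    simp [hμ, Measure.real, Real.volume_Ioc]; linarith
  have hμ0 : NeZero μ := ⟨fun h0 => by rw [h0] at hμuniv; simp at hμuniv; linarith⟩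
  have hμτ : μ.restrict (Ioc 0 τ) = volume.restrict (Ioc 0 τ) := by
    rw [hμ, Measure.restrict_restrict measurableSet_Ioc, inter_eq_left.2 hsub]
  have hi : Integrable h μ := by
    rw [hh, integrable_indicator_iff measurableSet_Ioc, IntegrableOn, hμτ]
    exact Integrable.const_mul hg _
  have hexp : (fun u => Real.exp (h u)) = fun u => 1 +
      (Ioc 0 τ).indicator (fun u => Real.exp (2 * κ * g u) - 1) u := by
    ext u
    by_cases hu : u ∈ Ioc 0 τ
    · simp [hh, indicator_of_mem hu]
    · simp [hh, indicator_of_notMem hu]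
  have hi1 : IntegrableOn (fun u => Real.exp (2 * κ * g u) - 1) (Ioc 0 τ) :=
    Integrable.sub hge (integrable_const _)
  have hi2 : Integrable ((Ioc 0 τ).indicator fun u => Real.exp (2 * κ * g u) - 1) μ := by
    rw [integrable_indicator_iff measurableSet_Ioc, IntegrableOn, hμτ]
    exact hi1
  have hiexp : Integrable (fun u => Real.exp (h u)) μ := by
    rw [hexp]
    exact (integrable_const _).add hi2
  have key := convexOn_exp.map_average_le (μ := μ) (f := h) Real.continuous_exp.continuousOn
    isClosed_univ (by simp) hi hiexp
  rw [average_eq, average_eq, hμuniv] at key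
  have e1 : ∫ u, h u ∂μ = 2 * κ * ∫ u in Ioc 0 τ, g u := by
    rw [hh, integral_indicator measurableSet_Ioc, hμτ, integral_const_mul]
  have e2 : ∫ u, Real.exp (h u) ∂μ = κ + ((∫ u in Ioc 0 τ, Real.exp (2 * κ * g u)) - τ) := by
    rw [hexp, integral_add (integrable_const _) hi2, integral_indicator measurableSet_Ioc, hμτ,
      integral_sub hge (integrable_const _)]
    simp [hμuniv, hτ]
  rw [e1, e2, smul_eq_mul, smul_eq_mul] at key
  have hκ0 : 0 < κ := by linarith
  have e3 : κ⁻¹ * (2 * κ * ∫ u in Ioc 0 τ, g u) = 2 * ∫ u in Ioc 0 τ, g u := by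
    field_simp
  rw [e3] at key
  refine key.trans ?_
  have hI : 0 ≤ ∫ u in Ioc 0 τ, Real.exp (2 * κ * g u) :=
    integral_nonneg fun u => (Real.exp_pos _).le
  rw [inv_mul_le_iff₀ hκ0]
  nlinarith

end Regularity

/-! ### The pathwise inequality for subsolutions -/

section Pathwise

variable {S A B : Type*} [TopologicalSpace S] [MeasurableSpace S] [MeasurableSpace A]
  [MeasurableSpace B] (M : Game S A B)

/-- The change `F (u, z) - F (u, ξ_{u-})` at a jump to `z`. -/
def jumpDiff (F : ℝ → S → ℝ) (p : TimePath S) (z : S) : ℝ :=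
  F p.time z - leftValue M (fun u => F u) p

/-- The discounting factor `exp (lam ∫₀ᵘ c)` as a process. -/
def discount (lam : ℝ) (c : TimePath S → ℝ) (p : TimePath S) : ℝ :=
  expWeight lam (fun r => c ⟨r.toNNReal, p.path⟩) p.time

/-- `F` is a subsolution of the Kolmogorov equation with intensity `Λ` and potential `lam * c`. -/
structure Subsolution (Λ : Kernel (TimePath S) S) (c : TimePath S → ℝ) (lam : ℝ)
    (F : ℝ → S → ℝ) (τ : ℝ≥0) : Prop where
  absCont : ∀ a ∈ Icc (0 : ℝ) τ, ∀ y,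
    AbsolutelyContinuousOnInterval (fun t => F (a + t) (M.flow y t)) 0 (τ - a)
  deriv : ∀ a ∈ Icc (0 : ℝ) τ, ∀ y, ∀ᵐ t, t ∈ Ioo 0 (τ - a) →
    ∃ d, HasDerivAt (fun t => F (a + t) (M.flow y t)) d t ∧
      ∀ p : TimePath S, p.time = (a + t).toNNReal →
        M.leftState p.path p.time = Sum.inl (M.flow y t) →
        0 ≤ d + lam * c p * F (a + t) (M.flow y t) + ∫ z, jumpDiff M F p z ∂(Λ p)

variable {M} {Λ : Kernel (TimePath S) S} {c : TimePath S → ℝ} {lam : ℝ} {F : ℝ → S → ℝ} {τ : ℝ≥0}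

omit [TopologicalSpace S] [MeasurableSpace S] in
theorem discount_pos (p : TimePath S) : 0 < discount lam c p := Real.exp_pos _

omit [TopologicalSpace S] in
-- Predictability, not just joint measurability, is what admits the discounted jump as an integrand
-- in the compensator identity.
theorem measurable_discount (hc : Measurable c) : Measurable (discount lam c) :=
  ((measurable_timeIntegral hc).const_mul lam).exp

theorem measurable_jumpDiff (hF : Measurable (Function.uncurry F)) :
    Measurable (Function.uncurry (jumpDiff M F)) := by
  refine Measurable.sub ?_ ?_
  · exact hF.comp ((measurable_time.comp measurable_fst).coe_nnreal_real.prodMk measurable_snd)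
  · refine (measurable_leftValue M ?_).comp measurable_fst
    exact hF.comp (measurable_fst.coe_nnreal_real.prodMk measurable_snd)

/-- The growth of the discounted value of a subsolution between two jumps. -/
theorem Subsolution.le_on_piece (h : Subsolution M Λ c lam F τ) {ω : Path S}
    (hc : IntervalIntegrable (fun r : ℝ => c ⟨r.toNNReal, ω⟩) volume 0 τ)
    (hR : IntervalIntegrable (fun u : ℝ => discount lam c ⟨u.toNNReal, ω⟩ *
      ∫ z, jumpDiff M F ⟨u.toNNReal, ω⟩ z ∂(Λ ⟨u.toNNReal, ω⟩)) volume 0 τ)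
    {u : ℝ≥0} (hu : u ≤ τ) {k : ℕ} (hk : OnPiece ω u k) {y : S} (hy : mark ω k = Sum.inl y) :
    discount lam c ⟨(jumpTime ω k).toNNReal, ω⟩ * F (jumpTime ω k).toReal y -
      (∫ r in (jumpTime ω k).toReal..u, discount lam c ⟨r.toNNReal, ω⟩ *
        ∫ z, jumpDiff M F ⟨r.toNNReal, ω⟩ z ∂(Λ ⟨r.toNNReal, ω⟩)) ≤
      discount lam c ⟨u, ω⟩ * leftValue M (fun u => F u) ⟨u, ω⟩ := by
  set a : ℝ := (jumpTime ω k).toReal with ha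
  set c' : ℝ → ℝ := fun r => c ⟨r.toNNReal, ω⟩ with hc'
  set R : ℝ → ℝ := fun r => ∫ z, jumpDiff M F ⟨r.toNNReal, ω⟩ z ∂(Λ ⟨r.toNNReal, ω⟩) with hRdef
  have ha0 : 0 ≤ a := ENNReal.toReal_nonneg
  have hau : a ≤ u := by
    have := ENNReal.toReal_mono ENNReal.coe_ne_top hk.jumpTime_le
    simpa using this
  have huτ : (u : ℝ) ≤ τ := NNReal.coe_le_coe.2 hu
  have hdisc : ∀ r : ℝ, 0 ≤ r → discount lam c ⟨r.toNNReal, ω⟩ = expWeight lam c' r := by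
    intro r hr
    simp only [discount, Real.coe_toNNReal r hr]
    rfl
  have hR' : IntervalIntegrable (fun r => expWeight lam c' r * R r) volume a (a + (u - a)) := by
    rw [add_sub_cancel]
    refine (hR.mono_set ?_).congr fun r hr => ?_
    · rw [uIcc_of_le hau, uIcc_of_le (by positivity)]
      exact Icc_subset_Icc ha0 huτ
    · rw [uIoc_of_le hau] at hr
      simp only [hdisc r (ha0.trans hr.1.le)]
      rfl
  have hcc : IntervalIntegrable c' volume 0 (a + (u - a)) := by
    rw [add_sub_cancel]
    refine hc.mono_set ?_
    rw [uIcc_of_le (by positivity), uIcc_of_le (by positivity)]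
    exact Icc_subset_Icc le_rfl huτ
  have haτ : a ∈ Icc (0 : ℝ) τ := ⟨ha0, hau.trans huτ⟩
  have hAC := (h.absCont a haτ y).mono (c := 0) (d := u - a) (by
    rw [uIcc_of_le (by linarith), uIcc_of_le (by linarith)]
    exact Icc_subset_Icc le_rfl (by linarith))
  -- The piece is followed from the jump time a up to u. At interior times a + t the left state is
  -- φ(y, t), so the subsolution inequality applies to the path ω itself.
  have key := expWeight_sub_ge (lam := lam) (R := R) ha0 (sub_nonneg.2 hau) hcc hAC hR' (by
    filter_upwards [h.deriv a haτ y] with t ht ht1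
    obtain ⟨d, hd, hd2⟩ := ht ⟨ht1.1, by linarith [ht1.2]⟩
    refine ⟨d, hd, hd2 ⟨(a + t).toNNReal, ω⟩ rfl ?_⟩
    have h0 : 0 ≤ a + t := by linarith [ht1.1]
    have hp : OnPiece ω (a + t).toNNReal k := by
      refine ⟨Or.inr ?_, le_trans ?_ hk.2⟩
      · rw [← ENNReal.ofReal_toReal hk.ne_top, ← ha]
        exact (ENNReal.ofReal_lt_ofReal_iff (by linarith [ht1.1])).2 (by linarith [ht1.1])
      · refine ENNReal.coe_le_coe.2 (Real.toNNReal_le_iff_le_coe.2 ?_)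
        linarith [ht1.2]
    rw [leftState_of_onPiece_of_mark M hp hy, Real.coe_toNNReal _ h0, ← ha, add_sub_cancel_left])
  rw [add_sub_cancel] at key
  have h1 : leftValue M (fun u => F u) ⟨u, ω⟩ = F u (M.flow y (u - a)) :=
    leftValue_of_inl (p := ⟨u, ω⟩) (leftState_of_onPiece_of_mark M hk hy)
  have h2 : ∫ r in a..u, discount lam c ⟨r.toNNReal, ω⟩ * R r =
      ∫ r in a..u, expWeight lam c' r * R r := by
    refine intervalIntegral.integral_congr fun r hr => ?_
    rw [uIcc_of_le hau] at hr
    simp only [hdisc r (ha0.trans hr.1)]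
  have h3 : discount lam c ⟨(jumpTime ω k).toNNReal, ω⟩ = expWeight lam c' a := rfl
  have h4 : discount lam c ⟨u, ω⟩ = expWeight lam c' u := rfl
  simp only [add_zero, M.flow_zero] at key
  rw [h1, h2, h3, h4]
  linarith

/-- The discounted value of a subsolution along a path dominates the initial value plus the
compensated jumps. -/
theorem Subsolution.le_path (h : Subsolution M Λ c lam F τ) {ω : Path S} {x : S}
    (hx : mark ω 0 = Sum.inl x)
    (hc : IntervalIntegrable (fun r : ℝ => c ⟨r.toNNReal, ω⟩) volume 0 τ)
    (hR : IntervalIntegrable (fun u : ℝ => discount lam c ⟨u.toNNReal, ω⟩ *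
      ∫ z, jumpDiff M F ⟨u.toNNReal, ω⟩ z ∂(Λ ⟨u.toNNReal, ω⟩)) volume 0 τ)
    {N : ℕ} (hN : OnPiece ω τ N) :
    F 0 x + (∑ k ∈ Finset.range N, Sum.elim
        (fun y => discount lam c ⟨(jumpTime ω (k + 1)).toNNReal, ω⟩ *
          jumpDiff M F ⟨(jumpTime ω (k + 1)).toNNReal, ω⟩ y) (fun _ => 0) (mark ω (k + 1))) -
      (∫ r in (0 : ℝ)..τ, discount lam c ⟨r.toNNReal, ω⟩ *
        ∫ z, jumpDiff M F ⟨r.toNNReal, ω⟩ z ∂(Λ ⟨r.toNNReal, ω⟩)) ≤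
      discount lam c ⟨τ, ω⟩ * leftValue M (fun u => F u) ⟨τ, ω⟩ := by
  set G : ℝ → ℝ := fun r => discount lam c ⟨r.toNNReal, ω⟩ *
        ∫ z, jumpDiff M F ⟨r.toNNReal, ω⟩ z ∂(Λ ⟨r.toNNReal, ω⟩) with hG
  have hmem : ∀ n ≤ N, (jumpTime ω n).toReal ∈ uIcc (0 : ℝ) τ := by
    intro n hn
    rw [uIcc_of_le (NNReal.coe_nonneg _)]
    refine ⟨ENNReal.toReal_nonneg, ?_⟩
    have := ENNReal.toReal_mono ENNReal.coe_ne_top ((jumpTime_mono ω hn).trans hN.jumpTime_le)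
    simpa using this
  have hii : ∀ {s t : ℝ}, s ∈ uIcc (0 : ℝ) τ → t ∈ uIcc (0 : ℝ) τ →
      IntervalIntegrable G volume s t := fun hs ht => hR.mono_set (uIcc_subset_uIcc hs ht)
  have h0 : (0 : ℝ) ∈ uIcc (0 : ℝ) τ := left_mem_uIcc
  -- Telescoping over the jumps: the estimate on a piece ends at the left value at T_{n+1}, and
  -- adding the jump difference gives the value at X_{n+1}, from which the next piece starts.
  have step : ∀ n ≤ N, ∀ y, mark ω n = Sum.inl y →
      F 0 x + (∑ k ∈ Finset.range n, Sum.elim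
        (fun y => discount lam c ⟨(jumpTime ω (k + 1)).toNNReal, ω⟩ *
          jumpDiff M F ⟨(jumpTime ω (k + 1)).toNNReal, ω⟩ y) (fun _ => 0) (mark ω (k + 1))) -
      (∫ r in (0 : ℝ)..(jumpTime ω n).toReal, G r) ≤
      discount lam c ⟨(jumpTime ω n).toNNReal, ω⟩ * F (jumpTime ω n).toReal y := by
    intro n
    induction n with
    | zero =>
      intro _ y hy
      rw [hx] at hy
      obtain rfl := Sum.inl_injective hy
      simp [jumpTime_zero, discount, expWeight]
    | succ n ih =>
      intro hn y hy
      have hn1 : jumpTime ω (n + 1) < τ := (hN.lt_iff n).2 hn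
      have hnt := jumpTime_ne_top_of_mark hy
      have hp := onPiece_jumpTime hnt
      obtain ⟨y', hy'⟩ := exists_mark_eq hp.ne_top
      have h1 := ih (by omega) y' hy'
      have h2 := h.le_on_piece hc hR (u := (jumpTime ω (n + 1)).toNNReal)
        ((ENNReal.toNNReal_le_toNNReal hnt ENNReal.coe_ne_top).2 hn1.le) hp hy'
      have h3 := intervalIntegral.integral_add_adjacent_intervals
        (hii h0 (hmem n (by omega))) (hii (hmem n (by omega)) (hmem (n + 1) hn))
      rw [Finset.sum_range_succ, hy, Sum.elim_inl]
      have h4 : jumpDiff M F ⟨(jumpTime ω (n + 1)).toNNReal, ω⟩ y =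
        F (jumpTime ω (n + 1)).toReal y -
          leftValue M (fun u => F u) ⟨(jumpTime ω (n + 1)).toNNReal, ω⟩ := rfl
      rw [h4, mul_sub, ← h3]
      change _ - (∫ r in (jumpTime ω n).toReal..(jumpTime ω (n + 1)).toReal, G r) ≤ _ at h2
      linarith
  obtain ⟨y, hy⟩ := exists_mark_eq hN.ne_top
  have h1 := step N le_rfl y hy
  have h2 := h.le_on_piece hc hR le_rfl hN hy
  have h3 := intervalIntegral.integral_add_adjacent_intervals
    (hii h0 (hmem N le_rfl)) (hii (hmem N le_rfl) right_mem_uIcc)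
  change _ - (∫ r in (jumpTime ω N).toReal..τ, G r) ≤ _ at h2
  rw [← h3]
  linarith

end Pathwise

/-! ### Integrability and expectation -/

section Expectation

variable {S A B : Type*} [TopologicalSpace S] [MeasurableSpace S] [MeasurableSpace A]
  [MeasurableSpace B] (M : Game S A B)

/-- The growth conditions, up to the time `τ`, that control the expectations of the process with
intensity `Λ`, with the common constant `C`. -/
structure Controlled (Λ : Kernel (TimePath S) S) (c : TimePath S → ℝ) (F : ℝ → S → ℝ) (τ : ℝ≥0)
    (v v₁ : S → ℝ≥0) (C : ℝ≥0) : Prop where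
  measurable_v : Measurable v
  measurable_v₁ : Measurable v₁
  one_le : ∀ y, 1 ≤ v y
  sq_le : ∀ y, v y ^ 2 ≤ C * v₁ y
  drift : ∀ p y, M.leftState p.path p.time = Sum.inl y → p.time ≤ τ →
    ∫⁻ z, v (M.flow z (τ - p.time)) ∂(Λ p) ≤
      (C + Λ p univ) * v (M.flow y (τ - p.time)) + C
  drift₁ : ∀ p y, M.leftState p.path p.time = Sum.inl y → p.time ≤ τ →
    ∫⁻ z, ((v₁ (M.flow z (τ - p.time)) ^ 2 : ℝ≥0) : ℝ≥0∞) ∂(Λ p) ≤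
      (C + Λ p univ) * ((v₁ (M.flow y (τ - p.time)) ^ 2 : ℝ≥0) : ℝ≥0∞) + C
  rate_le : ∀ p y, M.leftState p.path p.time = Sum.inl y → p.time ≤ τ →
    Λ p univ ≤ C * v (M.flow y (τ - p.time))
  measurable_cost : Measurable c
  cost_le : ∀ p y, M.leftState p.path p.time = Sum.inl y → p.time ≤ τ →
    ENNReal.ofReal (Real.exp (2 * (τ + 1) * |c p|)) ≤ C * v (M.flow y (τ - p.time))
  measurable_value : Measurable (Function.uncurry F)
  value_le : ∀ u : ℝ≥0, u ≤ τ → ∀ y, ‖F u y‖ₑ ≤ C * v (M.flow y (τ - u))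

variable {M} {Λ : Kernel (TimePath S) S} {c : TimePath S → ℝ} {lam : ℝ} {F : ℝ → S → ℝ} {τ : ℝ≥0}
  {v v₁ : S → ℝ≥0} {C : ℝ≥0}

theorem flowValue_sq_pow {ω : TimePath S} :
    flowValue M (fun y => v y ^ 2) τ ω = flowValue M v τ ω ^ 2 := by
  simp only [flowValue, leftValue]
  rcases M.leftState ω.path ω.time with y | z <;> simp

theorem Controlled.flowValue_sq_le (h : Controlled M Λ c F τ v v₁ C) (p : TimePath S) :
    flowValue M v τ p ^ 2 ≤ C * flowValue M v₁ τ p := by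
  simp only [flowValue, leftValue]
  rcases M.leftState p.path p.time with y | z
  · exact h.sq_le _
  · simp

/-- The jump is at most C(v(z) + v(y)). Integrating v(z) by the drift condition and v(y) by the rate
bound costs one more factor v. Since v ≥ 1, the four resulting terms are each at most C² v². -/
theorem Controlled.lintegral_jumpDiff_le (h : Controlled M Λ c F τ v v₁ C) {p : TimePath S} {y : S}
    (hy : M.leftState p.path p.time = Sum.inl y) (hp : p.time ≤ τ) :
    ∫⁻ z, ‖jumpDiff M F p z‖ₑ ∂(Λ p) ≤ 4 * C ^ 2 * (flowValue M v τ p : ℝ≥0∞) ^ 2 := by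
  rw [flowValue_of_inl hy]
  set V : ℝ≥0∞ := (v (M.flow y (τ - p.time)) : ℝ≥0∞) with hV
  have hV1 : 1 ≤ V := ENNReal.one_le_coe_iff.2 (h.one_le _)
  have h1 : ∀ z, ‖jumpDiff M F p z‖ₑ ≤ C * v (M.flow z (τ - p.time)) + C * V := by
    intro z
    rw [jumpDiff, leftValue_of_inl hy]
    exact (enorm_sub_le).trans (add_le_add (h.value_le _ hp z) (h.value_le _ hp y))
  have hm : Measurable fun z => (v (M.flow z (τ - p.time)) : ℝ≥0∞) :=
    (h.measurable_v.comp (M.measurable_flow.comp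
      (measurable_id.prodMk measurable_const))).coe_nnreal_ennreal
  have h2 := h.rate_le p y hy hp
  have hVV : V ≤ V ^ 2 := by
    rw [sq]; exact (one_mul V).symm.le.trans (mul_le_mul' hV1 le_rfl)
  calc ∫⁻ z, ‖jumpDiff M F p z‖ₑ ∂(Λ p)
      ≤ ∫⁻ z, (C * v (M.flow z (τ - p.time)) + C * V) ∂(Λ p) := lintegral_mono h1
    _ = C * ∫⁻ z, v (M.flow z (τ - p.time)) ∂(Λ p) + C * V * Λ p univ := by
        rw [lintegral_add_right _ measurable_const, lintegral_const_mul _ hm, lintegral_const]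
    _ ≤ C * ((C + C * V) * V + C) + C * V * (C * V) := by
        gcongr
        refine (h.drift p y hy hp).trans ?_
        gcongr
    _ = C ^ 2 * V + C ^ 2 * 1 + 2 * C ^ 2 * V ^ 2 := by ring
    _ ≤ C ^ 2 * V ^ 2 + C ^ 2 * V ^ 2 + 2 * C ^ 2 * V ^ 2 := by
        gcongr
        exact hV1.trans hVV
    _ = _ := by ring

/-- Jensen's inequality with κ = τ + 1, which is the origin of the factor 2(τ + 1) in the growth
condition on c. Replacing c by |c| and using lam ≤ 1 makes the bound uniform in u. -/
theorem Controlled.discount_sq_le (h : Controlled M Λ c F τ v v₁ C) (hl0 : 0 ≤ lam)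
    (hl1 : lam ≤ 1) {ω : Path S} {N : ℕ} (hN : OnPiece ω τ N)
    (hX : ∫⁻ u in Ioc (0 : ℝ) τ, C * (flowValue M v τ ⟨u.toNNReal, ω⟩ : ℝ≥0∞) ≠ ∞) :
    IntegrableOn (fun u : ℝ => c ⟨u.toNNReal, ω⟩) (Ioc 0 τ) ∧
    ∀ u ≤ τ, ENNReal.ofReal (discount lam c ⟨u, ω⟩) ^ 2 ≤
      1 + ∫⁻ u in Ioc (0 : ℝ) τ, C * (flowValue M v τ ⟨u.toNNReal, ω⟩ : ℝ≥0∞) := by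
  set X := ∫⁻ u in Ioc (0 : ℝ) τ, C * (flowValue M v τ ⟨u.toNNReal, ω⟩ : ℝ≥0∞) with hXd
  set g : ℝ → ℝ := fun u => |c ⟨u.toNNReal, ω⟩| with hg
  have hcm : Measurable fun u : ℝ => c ⟨u.toNNReal, ω⟩ :=
    h.measurable_cost.comp (measurable_section ω)
  have hgm : Measurable g := hcm.abs
  have hle : ∀ u ∈ Ioc (0 : ℝ) τ, ENNReal.ofReal (Real.exp (2 * (τ + 1) * g u)) ≤
      C * (flowValue M v τ ⟨u.toNNReal, ω⟩ : ℝ≥0∞) := by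
    intro u hu
    have hu' : u.toNNReal ≤ τ := Real.toNNReal_le_iff_le_coe.2 hu.2
    obtain ⟨k, hk⟩ := exists_onPiece (ω := ω) (u := u.toNNReal)
      ⟨N + 1, (ENNReal.coe_le_coe.2 hu').trans hN.2⟩
    obtain ⟨y, hy⟩ := exists_mark_eq hk.ne_top
    have hs := leftState_of_onPiece_of_mark M hk hy
    rw [flowValue_of_inl (p := ⟨u.toNNReal, ω⟩) hs]
    exact h.cost_le ⟨u.toNNReal, ω⟩ _ hs hu'
  have hlX : ∫⁻ u in Ioc (0 : ℝ) τ, ENNReal.ofReal (Real.exp (2 * (τ + 1) * g u)) ≤ X :=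
    setLIntegral_mono' measurableSet_Ioc hle
  have hem : Measurable fun u => Real.exp (2 * (τ + 1) * g u) := (hgm.const_mul _).exp
  have hexp : IntegrableOn (fun u => Real.exp (2 * (τ + 1) * g u)) (Ioc 0 τ) := by
    refine ⟨hem.aestronglyMeasurable, ?_⟩
    rw [hasFiniteIntegral_iff_ofReal (ae_of_all _ fun u => (Real.exp_pos _).le)]
    exact hlX.trans_lt hX.lt_top
  have hτ0 : (0 : ℝ) ≤ τ := NNReal.coe_nonneg τ
  have hgi : IntegrableOn g (Ioc 0 τ) := by
    refine Integrable.mono' hexp hgm.aestronglyMeasurable (ae_of_all _ fun u => ?_)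
    rw [Real.norm_eq_abs, hg, abs_abs]
    have h1 := Real.add_one_le_exp (2 * (τ + 1) * |c ⟨u.toNNReal, ω⟩|)
    have h2 : 0 ≤ |c ⟨u.toNNReal, ω⟩| := abs_nonneg _
    nlinarith
  have hci : IntegrableOn (fun u : ℝ => c ⟨u.toNNReal, ω⟩) (Ioc 0 τ) :=
    (integrable_norm_iff hcm.aestronglyMeasurable).1 hgi
  refine ⟨hci, fun u hu => ?_⟩
  have hJ := exp_two_mul_integral_le (κ := τ + 1) (by linarith) hτ0 (by linarith) hgi hexp
  have h1 : ∫ u in Ioc 0 (τ : ℝ), Real.exp (2 * (τ + 1) * g u) ≤ X.toReal := by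
    rw [integral_eq_lintegral_of_nonneg_ae (ae_of_all _ fun u => (Real.exp_pos _).le)
      hem.aestronglyMeasurable]
    exact ENNReal.toReal_mono hX hlX
  have h2 : lam * ∫ r in (0 : ℝ)..u, c ⟨r.toNNReal, ω⟩ ≤ ∫ u in Ioc 0 (τ : ℝ), g u := by
    have h3 : ∫ r in (0 : ℝ)..u, c ⟨r.toNNReal, ω⟩ ≤ ∫ u in Ioc 0 (τ : ℝ), g u := by
      rw [intervalIntegral.integral_of_le (NNReal.coe_nonneg u)]
      refine (le_abs_self _).trans ((abs_integral_le_integral_abs).trans ?_)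
      exact setIntegral_mono_set hgi (ae_of_all _ fun _ => abs_nonneg _)
        (Ioc_subset_Ioc_right (NNReal.coe_le_coe.2 hu)).eventuallyLE
    have h4 : 0 ≤ ∫ u in Ioc 0 (τ : ℝ), g u := integral_nonneg fun _ => abs_nonneg _
    nlinarith
  have h5 : discount lam c ⟨u, ω⟩ ^ 2 ≤ 1 + X.toReal := by
    refine le_trans ?_ (hJ.trans (by linarith))
    rw [discount, expWeight, ← Real.exp_nat_mul]
    refine Real.exp_le_exp.2 ?_
    push_cast
    linarith
  rw [← ENNReal.ofReal_pow (discount_pos _).le]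
  refine (ENNReal.ofReal_le_ofReal h5).trans ?_
  rw [ENNReal.ofReal_add zero_le_one ENNReal.toReal_nonneg, ENNReal.ofReal_toReal hX,
    ENNReal.ofReal_one]

/-- The jumps before `τ`, weighted with the positive (`s = 1`) or negative (`s = -1`) part of the
discounted jump of `F`. -/
def signedJump (M : Game S A B) (c : TimePath S → ℝ) (lam : ℝ) (F : ℝ → S → ℝ) (τ : ℝ≥0) (s : ℝ)
    (p : TimePath S) (z : S) : ℝ≥0∞ :=
  (Iio τ).indicator (fun _ => ENNReal.ofReal (s * (discount lam c p * jumpDiff M F p z))) p.time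

theorem measurable_signedJump (hc : Measurable c) (hF : Measurable (Function.uncurry F)) (s : ℝ) :
    Measurable (Function.uncurry (signedJump M c lam F τ s)) := by
  classical
  have h : Function.uncurry (signedJump M c lam F τ s) =
      ((fun q : TimePath S × S => q.1.time) ⁻¹' Iio τ).indicator fun q =>
        ENNReal.ofReal (s * (discount lam c q.1 * jumpDiff M F q.1 q.2)) := rfl
  rw [h]
  refine Measurable.indicator ?_ ((measurable_time.comp measurable_fst) measurableSet_Iio)
  exact ((((measurable_discount hc).comp measurable_fst).mul
    (measurable_jumpDiff hF)).const_mul s).ennreal_ofReal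

theorem intensityIntegral_signedJump (s : ℝ) (ω : Path S) :
    intensityIntegral Λ (signedJump M c lam F τ s) ω = ∫⁻ u in Ioc (0 : ℝ) τ,
      ∫⁻ z, ENNReal.ofReal (s * (discount lam c ⟨u.toNNReal, ω⟩ *
        jumpDiff M F ⟨u.toNNReal, ω⟩ z)) ∂(Λ ⟨u.toNNReal, ω⟩) := by
  rw [← setLIntegral_congr (Ioo_ae_eq_Ioc (a := (0 : ℝ)) (b := τ)), intensityIntegral,
    show Ioo (0 : ℝ) τ = Iio (τ : ℝ) ∩ Ioi 0 by ext; simp [and_comm],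
    ← setLIntegral_indicator measurableSet_Iio]
  refine setLIntegral_congr_fun measurableSet_Ioi fun u hu => ?_
  have hu0 : (0 : ℝ) < u := hu
  by_cases h : u < τ
  · have h1 : u.toNNReal ∈ Iio τ := (Real.toNNReal_lt_iff_lt_coe hu0.le).2 h
    rw [indicator_of_mem (show u ∈ Iio (τ : ℝ) from h)]
    simp only [signedJump, indicator_of_mem h1]
  · have h1 : u.toNNReal ∉ Iio τ := fun h' => h ((Real.toNNReal_lt_iff_lt_coe hu0.le).1 h')
    rw [indicator_of_notMem (show u ∉ Iio (τ : ℝ) from h)]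
    simp only [signedJump, indicator_of_notMem h1, lintegral_zero]

theorem jumpSum_signedJump {ω : Path S} {N : ℕ} (hN : OnPiece ω τ N) (s : ℝ) :
    jumpSum (signedJump M c lam F τ s) ω = ∑ k ∈ Finset.range N, ENNReal.ofReal (s * Sum.elim
      (fun y => discount lam c ⟨(jumpTime ω (k + 1)).toNNReal, ω⟩ *
          jumpDiff M F ⟨(jumpTime ω (k + 1)).toNNReal, ω⟩ y) (fun _ => 0) (mark ω (k + 1))) := by
  rw [jumpSum, tsum_eq_sum (s := Finset.range N)]
  · refine Finset.sum_congr rfl fun k hk => ?_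
    have h1 : jumpTime ω (k + 1) < τ := (hN.lt_iff k).2 (by simpa using hk)
    have h2 : (jumpTime ω (k + 1)).toNNReal ∈ Iio τ := by
      rw [mem_Iio, ← ENNReal.coe_lt_coe, ENNReal.coe_toNNReal h1.ne_top]
      exact h1
    rcases mark ω (k + 1) with y | z
    · simp only [Sum.elim_inl, signedJump, indicator_of_mem h2]
    · simp
  · intro k hk
    rcases hm : mark ω (k + 1) with y | z
    · have ht := jumpTime_ne_top_of_mark hm
      have h2 : (jumpTime ω (k + 1)).toNNReal ∉ Iio τ := by
        rw [mem_Iio, ← ENNReal.coe_lt_coe, ENNReal.coe_toNNReal ht, hN.lt_iff]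
        simpa using hk
      simp only [Sum.elim_inl, signedJump, indicator_of_notMem h2]
    · rfl

/-- A real number is the difference of its positive and negative parts. -/
theorem toReal_ofReal_sub (a : ℝ) :
    (ENNReal.ofReal (1 * a)).toReal - (ENNReal.ofReal (-1 * a)).toReal = a := by
  rw [one_mul, neg_one_mul, ENNReal.toReal_ofReal', ENNReal.toReal_ofReal']
  rcases le_total 0 a with h | h
  · rw [max_eq_left h, max_eq_right (by linarith)]; ring
  · rw [max_eq_right h, max_eq_left (by linarith)]; ring

/-- The compensated jumps up to `τ` are integrable in time along a path on which the absolute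
jump intensity is integrable. -/
theorem intervalIntegrable_of_lintegral_ne_top [IsSFiniteKernel Λ] (hc : Measurable c)
    (hF : Measurable (Function.uncurry F)) {ω : Path S}
    (hfin : ∀ u ∈ Ioc (0 : ℝ) τ,
      ∫⁻ z, ‖jumpDiff M F ⟨u.toNNReal, ω⟩ z‖ₑ ∂(Λ ⟨u.toNNReal, ω⟩) ≠ ∞)
    (h1 : intensityIntegral Λ (signedJump M c lam F τ 1) ω ≠ ∞)
    (h2 : intensityIntegral Λ (signedJump M c lam F τ (-1)) ω ≠ ∞) :
    IntervalIntegrable (fun u : ℝ => discount lam c ⟨u.toNNReal, ω⟩ *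
      ∫ z, jumpDiff M F ⟨u.toNNReal, ω⟩ z ∂(Λ ⟨u.toNNReal, ω⟩)) volume 0 τ ∧
    ∫ u in (0 : ℝ)..τ, discount lam c ⟨u.toNNReal, ω⟩ *
      ∫ z, jumpDiff M F ⟨u.toNNReal, ω⟩ z ∂(Λ ⟨u.toNNReal, ω⟩) =
      (intensityIntegral Λ (signedJump M c lam F τ 1) ω).toReal -
      (intensityIntegral Λ (signedJump M c lam F τ (-1)) ω).toReal := by
  set H : ℝ → ℝ → ℝ≥0∞ := fun s u => ∫⁻ z, ENNReal.ofReal (s * (discount lam c ⟨u.toNNReal, ω⟩ *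
        jumpDiff M F ⟨u.toNNReal, ω⟩ z)) ∂(Λ ⟨u.toNNReal, ω⟩) with hH
  have hHm : ∀ s, Measurable (H s) := by
    intro s
    have : Measurable (Function.uncurry fun (p : TimePath S) (z : S) =>
        ENNReal.ofReal (s * (discount lam c p * jumpDiff M F p z))) :=
      ((((measurable_discount hc).comp measurable_fst).mul
        (measurable_jumpDiff hF)).const_mul s).ennreal_ofReal
    exact (this.lintegral_kernel_prod_right (κ := Λ)).comp (measurable_section ω)
  rw [intensityIntegral_signedJump] at h1 h2
  rw [intensityIntegral_signedJump, intensityIntegral_signedJump]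
  change ∫⁻ u in Ioc (0 : ℝ) τ, H 1 u ≠ ∞ at h1
  change ∫⁻ u in Ioc (0 : ℝ) τ, H (-1) u ≠ ∞ at h2
  have heq : ∀ u ∈ Ioc (0 : ℝ) τ, discount lam c ⟨u.toNNReal, ω⟩ *
      ∫ z, jumpDiff M F ⟨u.toNNReal, ω⟩ z ∂(Λ ⟨u.toNNReal, ω⟩) =
      (H 1 u).toReal - (H (-1) u).toReal := by
    intro u hu
    have hm : Measurable (jumpDiff M F ⟨u.toNNReal, ω⟩) :=
      (measurable_jumpDiff hF).comp (measurable_const.prodMk measurable_id)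
    have hi : Integrable (jumpDiff M F ⟨u.toNNReal, ω⟩) (Λ ⟨u.toNNReal, ω⟩) :=
      ⟨hm.aestronglyMeasurable, (hfin u hu).lt_top⟩
    rw [← integral_const_mul, integral_eq_lintegral_pos_part_sub_lintegral_neg_part
      (hi.const_mul _)]
    simp only [hH, one_mul, neg_one_mul]
  have hi : IntegrableOn (fun u => (H 1 u).toReal - (H (-1) u).toReal) (Ioc (0 : ℝ) τ) :=
    (integrable_toReal_of_lintegral_ne_top (hHm 1).aemeasurable h1).sub
      (integrable_toReal_of_lintegral_ne_top (hHm (-1)).aemeasurable h2)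
  constructor
  · rw [intervalIntegrable_iff_integrableOn_Ioc_of_le (NNReal.coe_nonneg _)]
    exact hi.congr_fun (fun u hu => (heq u hu).symm) measurableSet_Ioc
  · rw [intervalIntegral.integral_of_le (NNReal.coe_nonneg _),
      setIntegral_congr_fun measurableSet_Ioc heq,
      integral_sub (integrable_toReal_of_lintegral_ne_top (hHm 1).aemeasurable h1)
      (integrable_toReal_of_lintegral_ne_top (hHm (-1)).aemeasurable h2),
      integral_toReal (hHm 1).aemeasurable (ae_lt_top (hHm 1) h1),
      integral_toReal (hHm (-1)).aemeasurable (ae_lt_top (hHm (-1)) h2)]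

theorem ennreal_mul_le_sq_add_sq (a b : ℝ≥0∞) : a * b ≤ a ^ 2 + b ^ 2 := by
  rcases le_total a b with h | h
  · exact (mul_le_mul' h le_rfl).trans (by rw [sq b]; exact le_add_self)
  · exact (mul_le_mul' le_rfl h).trans (by rw [sq a]; exact le_self_add)

/-- The process is alive up to `τ`. -/
theorem Controlled.ae_exists_onPiece [IsSFiniteKernel Λ] (hC : Controlled M Λ c F τ v v₁ C) {x : S}
    {P : Measure (Path S)} (hP : HasIntensity M Λ x P) : ∀ᵐ ω ∂P, ∃ N, OnPiece ω τ N := by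
  have := hP.prob
  obtain ⟨K, hK⟩ := exists_lintegral_flowValue_bound hP hC.measurable_v hC.drift
  have hvm := (measurable_flowValue M hC.measurable_v τ).coe_nnreal_ennreal
  have hfv := lintegral_time_lt_top hvm hK
  have hrate : ∀ p : TimePath S, p.time ≤ τ → Λ p univ ≤ C * (flowValue M v τ p : ℝ≥0∞) := by
    intro p hp
    by_cases hal : p ∈ aliveSet M
    · obtain ⟨y, hy⟩ := mem_aliveSet_iff.1 hal
      rw [flowValue_of_inl hy]
      exact hC.rate_le p y hy hp
    · rw [hP.eq_zero_of_notMem hal]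
      simp
  refine hP.ae_exists_onPiece (lt_of_le_of_lt (lintegral_mono fun ω =>
    setLIntegral_mono' measurableSet_Ioc fun u hu =>
      hrate _ (Real.toNNReal_le_iff_le_coe.2 hu.2)) ?_)
  have h1 : ∀ ω, ∫⁻ u in Ioc (0 : ℝ) τ, C * (flowValue M v τ ⟨u.toNNReal, ω⟩ : ℝ≥0∞) =
      C * ∫⁻ u in Ioc (0 : ℝ) τ, (flowValue M v τ ⟨u.toNNReal, ω⟩ : ℝ≥0∞) :=
    fun ω => lintegral_const_mul _ (hvm.comp (measurable_section ω))
  simp only [h1]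
  rw [lintegral_const_mul _ (measurable_timeLIntegral hvm _)]
  exact ENNReal.mul_lt_top ENNReal.coe_lt_top hfv

/-- The expected discounted value of a subsolution dominates its initial value. -/
theorem Subsolution.le_integral [IsSFiniteKernel Λ] (h : Subsolution M Λ c lam F τ)
    (hC : Controlled M Λ c F τ v v₁ C) (hl0 : 0 ≤ lam) (hl1 : lam ≤ 1) {x : S}
    {P : Measure (Path S)} (hP : HasIntensity M Λ x P) :
    Integrable (fun ω => discount lam c ⟨τ, ω⟩ * leftValue M (fun u => F u) ⟨τ, ω⟩) P ∧
      F 0 x ≤ ∫ ω, discount lam c ⟨τ, ω⟩ * leftValue M (fun u => F u) ⟨τ, ω⟩ ∂P := by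
  have := hP.prob
  -- moments
  obtain ⟨K, hK⟩ := exists_lintegral_flowValue_bound hP hC.measurable_v hC.drift
  obtain ⟨K₁, hK₁⟩ := exists_lintegral_flowValue_bound hP (hC.measurable_v₁.pow_const 2) hC.drift₁
  have hvm := (measurable_flowValue M hC.measurable_v τ).coe_nnreal_ennreal
  have hv₁m := (measurable_flowValue M (hC.measurable_v₁.pow_const 2) τ).coe_nnreal_ennreal
  have hfv := lintegral_time_lt_top hvm hK
  have hfv₁ := lintegral_time_lt_top hv₁m hK₁
  set X : Path S → ℝ≥0∞ := fun ω =>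
    ∫⁻ u in Ioc (0 : ℝ) τ, C * (flowValue M v τ ⟨u.toNNReal, ω⟩ : ℝ≥0∞) with hX
  set W : Path S → ℝ≥0∞ := fun ω =>
    ∫⁻ u in Ioc (0 : ℝ) τ, (flowValue M (fun y => v₁ y ^ 2) τ ⟨u.toNNReal, ω⟩ : ℝ≥0∞) with hW
  have hXm : Measurable X := measurable_timeLIntegral (hvm.const_mul _) _
  have hWm : Measurable W := measurable_timeLIntegral hv₁m _
  have hXf : ∫⁻ ω, X ω ∂P ≠ ∞ := by
    have h1 : ∀ ω, X ω = C * ∫⁻ u in Ioc (0 : ℝ) τ, (flowValue M v τ ⟨u.toNNReal, ω⟩ : ℝ≥0∞) :=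
      fun ω => lintegral_const_mul _ (hvm.comp (measurable_section ω))
    simp only [h1]
    rw [lintegral_const_mul _ (measurable_timeLIntegral hvm _)]
    exact ENNReal.mul_ne_top ENNReal.coe_ne_top hfv.ne
  have halive := hC.ae_exists_onPiece hP
  have hgood : ∀ᵐ ω ∂P, (∃ N, OnPiece ω τ N) ∧ X ω ≠ ∞ := by
    filter_upwards [halive, ae_lt_top hXm hXf] with ω h1 h2 using ⟨h1, h2.ne⟩
  -- From v² ≤ C v₁ by squaring. The fourth power arises below when discount · v² is separated, and
  -- it is the reason for a drift condition on v₁².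
  have hv4 : ∀ p, (flowValue M v τ p : ℝ≥0∞) ^ 4 ≤
      C ^ 2 * (flowValue M (fun y => v₁ y ^ 2) τ p : ℝ≥0∞) := by
    intro p
    rw [flowValue_sq_pow]
    have h1 := pow_le_pow_left' (hC.flowValue_sq_le p) 2
    rw [← pow_mul, mul_pow] at h1
    exact_mod_cast h1
  -- the intensity integrals
  have hfinΛ : ∀ ω N, OnPiece ω τ N → ∀ u ∈ Ioc (0 : ℝ) τ,
      ∫⁻ z, ‖jumpDiff M F ⟨u.toNNReal, ω⟩ z‖ₑ ∂(Λ ⟨u.toNNReal, ω⟩) ≤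
        4 * C ^ 2 * (flowValue M v τ ⟨u.toNNReal, ω⟩ : ℝ≥0∞) ^ 2 := by
    intro ω N hN u hu
    have hu' : u.toNNReal ≤ τ := Real.toNNReal_le_iff_le_coe.2 hu.2
    obtain ⟨k, hk⟩ := exists_onPiece (ω := ω) (u := u.toNNReal)
      ⟨N + 1, (ENNReal.coe_le_coe.2 hu').trans hN.2⟩
    obtain ⟨y, hy⟩ := exists_mark_eq hk.ne_top
    exact hC.lintegral_jumpDiff_le (p := ⟨u.toNNReal, ω⟩)
      (leftState_of_onPiece_of_mark M hk hy) hu'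
  -- The integrand is at most 4C² · discount · v² ≤ 4C² (discount² + v⁴). The first square is
  -- controlled by 1 + X and v⁴ by C² v₁², and both have finite mean.
  have hIle : ∀ s : ℝ, |s| = 1 → ∀ᵐ ω ∂P, intensityIntegral Λ (signedJump M c lam F τ s) ω ≤
      4 * C ^ 2 * (τ * (1 + X ω) + C ^ 2 * W ω) := by
    intro s hs
    filter_upwards [hgood] with ω ⟨⟨N, hN⟩, hXω⟩
    have hE := (hC.discount_sq_le hl0 hl1 hN hXω).2
    rw [intensityIntegral_signedJump]
    calc _ ≤ ∫⁻ u in Ioc (0 : ℝ) τ, 4 * C ^ 2 * ((1 + X ω) +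
          C ^ 2 * (flowValue M (fun y => v₁ y ^ 2) τ ⟨u.toNNReal, ω⟩ : ℝ≥0∞)) := by
          refine setLIntegral_mono' measurableSet_Ioc fun u hu => ?_
          set p : TimePath S := ⟨u.toNNReal, ω⟩ with hp
          have hle : ∀ z, ENNReal.ofReal (s * (discount lam c p * jumpDiff M F p z)) ≤
              ENNReal.ofReal (discount lam c p) * ‖jumpDiff M F p z‖ₑ := by
            intro z
            rw [Real.enorm_eq_ofReal_abs, ← ENNReal.ofReal_mul (discount_pos _).le]
            refine ENNReal.ofReal_le_ofReal ((le_abs_self _).trans ?_)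
            rw [abs_mul, abs_mul, hs, one_mul, abs_of_pos (discount_pos _)]
          have hm : Measurable fun z => ‖jumpDiff M F p z‖ₑ :=
            ((measurable_jumpDiff hC.measurable_value).comp
              (measurable_const.prodMk measurable_id)).enorm
          calc _ ≤ ENNReal.ofReal (discount lam c p) * ∫⁻ z, ‖jumpDiff M F p z‖ₑ ∂(Λ p) := by
                rw [← lintegral_const_mul _ hm]
                exact lintegral_mono hle
            _ ≤ ENNReal.ofReal (discount lam c p) *
                (4 * C ^ 2 * (flowValue M v τ p : ℝ≥0∞) ^ 2) := by
                gcongr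
                exact hfinΛ ω N hN u hu
            _ = 4 * C ^ 2 * (ENNReal.ofReal (discount lam c p) *
                (flowValue M v τ p : ℝ≥0∞) ^ 2) := by ring
            _ ≤ 4 * C ^ 2 * (ENNReal.ofReal (discount lam c p) ^ 2 +
                ((flowValue M v τ p : ℝ≥0∞) ^ 2) ^ 2) := by
                gcongr
                exact ennreal_mul_le_sq_add_sq _ _
            _ ≤ _ := by
                gcongr
                · exact hE _ (Real.toNNReal_le_iff_le_coe.2 hu.2)
                · rw [← pow_mul]; exact hv4 p
      _ = _ := by
          have hm : Measurable fun u : ℝ =>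
              (flowValue M (fun y => v₁ y ^ 2) τ ⟨u.toNNReal, ω⟩ : ℝ≥0∞) :=
            hv₁m.comp (measurable_section ω)
          rw [lintegral_const_mul _ ((hm.const_mul _).const_add _),
            lintegral_add_left measurable_const, lintegral_const_mul _ hm]
          simp only [lintegral_const, Measure.restrict_apply, MeasurableSet.univ, univ_inter,
            Real.volume_Ioc, sub_zero, ENNReal.ofReal_coe_nnreal]
          rw [mul_comm (1 + X ω)]
  have hbound : ∫⁻ ω, 4 * C ^ 2 * (τ * (1 + X ω) + C ^ 2 * W ω) ∂P ≠ ∞ := by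
    rw [lintegral_const_mul _ (show Measurable fun ω => τ * (1 + X ω) + C ^ 2 * W ω by fun_prop),
      lintegral_add_right _ (hWm.const_mul _), lintegral_const_mul _ hWm,
      lintegral_const_mul _ (hXm.const_add _), lintegral_add_left measurable_const, lintegral_const]
    simp only [measure_univ, mul_one]
    finiteness
  have hYm : ∀ s, Measurable (Function.uncurry (signedJump M c lam F τ s)) := fun s =>
    measurable_signedJump hC.measurable_cost hC.measurable_value s
  have hIf : ∀ s : ℝ, |s| = 1 →
      ∫⁻ ω, intensityIntegral Λ (signedJump M c lam F τ s) ω ∂P ≠ ∞ := fun s hs =>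
    ne_top_of_le_ne_top hbound (lintegral_mono_ae (hIle s hs))
  have hIm : ∀ s, Measurable (intensityIntegral Λ (signedJump M c lam F τ s)) := fun s =>
    measurable_intensityIntegral (hYm s)
  have hJm : ∀ s, Measurable (jumpSum (signedJump M c lam F τ s)) := fun s =>
    measurable_jumpSum x (hYm s)
  have hIJ : ∀ s, ∫⁻ ω, jumpSum (signedJump M c lam F τ s) ω ∂P =
      ∫⁻ ω, intensityIntegral Λ (signedJump M c lam F τ s) ω ∂P := fun s =>
    hP.compensator _ (hYm s)
  have hs1 : |(1 : ℝ)| = 1 := abs_one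
  have hs2 : |(-1 : ℝ)| = 1 := by simp
  have hIi : ∀ s : ℝ, |s| = 1 → Integrable (fun ω =>
      (intensityIntegral Λ (signedJump M c lam F τ s) ω).toReal) P := fun s hs =>
    integrable_toReal_of_lintegral_ne_top (hIm s).aemeasurable (hIf s hs)
  have hJi : ∀ s : ℝ, |s| = 1 → Integrable (fun ω =>
      (jumpSum (signedJump M c lam F τ s) ω).toReal) P := fun s hs =>
    integrable_toReal_of_lintegral_ne_top (hJm s).aemeasurable (by rw [hIJ]; exact hIf s hs)
  have hIJr : ∀ s : ℝ, |s| = 1 → ∫ ω, (jumpSum (signedJump M c lam F τ s) ω).toReal ∂P =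
      ∫ ω, (intensityIntegral Λ (signedJump M c lam F τ s) ω).toReal ∂P := by
    intro s hs
    rw [integral_toReal (hIm s).aemeasurable (ae_lt_top (hIm s) (hIf s hs)),
      integral_toReal (hJm s).aemeasurable
        (ae_lt_top (hJm s) (by rw [hIJ]; exact hIf s hs)), hIJ]
  -- the pathwise inequality
  have hpath : ∀ᵐ ω ∂P, F 0 x + ((jumpSum (signedJump M c lam F τ 1) ω).toReal -
      (jumpSum (signedJump M c lam F τ (-1)) ω).toReal) -
      ((intensityIntegral Λ (signedJump M c lam F τ 1) ω).toReal -
      (intensityIntegral Λ (signedJump M c lam F τ (-1)) ω).toReal) ≤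
      discount lam c ⟨τ, ω⟩ * leftValue M (fun u => F u) ⟨τ, ω⟩ := by
    filter_upwards [hgood, hP.init, ae_lt_top (hIm 1) (hIf 1 hs1),
      ae_lt_top (hIm (-1)) (hIf (-1) hs2)] with ω ⟨⟨N, hN⟩, hXω⟩ hx hI1 hI2
    have hci := (hC.discount_sq_le hl0 hl1 hN hXω).1
    obtain ⟨hR1, hR2⟩ := intervalIntegrable_of_lintegral_ne_top (Λ := Λ) (lam := lam)
      hC.measurable_cost hC.measurable_value (ω := ω)
      (fun u hu => ne_top_of_le_ne_top (by finiteness) (hfinΛ ω N hN u hu))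
      hI1.ne hI2.ne
    have key := h.le_path hx
      ((intervalIntegrable_iff_integrableOn_Ioc_of_le (NNReal.coe_nonneg _)).2 hci) hR1 hN
    rw [hR2] at key
    rw [jumpSum_signedJump hN, jumpSum_signedJump hN,
      ENNReal.toReal_sum (fun _ _ => ENNReal.ofReal_ne_top),
      ENNReal.toReal_sum (fun _ _ => ENNReal.ofReal_ne_top), ← Finset.sum_sub_distrib]
    simp only [toReal_ofReal_sub]
    exact key
  -- integrability
  have hZm : Measurable fun ω => discount lam c ⟨τ, ω⟩ * leftValue M (fun u => F u) ⟨τ, ω⟩ := by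
    refine Measurable.mul ((measurable_discount hC.measurable_cost).comp
      (measurable_timePath_at τ)) ((measurable_leftValue M ?_).comp (measurable_timePath_at τ))
    exact hC.measurable_value.comp (measurable_fst.coe_nnreal_real.prodMk measurable_snd)
  have hZ : Integrable (fun ω => discount lam c ⟨τ, ω⟩ * leftValue M (fun u => F u) ⟨τ, ω⟩) P := by
    refine ⟨hZm.aestronglyMeasurable, ?_⟩
    have hle : ∀ᵐ ω ∂P, ‖discount lam c ⟨τ, ω⟩ * leftValue M (fun u => F u) ⟨τ, ω⟩‖ₑ ≤
        C * (1 + X ω + C ^ 2 * (flowValue M (fun y => v₁ y ^ 2) τ ⟨τ, ω⟩ : ℝ≥0∞)) := by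
      filter_upwards [hgood] with ω ⟨⟨N, hN⟩, hXω⟩
      have hE := (hC.discount_sq_le hl0 hl1 hN hXω).2 τ le_rfl
      obtain ⟨y, hy⟩ := exists_mark_eq hN.ne_top
      have hs := leftState_of_onPiece_of_mark M hN hy
      rw [enorm_mul, leftValue_of_inl (p := ⟨τ, ω⟩) hs]
      set V : ℝ≥0∞ := (flowValue M v τ ⟨τ, ω⟩ : ℝ≥0∞) with hV
      have h1 : ‖F τ (M.flow y (τ - (jumpTime ω N).toReal))‖ₑ ≤ C * V := by
        rw [hV, flowValue_of_inl (p := ⟨τ, ω⟩) hs]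
        exact hC.value_le τ le_rfl _
      have hV1 : 1 ≤ V := by
        rw [hV, flowValue_of_inl (p := ⟨τ, ω⟩) hs]
        exact ENNReal.one_le_coe_iff.2 (hC.one_le _)
      have hV2 : V ^ 2 ≤ V ^ 4 := pow_le_pow_right₀ hV1 (by norm_num)
      rw [Real.enorm_eq_ofReal (discount_pos _).le]
      calc _ ≤ ENNReal.ofReal (discount lam c ⟨τ, ω⟩) * (C * V) := by gcongr
        _ = C * (ENNReal.ofReal (discount lam c ⟨τ, ω⟩) * V) := by ring
        _ ≤ C * (ENNReal.ofReal (discount lam c ⟨τ, ω⟩) ^ 2 + V ^ 2) := by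
          gcongr
          exact ennreal_mul_le_sq_add_sq _ _
        _ ≤ _ := by
          gcongr
          exact hV2.trans (hv4 _)
    refine (lintegral_mono_ae hle).trans_lt ?_
    have hm : Measurable fun ω => (flowValue M (fun y => v₁ y ^ 2) τ ⟨τ, ω⟩ : ℝ≥0∞) :=
      hv₁m.comp (measurable_timePath_at τ)
    rw [lintegral_const_mul _ (show Measurable fun ω => 1 + X ω +
        C ^ 2 * (flowValue M (fun y => v₁ y ^ 2) τ ⟨τ, ω⟩ : ℝ≥0∞) by fun_prop),
      lintegral_add_right _ (hm.const_mul _), lintegral_const_mul _ hm, lintegral_add_left measurable_const, lintegral_const]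
    have hmf : ∫⁻ ω, (flowValue M (fun y => v₁ y ^ 2) τ ⟨τ, ω⟩ : ℝ≥0∞) ∂P ≠ ∞ :=
      ne_top_of_le_ne_top ENNReal.coe_ne_top (hK₁ τ le_rfl)
    simp only [measure_univ, mul_one]
    finiteness
  refine ⟨hZ, ?_⟩
  have hJ : Integrable (fun ω => (jumpSum (signedJump M c lam F τ 1) ω).toReal -
      (jumpSum (signedJump M c lam F τ (-1)) ω).toReal) P := (hJi 1 hs1).sub (hJi _ hs2)
  have hI : Integrable (fun ω => (intensityIntegral Λ (signedJump M c lam F τ 1) ω).toReal -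
      (intensityIntegral Λ (signedJump M c lam F τ (-1)) ω).toReal) P :=
    (hIi 1 hs1).sub (hIi _ hs2)
  have hJ' : Integrable (fun ω => F 0 x + ((jumpSum (signedJump M c lam F τ 1) ω).toReal -
      (jumpSum (signedJump M c lam F τ (-1)) ω).toReal)) P := (integrable_const _).add hJ
  -- In expectation the positive and the negative jump sums cancel separately with their
  -- compensators, leaving only the initial value.
  have hfinal := integral_mono_ae (hJ'.sub hI) hZ hpath
  simp only [Pi.sub_apply] at hfinal
  rw [integral_sub hJ' hI, integral_add (integrable_const _) hJ,
    integral_sub (hJi 1 hs1) (hJi _ hs2), integral_sub (hIi 1 hs1) (hIi _ hs2), hIJr 1 hs1,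
    hIJr _ hs2] at hfinal
  simp only [integral_const, probReal_univ, one_smul] at hfinal
  linarith

end Expectation

/-! ### The signed rate as a jump measure minus an exit mass -/

section Rates

variable {S A B : Type*} [TopologicalSpace S] [MeasurableSpace S] [MeasurableSingletonClass S]
  [MeasurableSpace A] [MeasurableSpace B] {M : Game S A B} {t : ℝ} {x : S} {a : A} {b : B}

omit [MeasurableSingletonClass S] in
-- The part of D in the negative set of a Hahn decomposition has rate at most 0. It misses x, so its
-- rate is also nonnegative, and only the part in the positive set counts.
theorem posPart_apply_of_notMem (h : M.InK t x a b) {D : Set S} (hD : MeasurableSet D)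
    (hx : x ∉ D) :
    (M.rate t x a b).toJordanDecomposition.posPart D = ENNReal.ofReal (M.rate t x a b D) := by
  set r := M.rate t x a b with hr
  obtain ⟨i, hi₁, hi₂, hi₃, hpos, hneg⟩ := r.toJordanDecomposition_spec
  have h0 : r (iᶜ ∩ D) = 0 := by
    refine le_antisymm ?_ ?_
    · exact VectorMeasure.nonpos_of_restrict_le_zero r
        (VectorMeasure.restrict_le_zero_subset r hi₁.compl inter_subset_left hi₃)
    · exact M.rate_nonneg t x a b h.1 h.2.1 h.2.2 _ (hi₁.compl.inter hD) fun h' => hx h'.2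
  have h1 : r D = r (i ∩ D) := by
    have := VectorMeasure.of_union (v := r) (A := i ∩ D) (B := iᶜ ∩ D)
      (by rw [Set.disjoint_left]; rintro y ⟨hy, -⟩ ⟨hy', -⟩; exact hy' hy)
      (hi₁.inter hD) (hi₁.compl.inter hD)
    rw [h0, add_zero, ← union_inter_distrib_right, union_compl_self, univ_inter] at this
    exact this
  rw [hpos, SignedMeasure.toMeasureOfZeroLE_apply _ _ _ hD, h1]
  rw [ENNReal.ofReal]
  congr 1
  rw [Real.toNNReal_of_nonneg (VectorMeasure.nonneg_of_zero_le_restrict r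
    (VectorMeasure.zero_le_restrict_subset r hi₁ inter_subset_left hi₂))]

theorem jumpMeasure_apply (h : M.InK t x a b) {D : Set S} (hD : MeasurableSet D) :
    M.jumpMeasure t x a b D = ENNReal.ofReal (M.rate t x a b (D \ {x})) := by
  rw [Game.jumpMeasure, Measure.restrict_apply hD, ← sdiff_eq,
    posPart_apply_of_notMem h (hD.diff (measurableSet_singleton x)) (by simp)]

theorem exitRate_eq (h : M.InK t x a b) : M.exitRate t x a b = M.rate t x a b (univ \ {x}) := by
  have h1 := VectorMeasure.of_add_of_sdiff (v := M.rate t x a b) (measurableSet_singleton x)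
    MeasurableSet.univ (subset_univ _)
  rw [M.rate_conservative t x a b h.1 h.2.1 h.2.2] at h1
  rw [Game.exitRate]
  linarith

theorem exitRate_nonneg (h : M.InK t x a b) : 0 ≤ M.exitRate t x a b := by
  rw [exitRate_eq h]
  exact M.rate_nonneg t x a b h.1 h.2.1 h.2.2 _ (MeasurableSet.univ.diff
    (measurableSet_singleton x)) (by simp)

theorem jumpMeasure_univ (h : M.InK t x a b) :
    M.jumpMeasure t x a b univ = ENNReal.ofReal (M.exitRate t x a b) := by
  rw [jumpMeasure_apply h MeasurableSet.univ, exitRate_eq h]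

instance : IsFiniteMeasure (M.jumpMeasure t x a b) := by
  unfold Game.jumpMeasure
  infer_instance

theorem rate_eq (h : M.InK t x a b) : M.rate t x a b =
    (M.jumpMeasure t x a b).toSignedMeasure - VectorMeasure.dirac x (M.exitRate t x a b) := by
  ext D hD
  have h0 : 0 ≤ M.rate t x a b (D \ {x}) := M.rate_nonneg t x a b h.1 h.2.1 h.2.2 _
    (hD.diff (measurableSet_singleton x)) (by simp)
  have hJ : (M.jumpMeasure t x a b).toSignedMeasure D = M.rate t x a b (D \ {x}) := by
    rw [Measure.toSignedMeasure_apply_measurable hD, Measure.real, jumpMeasure_apply h hD,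
      ENNReal.toReal_ofReal h0]
  rw [_root_.sub_apply, hJ]
  by_cases hx : x ∈ D
  · rw [VectorMeasure.dirac_apply_of_mem hD hx, Game.exitRate, sub_neg_eq_add, add_comm]
    exact (VectorMeasure.of_add_of_sdiff (measurableSet_singleton x) hD
      (singleton_subset_iff.2 hx)).symm
  · rw [VectorMeasure.dirac_apply_of_notMem hx, sub_zero, sdiff_singleton_eq_self hx]

omit [MeasurableSingletonClass S] in
theorem integrable_jumpMeasure {f : S → ℝ} (hf : (M.rate t x a b).Integrable f) :
    Integrable f (M.jumpMeasure t x a b) := by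
  refine Integrable.mono_measure hf ?_
  rw [← SignedMeasure.totalVariation_eq_variation]
  exact Measure.restrict_le_self.trans (Measure.le_add_right le_rfl)

theorem integral_rate (h : M.InK t x a b) {f : S → ℝ}
    (hf : Integrable f (M.jumpMeasure t x a b)) :
    ∫ᵛ y, f y ∂<•(M.rate t x a b) =
      (∫ y, f y ∂(M.jumpMeasure t x a b)) - M.exitRate t x a b * f x := by
  rw [rate_eq h, VectorMeasure.integral_sub_vectorMeasure, VectorMeasure.integral_toSignedMeasure,
    VectorMeasure.integral_dirac, ContinuousLinearMap.flip_apply, ContinuousLinearMap.lsmul_apply,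
    smul_eq_mul]
  · rw [VectorMeasure.Integrable, Measure.variation_toSignedMeasure]
    exact hf
  · rw [VectorMeasure.Integrable, VectorMeasure.variation_dirac]
    exact (integrable_dirac (by finiteness)).smul_measure (by finiteness)

/-- The atom of the rate at x contributes -q f(x). Moving it to the right, where q is the mass of
the jump measure, gives a drift condition between nonnegative quantities. -/
theorem lintegral_jumpMeasure_le (h : M.InK t x a b) {f : S → ℝ} (hf0 : ∀ y, 0 ≤ f y)
    (hf : (M.rate t x a b).Integrable f) {ρ C : ℝ} (hρ : 0 ≤ ρ) (hC : 0 ≤ C)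
    (hle : ∫ᵛ y, f y ∂<•(M.rate t x a b) ≤ ρ * f x + C) :
    ∫⁻ y, ENNReal.ofReal (f y) ∂(M.jumpMeasure t x a b) ≤
      (ENNReal.ofReal ρ + M.jumpMeasure t x a b univ) * ENNReal.ofReal (f x) +
        ENNReal.ofReal C := by
  have hJ := integrable_jumpMeasure hf
  rw [← ofReal_integral_eq_lintegral_ofReal hJ (ae_of_all _ hf0), jumpMeasure_univ h,
    ← ENNReal.ofReal_add hρ (exitRate_nonneg h),
    ← ENNReal.ofReal_mul (add_nonneg hρ (exitRate_nonneg h)),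
    ← ENNReal.ofReal_add (mul_nonneg (add_nonneg hρ (exitRate_nonneg h)) (hf0 x)) hC]
  refine ENNReal.ofReal_le_ofReal ?_
  rw [integral_rate h hJ] at hle
  linarith

end Rates

theorem measurableEmbedding_inl {α β : Type*} [MeasurableSpace α] [MeasurableSpace β] :
    MeasurableEmbedding (Sum.inl : α → α ⊕ β) :=
  ⟨Sum.inl_injective, measurable_inl, fun _ hs => hs.inl_image⟩

/-! ### Jump measures and costs as functions on extended quadruples -/

section Kernels

variable {S A B : Type*} [TopologicalSpace S] [MeasurableSpace S] [MeasurableSpace A]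
  [MeasurableSpace B] (M : Game S A B)

/-- The set `K` of admissible quadruples. -/
def admSet : Set (ℝ × S × A × B) :=
  {p | 0 ≤ p.1 ∧ p.2.2.1 ∈ M.actA p.1 p.2.1 ∧ p.2.2.2 ∈ M.actB p.1 p.2.1}

/-- The embedding of `K` into the quadruples with states and actions extended by cemeteries. -/
def admEmbedding (p : admSet M) : ℝ × Ext S × Ext A × Ext B :=
  (p.1.1, Sum.inl p.1.2.1, Sum.inl p.1.2.2.1, Sum.inl p.1.2.2.2)

theorem measurableEmbedding_adm : MeasurableEmbedding (admEmbedding M) :=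
  (MeasurableEmbedding.id.prodMap (measurableEmbedding_inl.prodMap
    (measurableEmbedding_inl.prodMap measurableEmbedding_inl))).comp
    (MeasurableEmbedding.subtype_coe M.measurableSet_K)

/-- A π-λ argument starting from rectangles. Sections are needed because the jump measure omits the
point x, which varies with the parameter: D \ {x} is the section at x of a set off the diagonal. -/
theorem measurable_rate_section {E : Set (S × S)} (hE : MeasurableSet E) :
    Measurable fun p : admSet M =>
      M.rate p.1.1 p.1.2.1 p.1.2.2.1 p.1.2.2.2 {y | (p.1.2.1, y) ∈ E} := by
  classical
  have hsec : ∀ {E : Set (S × S)}, MeasurableSet E → ∀ x, MeasurableSet {y | (x, y) ∈ E} :=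
    fun hE x => measurable_prodMk_left hE
  induction E, hE using MeasurableSpace.induction_on_inter (generateFrom_prod (α := S) (β := S)).symm
    (isPiSystem_prod (α := S) (β := S)) with
  | empty => simp
  | basic E hE =>
    obtain ⟨D₁, hD₁, D₂, hD₂, rfl⟩ := hE
    have h : (fun p : admSet M => M.rate p.1.1 p.1.2.1 p.1.2.2.1 p.1.2.2.2
        {y | (p.1.2.1, y) ∈ D₁ ×ˢ D₂}) = fun p : admSet M => if p.1.2.1 ∈ D₁ then
          M.rate p.1.1 p.1.2.1 p.1.2.2.1 p.1.2.2.2 D₂ else 0 := by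
      ext p
      by_cases hp : p.1.2.1 ∈ D₁ <;> simp [hp]
    rw [h]
    exact Measurable.ite ((measurable_fst.comp (measurable_snd.comp measurable_subtype_coe)) hD₁)
      (M.measurable_rate D₂ hD₂) measurable_const
  | compl E hE ih =>
    have huniv : Measurable fun p : admSet M =>
        M.rate p.1.1 p.1.2.1 p.1.2.2.1 p.1.2.2.2 univ := M.measurable_rate univ MeasurableSet.univ
    refine (congrArg Measurable (funext fun p => ?_)).mp (huniv.sub ih)
    have := VectorMeasure.of_add_of_sdiff (v := M.rate p.1.1 p.1.2.1 p.1.2.2.1 p.1.2.2.2)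
      (hsec hE p.1.2.1) MeasurableSet.univ (subset_univ _)
    rw [← compl_eq_univ_sdiff] at this
    rw [Pi.sub_apply, ← this, add_sub_cancel_left]
    rfl
  | iUnion E hd hE ih =>
    refine measurable_of_tendsto_metrizable (f := fun n (p : admSet M) => ∑ i ∈ Finset.range n,
      M.rate p.1.1 p.1.2.1 p.1.2.2.1 p.1.2.2.2 {y | (p.1.2.1, y) ∈ E i})
      (fun n => Finset.measurable_sum _ fun i _ => ih i) ?_
    rw [tendsto_pi_nhds]
    intro p
    have h := (M.rate p.1.1 p.1.2.1 p.1.2.2.1 p.1.2.2.2).hasSum_of_disjoint_iUnion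
      (f := fun i => {y | (p.1.2.1, y) ∈ E i}) (fun i => hsec (hE i) p.1.2.1)
      (fun i j hij => (hd hij).preimage _)
    have h2 : (⋃ i, {y | (p.1.2.1, y) ∈ E i}) = {y | (p.1.2.1, y) ∈ ⋃ i, E i} := by
      ext y; simp
    rw [h2] at h
    exact h.tendsto_sum_nat

variable [MeasurableEq S] [MeasurableSingletonClass S]

theorem measurable_jumpMeasure : Measurable fun p : admSet M =>
    M.jumpMeasure p.1.1 p.1.2.1 p.1.2.2.1 p.1.2.2.2 := by
  refine Measure.measurable_of_measurable_coe _ fun D hD => ?_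
  have hE : MeasurableSet ({q : S × S | q.2 ∈ D} \ diagonal S) :=
    (measurable_snd hD).diff measurableSet_diagonal
  refine (congrArg Measurable (funext fun p => ?_)).mp (measurable_rate_section M hE).ennreal_ofReal
  rw [jumpMeasure_apply (M := M) p.2 hD]
  congr 2
  ext y
  simp [eq_comm]

/-- The jump measures on `K`, extended by `0`, as a kernel. -/
def jumpKernel : Kernel (ℝ × Ext S × Ext A × Ext B) S :=
  ⟨Function.extend (admEmbedding M)
    (fun p => M.jumpMeasure p.1.1 p.1.2.1 p.1.2.2.1 p.1.2.2.2) 0,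
    (measurableEmbedding_adm M).measurable_extend (measurable_jumpMeasure M) measurable_const⟩

/-- The running cost on `K`, extended by `0`. -/
def costFun : ℝ × Ext S × Ext A × Ext B → ℝ :=
  Function.extend (admEmbedding M) (fun p => M.cost p.1.1 p.1.2.1 p.1.2.2.1 p.1.2.2.2) 0

omit [MeasurableEq S] [MeasurableSingletonClass S] in
theorem measurable_costFun : Measurable (costFun M) :=
  (measurableEmbedding_adm M).measurable_extend M.measurable_cost measurable_const

variable {M}

theorem jumpKernel_apply (q : ℝ × Ext S × Ext A × Ext B) :
    jumpKernel M q = Function.extend (admEmbedding M)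
      (fun p => M.jumpMeasure p.1.1 p.1.2.1 p.1.2.2.1 p.1.2.2.2) 0 q := rfl

theorem jumpKernel_of_inK {t : ℝ} {x : S} {a : A} {b : B} (h : M.InK t x a b) :
    jumpKernel M (t, Sum.inl x, Sum.inl a, Sum.inl b) = M.jumpMeasure t x a b := by
  rw [jumpKernel_apply]
  exact (measurableEmbedding_adm M).injective.extend_apply _ _ ⟨(t, x, a, b), h⟩

omit [MeasurableEq S] [MeasurableSingletonClass S] in
theorem costFun_of_inK {t : ℝ} {x : S} {a : A} {b : B} (h : M.InK t x a b) :
    costFun M (t, Sum.inl x, Sum.inl a, Sum.inl b) = M.cost t x a b :=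
  (measurableEmbedding_adm M).injective.extend_apply _ _ ⟨(t, x, a, b), h⟩

theorem jumpKernel_cem (t : ℝ) (z : Unit) (a : Ext A) (b : Ext B) :
    jumpKernel M (t, Sum.inr z, a, b) = 0 := by
  rw [jumpKernel_apply]
  exact Function.extend_apply' _ _ _ (by rintro ⟨p, hp⟩; simp [admEmbedding] at hp)

omit [MeasurableEq S] [MeasurableSingletonClass S] in
theorem costFun_cem (t : ℝ) (z : Unit) (a : Ext A) (b : Ext B) :
    costFun M (t, Sum.inr z, a, b) = 0 :=
  Function.extend_apply' _ _ _ (by rintro ⟨p, hp⟩; simp [admEmbedding] at hp)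

theorem jumpKernel_univ_lt_top (q : ℝ × Ext S × Ext A × Ext B) : jumpKernel M q univ < ∞ := by
  by_cases hq : ∃ p, admEmbedding M p = q
  · obtain ⟨⟨⟨t, x, a, b⟩, hp⟩, rfl⟩ := hq
    have := jumpKernel_of_inK (M := M) (t := t) (x := x) (a := a) (b := b) hp
    simp only [admEmbedding, this]
    exact measure_lt_top _ _
  · have : jumpKernel M q = 0 := by
      rw [jumpKernel_apply]
      exact Function.extend_apply' _ _ _ hq
    simp [this]

/-- A kernel of finite measures is s-finite. -/
theorem _root_.ProbabilityTheory.Kernel.isSFiniteKernel_of_lt_top {α β : Type*} [MeasurableSpace α]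
    [MeasurableSpace β] {κ : Kernel α β} (h : ∀ a, κ a univ < ∞) : IsSFiniteKernel κ := by
  classical
  -- Cutting the parameter space along the integer part of the total mass yields countably many
  -- pieces with bounded mass.
  set f : α → ℕ := fun a => ⌊(κ a univ).toReal⌋₊ with hf
  have hfm : Measurable f := (κ.measurable_coe MeasurableSet.univ).ennreal_toReal.nat_floor
  have hs : ∀ n, MeasurableSet (f ⁻¹' {n}) := fun n => hfm (measurableSet_singleton n)
  have hsum : κ = Kernel.sum fun n => Kernel.piecewise (hs n) κ 0 := by
    ext a D hD
    rw [Kernel.sum_apply' _ _ hD, tsum_eq_single (f a)]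
    · simp [Kernel.piecewise_apply]
    · intro n hn
      simp [Kernel.piecewise_apply, hn.symm]
  rw [hsum]
  have : ∀ n, IsSFiniteKernel (Kernel.piecewise (hs n) κ 0) := by
    intro n
    have : IsFiniteKernel (Kernel.piecewise (hs n) κ 0) := by
      refine ⟨⟨ENNReal.ofReal (n + 1), ENNReal.ofReal_lt_top, fun a => ?_⟩⟩
      rw [Kernel.piecewise_apply]
      split_ifs with ha
      · rw [← ENNReal.ofReal_toReal (h a).ne]
        refine ENNReal.ofReal_le_ofReal ?_
        have h1 : f a = n := ha
        rw [← h1]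
        exact (Nat.lt_floor_add_one _).le
      · simp
    infer_instance
  exact Kernel.isSFiniteKernel_sum

instance : IsSFiniteKernel (jumpKernel M) :=
  Kernel.isSFiniteKernel_of_lt_top jumpKernel_univ_lt_top

end Kernels

/-! ### Intensity and cost under given action laws -/

section GameIntensity

variable {S A B : Type*} [TopologicalSpace S] [MeasurableSpace S] [MeasurableSpace A]
  [MeasurableSpace B] (M : Game S A B)

/-- The action law `α` only uses actions which are admissible at time `s + u` in `ξ_{u-}`. -/
def IsAdmissible {Act : Type*} [MeasurableSpace Act] (act : ℝ → S → Set Act) (s : ℝ≥0)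
    (α : Kernel (TimePath S) (Ext Act)) : Prop :=
  ∀ p, α p (admissible act (s + p.time) (M.leftState p.path p.time)) = 1

/-- The joint law of the time, the left state and the actions. -/
def actionKernel (s : ℝ≥0) (α : Kernel (TimePath S) (Ext A)) (β : Kernel (TimePath S) (Ext B)) :
    Kernel (TimePath S) (ℝ × Ext S × Ext A × Ext B) :=
  ((Kernel.deterministic (fun p : TimePath S => ((s + p.time : ℝ), M.leftState p.path p.time))
    ((measurable_time.coe_nnreal_real.const_add _).prodMk (measurable_leftState M))) ×ₖ
    (β ×ₖ α)).map fun r => (r.1.1, r.1.2, r.2.2, r.2.1)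

variable {M} {s : ℝ≥0} {α : Kernel (TimePath S) (Ext A)} {β : Kernel (TimePath S) (Ext B)}

omit [TopologicalSpace S] [MeasurableSpace S] in
theorem ae_mem_of_admissible {Act : Type*} [MeasurableSpace Act] {act : ℝ → S → Set Act}
    {u : ℝ≥0} {y : S} (hact : MeasurableSet (act u y)) {μ : Measure (Ext Act)}
    [IsProbabilityMeasure μ] (h : μ (admissible act u (Sum.inl y)) = 1) :
    ∀ᵐ a ∂μ, a ∈ (Sum.inl '' act u y : Set (Ext Act)) :=
  (mem_ae_iff_prob_eq_one hact.inl_image).2 h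

theorem measurable_reorder {α β γ δ : Type*} [MeasurableSpace α] [MeasurableSpace β]
    [MeasurableSpace γ] [MeasurableSpace δ] :
    Measurable fun r : (α × β) × (δ × γ) => (r.1.1, r.1.2, r.2.2, r.2.1) := by
  fun_prop

theorem actionKernel_apply [IsMarkovKernel α] [IsMarkovKernel β] (p : TimePath S) :
    actionKernel M s α β p = ((β p).prod (α p)).map
      fun r => ((s + p.time : ℝ), M.leftState p.path p.time, r.2, r.1) := by
  ext D hD
  rw [actionKernel, Kernel.map_apply' _ measurable_reorder _ hD, Kernel.prod_apply,
    Kernel.deterministic_apply, Measure.dirac_prod, Kernel.prod_apply,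
    Measure.map_apply (by fun_prop) (measurable_reorder hD), Measure.map_apply (by fun_prop) hD]
  rfl

instance [IsMarkovKernel α] [IsMarkovKernel β] : IsMarkovKernel (actionKernel M s α β) := by
  refine ⟨fun p => ?_⟩
  rw [actionKernel_apply]
  exact Measure.isProbabilityMeasure_map (by fun_prop)

theorem lintegral_actionKernel [IsMarkovKernel α] [IsMarkovKernel β] (p : TimePath S)
    {h : ℝ × Ext S × Ext A × Ext B → ℝ≥0∞} (hh : Measurable h) :
    ∫⁻ q, h q ∂(actionKernel M s α β p) = ∫⁻ b, ∫⁻ a,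
      h (s + p.time, M.leftState p.path p.time, a, b) ∂(α p) ∂(β p) := by
  rw [actionKernel_apply, lintegral_map hh (by fun_prop), lintegral_prod _ (by fun_prop)]

theorem integral_actionKernel [IsMarkovKernel α] [IsMarkovKernel β] (p : TimePath S)
    {h : ℝ × Ext S × Ext A × Ext B → ℝ} (hh : Integrable h (actionKernel M s α β p)) :
    ∫ q, h q ∂(actionKernel M s α β p) = ∫ b, ∫ a,
      h (s + p.time, M.leftState p.path p.time, a, b) ∂(α p) ∂(β p) := by
  rw [actionKernel_apply] at hh ⊢
  rw [integral_map (by fun_prop) hh.1, integral_prod]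
  exact (integrable_map_measure hh.1 (by fun_prop)).1 hh

/-- This reduces every integral over the actions to admissible quadruples, the only place where
rates and costs are constrained. -/
theorem ae_actionKernel [IsMarkovKernel α] [IsMarkovKernel β]
    (hα : IsAdmissible M M.actA s α) (hβ : IsAdmissible M M.actB s β) {p : TimePath S} {y : S}
    [MeasurableSingletonClass S] (hy : M.leftState p.path p.time = Sum.inl y) :
    ∀ᵐ q ∂(actionKernel M s α β p), ∃ a b, M.InK (s + p.time) y a b ∧
      q = ((s + p.time : ℝ), Sum.inl y, Sum.inl a, Sum.inl b) := by
  have h0 : (0 : ℝ) ≤ (s + p.time : ℝ≥0) := NNReal.coe_nonneg _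
  have hA := M.measurableSet_actA (s + p.time : ℝ≥0) y h0
  have hB := M.measurableSet_actB (s + p.time : ℝ≥0) y h0
  have h1 := ae_mem_of_admissible hA (hy ▸ hα p)
  have h2 := ae_mem_of_admissible hB (hy ▸ hβ p)
  -- Transferring the almost-sure statement to the image measure requires a measurable set. At a
  -- fixed time and state it is a product of two points with the images of the two action sets.
  have hset : MeasurableSet {q : ℝ × Ext S × Ext A × Ext B | ∃ a b, M.InK (s + p.time) y a b ∧
      q = ((s + p.time : ℝ), Sum.inl y, Sum.inl a, Sum.inl b)} := by
    have : {q : ℝ × Ext S × Ext A × Ext B | ∃ a b, M.InK (s + p.time) y a b ∧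
      q = ((s + p.time : ℝ), Sum.inl y, Sum.inl a, Sum.inl b)} =
      {(s + p.time : ℝ)} ×ˢ ((Sum.inl '' {y} : Set (Ext S)) ×ˢ
        ((Sum.inl '' M.actA (s + p.time : ℝ≥0) y : Set (Ext A)) ×ˢ
        (Sum.inl '' M.actB (s + p.time : ℝ≥0) y : Set (Ext B)))) := by
      ext ⟨t, z, a, b⟩
      simp only [mem_ofPred_eq, mem_prod, mem_singleton_iff, image_singleton, mem_image,
        Prod.mk.injEq]
      constructor
      · rintro ⟨a', b', ⟨-, h3, h4⟩, rfl, rfl, rfl, rfl⟩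
        exact ⟨rfl, rfl, ⟨a', h3, rfl⟩, ⟨b', h4, rfl⟩⟩
      · rintro ⟨rfl, rfl, ⟨a', h3, rfl⟩, ⟨b', h4, rfl⟩⟩
        exact ⟨a', b', ⟨h0, h3, h4⟩, rfl, rfl, rfl, rfl⟩
    rw [this]
    exact (measurableSet_singleton _).prod ((measurableSet_singleton y).inl_image.prod
      (hA.inl_image.prod hB.inl_image))
  rw [actionKernel_apply, ae_map_iff (by fun_prop) hset]
  filter_upwards [Measure.quasiMeasurePreserving_fst.ae h2,
    Measure.quasiMeasurePreserving_snd.ae h1] with r hr2 hr1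
  obtain ⟨b, hb, hb'⟩ := hr2
  obtain ⟨a, ha, ha'⟩ := hr1
  exact ⟨a, b, ⟨h0, ha, hb⟩, by rw [hy, ha', hb']⟩

variable [MeasurableEq S] [MeasurableSingletonClass S]

variable (M s α β) in
/-- The jump intensity of the controlled process. -/
def gameIntensity : Kernel (TimePath S) S := jumpKernel M ∘ₖ actionKernel M s α β

variable (M s α β) in
/-- The running cost of the controlled process, averaged over the actions. -/
def gameCost (p : TimePath S) : ℝ := ∫ q, costFun M q ∂(actionKernel M s α β p)

variable [IsMarkovKernel α] [IsMarkovKernel β]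

instance : IsSFiniteKernel (gameIntensity M s α β) := by
  unfold gameIntensity
  infer_instance

omit [MeasurableEq S] [MeasurableSingletonClass S] in
theorem measurable_gameCost : Measurable (gameCost M s α β) :=
  (StronglyMeasurable.integral_kernel_prod_right (f := fun _ q => costFun M q)
    ((measurable_costFun M).comp measurable_snd).stronglyMeasurable).measurable

omit [IsMarkovKernel α] [IsMarkovKernel β] in
theorem lintegral_gameIntensity (p : TimePath S) {h : S → ℝ≥0∞} (hh : Measurable h) :
    ∫⁻ y, h y ∂(gameIntensity M s α β p) =
      ∫⁻ q, ∫⁻ y, h y ∂(jumpKernel M q) ∂(actionKernel M s α β p) :=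
  Kernel.lintegral_comp _ _ _ hh

theorem gameIntensity_cem {p : TimePath S} (hp : M.leftState p.path p.time = cem) :
    gameIntensity M s α β p = 0 := by
  ext D hD
  rw [← lintegral_indicator_one hD, lintegral_gameIntensity p (measurable_one.indicator hD),
    lintegral_actionKernel p (Measurable.lintegral_kernel (measurable_one.indicator hD))]
  simp [hp, jumpKernel_cem]

/-- The rates in `Game.jumpIntegral` are not known to be measurable off K, while `jumpKernel` is 0
there. The two integrands agree for almost all actions because the laws are admissible. -/
theorem jumpIntegral_eq (hα : IsAdmissible M M.actA s α) (hβ : IsAdmissible M M.actB s β)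
    (p : TimePath S) {h : S → ℝ≥0∞} (hh : Measurable h) :
    M.jumpIntegral (s + p.time) (M.leftState p.path p.time) (α p) (β p) h =
      ∫⁻ y, h y ∂(gameIntensity M s α β p) := by
  rw [lintegral_gameIntensity p hh, lintegral_actionKernel p (Measurable.lintegral_kernel hh),
    Game.jumpIntegral]
  rcases hy : M.leftState p.path p.time with y | z
  · have h0 : (0 : ℝ) ≤ (s + p.time : ℝ≥0) := NNReal.coe_nonneg _
    have h1 := ae_mem_of_admissible (M.measurableSet_actA (s + p.time : ℝ≥0) y h0) (hy ▸ hα p)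
    have h2 := ae_mem_of_admissible (M.measurableSet_actB (s + p.time : ℝ≥0) y h0) (hy ▸ hβ p)
    refine lintegral_congr_ae ?_
    filter_upwards [h2] with b hb
    obtain ⟨b, hb, rfl⟩ := hb
    refine lintegral_congr_ae ?_
    filter_upwards [h1] with a ha
    obtain ⟨a, ha, rfl⟩ := ha
    rw [jumpKernel_of_inK (show M.InK (s + p.time) y a b from ⟨h0, ha, hb⟩)]
    rfl
  · simp [jumpKernel_cem, Game.jumpMeasureExt]

/-- The law of the controlled process has the intensity given by the action laws. -/
theorem _root_.PDGame.Game.IsLaw.hasIntensity (hα : IsAdmissible M M.actA s α)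
    (hβ : IsAdmissible M M.actB s β) {x : S} {P : Measure (Path S)}
    (hP : M.IsLaw s x (fun ω u => α ⟨u, ω⟩) (fun ω u => β ⟨u, ω⟩) P) :
    HasIntensity M (gameIntensity M s α β) x P where
  prob := hP.prob
  init := hP.init
  dead _ hp := gameIntensity_cem hp
  compensator Y hY := by
    have hYm : @Measurable ((ℝ≥0 × Path S) × S) ℝ≥0∞
        ((pathFiltration S).predictable.prod inferInstance) _
        (fun p => Y ⟨p.1.1, p.1.2⟩ p.2) := by
      -- The definition of the law uses pairs with the predictable σ-algebra. Overriding the product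
      -- instance allows the test function to be transported from `TimePath`.
      let _ : MeasurableSpace (ℝ≥0 × Path S) := (pathFiltration S).predictable
      exact hY.comp ((measurable_mk_predictable.comp measurable_fst).prodMk measurable_snd)
    refine (hP.compensator (fun u ω y => Y ⟨u, ω⟩ y) hYm).trans (lintegral_congr fun ω => ?_)
    refine setLIntegral_congr_fun measurableSet_Ioi fun u hu => ?_
    have hu' : ((u.toNNReal : ℝ≥0) : ℝ) = u := Real.coe_toNNReal _ (le_of_lt hu)
    have h := jumpIntegral_eq hα hβ ⟨u.toNNReal, ω⟩
      (h := fun y => Y ⟨u.toNNReal, ω⟩ y) (hY.comp (measurable_const.prodMk measurable_id))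
    simp only [hu'] at h
    exact h

omit [MeasurableEq S] [MeasurableSingletonClass S] in
theorem gameCost_eq (hα : IsAdmissible M M.actA s α) (hβ : IsAdmissible M M.actB s β)
    {p : TimePath S} (hc : Integrable (costFun M) (actionKernel M s α β p)) :
    gameCost M s α β p = ∫ b, ∫ a, M.costExt (s + p.time) (M.leftState p.path p.time) a b
      ∂(α p) ∂(β p) := by
  rw [gameCost, integral_actionKernel p hc]
  rcases hy : M.leftState p.path p.time with y | z
  · have h0 : (0 : ℝ) ≤ (s + p.time : ℝ≥0) := NNReal.coe_nonneg _
    have h1 := ae_mem_of_admissible (M.measurableSet_actA (s + p.time : ℝ≥0) y h0) (hy ▸ hα p)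
    have h2 := ae_mem_of_admissible (M.measurableSet_actB (s + p.time : ℝ≥0) y h0) (hy ▸ hβ p)
    refine integral_congr_ae ?_
    filter_upwards [h2] with b hb
    obtain ⟨b, hb, rfl⟩ := hb
    refine integral_congr_ae ?_
    filter_upwards [h1] with a ha
    obtain ⟨a, ha, rfl⟩ := ha
    rw [costFun_of_inK (show M.InK (s + p.time) y a b from ⟨h0, ha, hb⟩)]
    rfl
  · simp [costFun_cem, Game.costExt]

end GameIntensity

theorem _root_.AbsolutelyContinuousOnInterval.congr {f g : ℝ → ℝ} {a b : ℝ}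
    (hf : AbsolutelyContinuousOnInterval f a b) (h : EqOn f g (uIcc a b)) :
    AbsolutelyContinuousOnInterval g a b := by
  rw [absolutelyContinuousOnInterval_iff] at hf ⊢
  intro ε hε
  obtain ⟨δ, hδ, hf⟩ := hf ε hε
  refine ⟨δ, hδ, fun E hE hE2 => ?_⟩
  refine lt_of_eq_of_lt (Finset.sum_congr rfl fun i hi => ?_) (hf E hE hE2)
  rw [h (hE.1 i hi).1, h (hE.1 i hi).2]

/-! ### Bounds averaged over the actions -/

section GameBounds

variable {S A B : Type*} [TopologicalSpace S] [MeasurableSpace S] [MeasurableSpace A]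
  [MeasurableSpace B] {M : Game S A B} {s : ℝ≥0} {α : Kernel (TimePath S) (Ext A)}
  {β : Kernel (TimePath S) (Ext B)} [IsMarkovKernel α] [IsMarkovKernel β]
  [MeasurableSingletonClass S]

/-- The bound for fixed actions is affine in the total jump rate, so it is preserved by averaging
over the actions. -/
theorem lintegral_gameIntensity_le [MeasurableEq S] (hα : IsAdmissible M M.actA s α)
    (hβ : IsAdmissible M M.actB s β) {p : TimePath S} {y : S}
    (hy : M.leftState p.path p.time = Sum.inl y) {w : S → ℝ} (hw : Measurable w)
    (hw0 : ∀ z, 0 ≤ w z) {ρ C : ℝ} (hρ : 0 ≤ ρ) (hC : 0 ≤ C)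
    (h : ∀ a b, M.InK (s + p.time) y a b → (M.rate (s + p.time) y a b).Integrable w ∧
      ∫ᵛ z, w z ∂<•(M.rate (s + p.time) y a b) ≤ ρ * w y + C) :
    ∫⁻ z, ENNReal.ofReal (w z) ∂(gameIntensity M s α β p) ≤
      (ENNReal.ofReal ρ + gameIntensity M s α β p univ) * ENNReal.ofReal (w y) +
        ENNReal.ofReal C := by
  have hu : Measurable fun q => jumpKernel M q univ := (jumpKernel M).measurable_coe .univ
  rw [lintegral_gameIntensity p hw.ennreal_ofReal, gameIntensity,
    Kernel.comp_apply' _ _ _ MeasurableSet.univ]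
  calc _ ≤ ∫⁻ q, ((ENNReal.ofReal ρ + jumpKernel M q univ) * ENNReal.ofReal (w y) +
        ENNReal.ofReal C) ∂(actionKernel M s α β p) := by
        refine lintegral_mono_ae ?_
        filter_upwards [ae_actionKernel hα hβ hy] with q hq
        obtain ⟨a, b, hK, rfl⟩ := hq
        rw [jumpKernel_of_inK hK]
        exact lintegral_jumpMeasure_le hK hw0 (h a b hK).1 hρ hC (h a b hK).2
    _ = _ := by
        rw [lintegral_add_right _ measurable_const, lintegral_mul_const _ (hu.const_add _),
          lintegral_add_left measurable_const]
        simp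

theorem gameIntensity_univ_le [MeasurableEq S] (hα : IsAdmissible M M.actA s α)
    (hβ : IsAdmissible M M.actB s β) {p : TimePath S} {y : S}
    (hy : M.leftState p.path p.time = Sum.inl y) {C : ℝ}
    (h : ∀ a b, M.InK (s + p.time) y a b → M.exitRate (s + p.time) y a b ≤ C) :
    gameIntensity M s α β p univ ≤ ENNReal.ofReal C := by
  rw [gameIntensity, Kernel.comp_apply' _ _ _ MeasurableSet.univ]
  calc _ ≤ ∫⁻ _, ENNReal.ofReal C ∂(actionKernel M s α β p) := by
        refine lintegral_mono_ae ?_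
        filter_upwards [ae_actionKernel hα hβ hy] with q hq
        obtain ⟨a, b, hK, rfl⟩ := hq
        rw [jumpKernel_of_inK hK, jumpMeasure_univ hK]
        exact ENNReal.ofReal_le_ofReal (h a b hK)
    _ = _ := by simp

theorem ae_abs_costFun_le (hα : IsAdmissible M M.actA s α)
    (hβ : IsAdmissible M M.actB s β) {p : TimePath S} {y : S}
    (hy : M.leftState p.path p.time = Sum.inl y) {κ C : ℝ} (hκ : 0 < κ)
    (h : ∀ a b, M.InK (s + p.time) y a b → Real.exp (κ * |M.cost (s + p.time) y a b|) ≤ C) :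
    ∀ᵐ q ∂(actionKernel M s α β p), ‖costFun M q‖ ≤ Real.log C / κ := by
  filter_upwards [ae_actionKernel hα hβ hy] with q hq
  obtain ⟨a, b, hK, rfl⟩ := hq
  rw [costFun_of_inK hK, Real.norm_eq_abs, le_div_iff₀ hκ, mul_comm]
  exact (Real.le_log_iff_exp_le ((Real.exp_pos _).trans_le (h a b hK))).2 (h a b hK)

theorem integrable_costFun (hα : IsAdmissible M M.actA s α)
    (hβ : IsAdmissible M M.actB s β) {p : TimePath S} {y : S}
    (hy : M.leftState p.path p.time = Sum.inl y) {κ C : ℝ} (hκ : 0 < κ)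
    (h : ∀ a b, M.InK (s + p.time) y a b → Real.exp (κ * |M.cost (s + p.time) y a b|) ≤ C) :
    Integrable (costFun M) (actionKernel M s α β p) :=
  Integrable.of_bound (measurable_costFun M).aestronglyMeasurable _
    (ae_abs_costFun_le hα hβ hy hκ h)

/-- An exponential bound that is uniform in the actions is the bound |c| ≤ log C / κ, which the
average inherits. -/
theorem exp_abs_gameCost_le (hα : IsAdmissible M M.actA s α)
    (hβ : IsAdmissible M M.actB s β) {p : TimePath S} {y : S}
    (hy : M.leftState p.path p.time = Sum.inl y) {κ C : ℝ} (hκ : 0 < κ)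
    (h : ∀ a b, M.InK (s + p.time) y a b → Real.exp (κ * |M.cost (s + p.time) y a b|) ≤ C) :
    Real.exp (κ * |gameCost M s α β p|) ≤ C := by
  -- A probability law on admissible actions provides at least one such pair, hence C > 0 and the
  -- logarithm is meaningful.
  obtain ⟨q, a, b, hK, -⟩ := (ae_actionKernel hα hβ hy).exists
  have hC : 0 < C := (Real.exp_pos _).trans_le (h a b hK)
  have h1 := norm_integral_le_of_norm_le_const (ae_abs_costFun_le hα hβ hy hκ h)
  rw [probReal_univ, mul_one, Real.norm_eq_abs, le_div_iff₀ hκ, mul_comm] at h1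
  exact (Real.le_log_iff_exp_le hC).1 h1

end GameBounds

/-! ### Time-shifted value functions on all times -/

section Extend

variable {S A B : Type*} [TopologicalSpace S] [MeasurableSpace S] [MeasurableSpace A]
  [MeasurableSpace B] {M : Game S A B}

/-- The function `(u, y) ↦ f (s + u, y)`, extended to all times by its values on the boundary of
`[0, T]`. -/
def shiftValue {T : ℝ} (hT : 0 ≤ T) (s : ℝ≥0) (f : ℝ → S → ℝ) (u : ℝ) (y : S) : ℝ :=
  f (projIcc 0 T hT (s + u)) y

omit [TopologicalSpace S] [MeasurableSpace S] in
theorem shiftValue_eq {T : ℝ} (hT : 0 ≤ T) {s : ℝ≥0} {f : ℝ → S → ℝ} {u : ℝ} {y : S}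
    (hu : s + u ∈ Icc 0 T) : shiftValue hT s f u y = f (s + u) y := by
  rw [shiftValue, projIcc_of_mem hT hu]

variable {T : ℝ} {V V₁ : S → ℝ} {D : Set (ℝ × S)} {f : ℝ → S → ℝ}

theorem measurable_shiftValue (hT : 0 ≤ T) (s : ℝ≥0) (hf : M.MemBac T V V₁ D f) :
    Measurable (Function.uncurry (shiftValue hT s f)) := by
  have h : Measurable fun q : ℝ × S =>
      (⟨((projIcc 0 T hT (s + q.1) : ℝ), q.2), (projIcc 0 T hT (s + q.1)).2⟩ :
        {p : ℝ × S | p.1 ∈ Icc 0 T}) := by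
    refine Measurable.subtype_mk (Measurable.prodMk ?_ measurable_snd)
    exact (continuous_subtype_val.comp continuous_projIcc).measurable.comp
      (measurable_fst.const_add _)
  exact hf.measurable.comp h

end Extend

/-! ### From the game assumptions to the abstract estimates -/

section GameControl

variable {S A B : Type*} [TopologicalSpace S] [MeasurableSpace S] [MeasurableSpace A]
  [MeasurableSpace B] [MeasurableSingletonClass S] [MeasurableEq S] {M : Game S A B} {s : ℝ≥0}
  {α : Kernel (TimePath S) (Ext A)} {β : Kernel (TimePath S) (Ext B)} [IsMarkovKernel α]
  [IsMarkovKernel β] {T : ℝ} {V V₁ : S → ℝ} {D : Set (ℝ × S)} {f : ℝ → S → ℝ} {τ : ℝ≥0}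

/-- The standing assumptions control the expectations of the controlled process. -/
theorem exists_controlled (hT : 0 ≤ T) (hV : M.Drift T V) (hV₁ : M.SecondDrift T V V₁)
    (hf : M.MemBac T V V₁ D f) (hτ : (s + τ : ℝ) = T) (hα : IsAdmissible M M.actA s α)
    (hβ : IsAdmissible M M.actB s β) :
    ∃ C, Controlled M (gameIntensity M s α β) (gameCost M s α β) (shiftValue hT s f) τ
      (fun y => (V y).toNNReal) (fun y => (V₁ y).toNNReal) C := by
  obtain ⟨ρ₁, b₁, hρ₁, hb₁, hdrift⟩ := hV.drift
  obtain ⟨M₂, hM₂, hgrowth⟩ := hV.growth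
  obtain ⟨κ, hκ, hrate⟩ := hV₁.exitRate_le
  obtain ⟨M₃, hM₃, hsq⟩ := hV₁.sq_le
  obtain ⟨ρ₂, b₂, hρ₂, hb₂, hdrift₂⟩ := hV₁.drift
  obtain ⟨Cf, hCf⟩ := hf.bounded
  -- All the summands are nonnegative, so the sum dominates each constant. The absolute value is
  -- taken because the bound for f comes without a sign.
  set C : ℝ := ρ₁ + b₁ + M₂ + κ + M₃ + ρ₂ + b₂ + |Cf| with hC
  have hCf0 := abs_nonneg Cf
  have hCf1 := le_abs_self Cf
  have hC0 : 0 ≤ C := by linarith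
  have hs0 : (0 : ℝ) ≤ s := NNReal.coe_nonneg s
  have hV0 : ∀ y, 0 ≤ V y := fun y => zero_le_one.trans (hV.one_le y)
  have hV₁0 : ∀ y, 0 ≤ V₁ y := fun y => zero_le_one.trans (hV₁.one_le y)
  -- The horizon left after the elapsed time u equals the one left after the absolute time s + u, so
  -- the abstract weights at τ - u are those of the assumptions.
  have htime : ∀ {u : ℝ≥0}, u ≤ τ → (s + u : ℝ) ≤ T ∧ (τ - u : ℝ) = T - (s + u) := by
    intro u hu
    have : (u : ℝ) ≤ τ := NNReal.coe_le_coe.2 hu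
    constructor <;> linarith
  have hofReal : ∀ r : ℝ, ((r.toNNReal : ℝ≥0) : ℝ≥0∞) = ENNReal.ofReal r := fun _ => rfl
  have hflow : ∀ t, Measurable fun y => M.flow y t := fun t =>
    M.measurable_flow.comp (measurable_id.prodMk measurable_const)
  refine ⟨C.toNNReal, ?_⟩
  constructor
  · exact hV.measurable.real_toNNReal
  · exact hV₁.measurable.real_toNNReal
  · intro y
    rw [← Real.toNNReal_one]
    exact Real.toNNReal_le_toNNReal (hV.one_le y)
  · intro y
    rw [← Real.toNNReal_pow (hV0 y), ← Real.toNNReal_mul hC0]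
    exact Real.toNNReal_le_toNNReal ((hsq y).trans
      (mul_le_mul_of_nonneg_right (by linarith) (hV₁0 y)))
  · intro p y hy hp
    obtain ⟨h1, h2⟩ := htime hp
    rw [h2]
    refine lintegral_gameIntensity_le hα hβ hy (w := fun z => V (M.flow z (T - (s + p.time))))
      (hV.measurable.comp (hflow _)) (fun z => hV0 _) hC0 hC0 fun a b hK => ?_
    obtain ⟨h3, h4⟩ := hdrift _ _ a b (T - (s + p.time)) hK (by linarith)
    refine ⟨h3, h4.trans (add_le_add (mul_le_mul_of_nonneg_right ?_ (hV0 _)) ?_)⟩ <;> linarith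
  · intro p y hy hp
    obtain ⟨h1, h2⟩ := htime hp
    rw [h2]
    simp only [← Real.toNNReal_pow (hV₁0 _)]
    refine lintegral_gameIntensity_le hα hβ hy
      (w := fun z => V₁ (M.flow z (T - (s + p.time))) ^ 2)
      ((hV₁.measurable.comp (hflow _)).pow_const 2) (fun z => sq_nonneg _) hC0 hC0 fun a b hK => ?_
    obtain ⟨h3, h4⟩ := hdrift₂ _ _ a b (T - (s + p.time)) hK h1 ⟨by linarith, le_rfl⟩
    refine ⟨h3, h4.trans (add_le_add (mul_le_mul_of_nonneg_right ?_ (sq_nonneg _)) ?_)⟩ <;>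
      linarith
  · intro p y hy hp
    obtain ⟨h1, h2⟩ := htime hp
    rw [h2, hofReal, hofReal, ← ENNReal.ofReal_mul hC0]
    refine gameIntensity_univ_le hα hβ hy fun a b hK => (hrate _ _ a b hK h1).trans ?_
    exact mul_le_mul_of_nonneg_right (by linarith) (hV0 _)
  · exact measurable_gameCost
  · intro p y hy hp
    obtain ⟨h1, h2⟩ := htime hp
    rw [h2, hofReal, hofReal, ← ENNReal.ofReal_mul hC0]
    refine ENNReal.ofReal_le_ofReal (le_trans (Real.exp_le_exp.2 ?_)
      (exp_abs_gameCost_le hα hβ hy (κ := 2 * (T + 1)) (by linarith)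
      (C := C * V (M.flow y (T - (s + p.time)))) fun a b hK => ?_))
    · exact mul_le_mul_of_nonneg_right (by linarith) (abs_nonneg _)
    · exact (hgrowth _ _ a b hK h1).1.trans (mul_le_mul_of_nonneg_right (by linarith) (hV0 _))
  · exact measurable_shiftValue hT s hf
  · intro u hu y
    obtain ⟨h1, h2⟩ := htime hu
    have h3 : (s + u : ℝ) ∈ Icc 0 T := ⟨by positivity, h1⟩
    rw [shiftValue_eq hT h3, h2, Real.enorm_eq_ofReal_abs, hofReal, hofReal,
      ← ENNReal.ofReal_mul hC0]
    exact ENNReal.ofReal_le_ofReal ((hCf _ h3 y).trans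
      (mul_le_mul_of_nonneg_right (by linarith) (hV0 _)))

omit [TopologicalSpace S] [MeasurableSpace S] [MeasurableSingletonClass S] [MeasurableEq S] in
/-- An action law concentrated on true actions is the image of a mixed action. -/
theorem exists_map_inl {Act : Type*} [MeasurableSpace Act] {K : Set Act}
    {m : Measure (Ext Act)} [IsProbabilityMeasure m] (h : m (Sum.inl '' K) = 1) :
    ∃ μ : Measure Act, IsProbabilityMeasure μ ∧ μ K = 1 ∧ m = μ.map Sum.inl := by
  have h1 : ∀ D, (m.comap Sum.inl) D = m (Sum.inl '' D) :=
    measurableEmbedding_inl.comap_apply m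
  have h2 : m (range (Sum.inl : Act → Ext Act)) = 1 := by
    refine le_antisymm prob_le_one ?_
    rw [← h]
    exact measure_mono (image_subset_range _ _)
  refine ⟨m.comap Sum.inl, ⟨?_⟩, ?_, ?_⟩
  · rw [h1, image_univ, h2]
  · rw [h1, h]
  · rw [measurableEmbedding_inl.map_comap]
    refine (Measure.restrict_eq_self_of_ae_mem ?_).symm
    exact (mem_ae_iff_prob_eq_one measurableSet_range_inl).2 h2

/-- The transition rate term of the Shapley operator is the integral of the jumps against the
intensity. -/
theorem integral_rate_eq (hC : ∃ C, Controlled M (gameIntensity M s α β) (gameCost M s α β)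
      (shiftValue (T := T) hT s f) τ (fun y => (V y).toNNReal) (fun y => (V₁ y).toNNReal) C)
    (hV : M.Drift T V) (hf : M.MemBac T V V₁ D f)
    (hτ : (s + τ : ℝ) = T) {p : TimePath S} {y : S} (hp : p.time ≤ τ)
    (hy : M.leftState p.path p.time = Sum.inl y) {μ : Measure A} {ν : Measure B}
    (hμν : M.MixedActions (s + p.time) y μ ν) (hμ : α p = μ.map Sum.inl)
    (hν : β p = ν.map Sum.inl) :
    ∫ b, ∫ a, (∫ᵛ z, f (s + p.time) z ∂<•(M.rate (s + p.time) y a b)) ∂μ ∂ν =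
      ∫ z, jumpDiff M (shiftValue hT s f) p z ∂(gameIntensity M s α β p) := by
  obtain ⟨C, hC⟩ := hC
  obtain ⟨_, _, hA, hB⟩ := hμν
  have hpτ : (p.time : ℝ) ≤ τ := NNReal.coe_le_coe.2 hp
  have ht : (s + p.time : ℝ) ∈ Icc 0 T := ⟨by positivity, by linarith⟩
  have hjm : Measurable (jumpDiff M (shiftValue hT s f) p) :=
    (measurable_jumpDiff hC.measurable_value).comp (measurable_const.prodMk measurable_id)
  have hji : Integrable (jumpDiff M (shiftValue hT s f) p) (gameIntensity M s α β p) :=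
    ⟨hjm.aestronglyMeasurable, (hC.lintegral_jumpDiff_le hy hp).trans_lt (by finiteness)⟩
  have hjd : ∀ z, jumpDiff M (shiftValue hT s f) p z = f (s + p.time) z - f (s + p.time) y := by
    intro z
    rw [jumpDiff, leftValue_of_inl hy, shiftValue_eq hT ht, shiftValue_eq hT ht]
  have hfm : Measurable fun z => f (s + p.time) z := by
    have : Measurable fun z => shiftValue hT s f p.time z :=
      hC.measurable_value.comp (measurable_const.prodMk measurable_id)
    simpa only [shiftValue_eq hT ht] using this
  rw [gameIntensity] at hji ⊢
  rw [Kernel.integral_comp hji, integral_actionKernel p hji.integral_comp, hy, hν,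
    measurableEmbedding_inl.integral_map, hμ]
  simp only [measurableEmbedding_inl.integral_map]
  have hA' := (mem_ae_iff_prob_eq_one (M.measurableSet_actA _ y ht.1)).2 hA
  have hB' := (mem_ae_iff_prob_eq_one (M.measurableSet_actB _ y ht.1)).2 hB
  refine integral_congr_ae ?_
  filter_upwards [hB'] with b hb
  refine integral_congr_ae ?_
  filter_upwards [hA'] with a ha
  have hK : M.InK (s + p.time) y a b := ⟨ht.1, ha, hb⟩
  obtain ⟨Cf, hCf⟩ := hf.bounded
  obtain ⟨_, _, -, -, hdrift⟩ := hV.drift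
  have hfi : Integrable (fun z => f (s + p.time) z) (M.jumpMeasure (s + p.time) y a b) :=
    Integrable.mono' ((integrable_jumpMeasure (hdrift _ _ a b (T - (s + p.time)) hK
      (by linarith [ht.2])).1).const_mul Cf) hfm.aestronglyMeasurable
      (ae_of_all _ fun z => hCf _ ht z)
  -- For admissible actions the atom at y gives -q f(y), and q is the total mass of the jump
  -- measure, so the rate integral is that of f(z) - f(y).
  rw [jumpKernel_of_inK hK, integral_rate hK hfi]
  simp only [hjd]
  rw [integral_sub hfi (integrable_const _), integral_const, Measure.real, jumpMeasure_univ hK,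
    ENNReal.toReal_ofReal (exitRate_nonneg hK), smul_eq_mul]

/-- A subsolution of the Shapley inequality is a subsolution for every choice of strategies. -/
theorem subsolution_of_shapley {lam : ℝ} (hT : 0 ≤ T) (hV : M.Drift T V)
    (hV₁ : M.SecondDrift T V V₁)
    (hf : M.MemBac T V V₁ D f) (hτ : (s + τ : ℝ) = T) (hα : IsAdmissible M M.actA s α)
    (hβ : IsAdmissible M M.actB s β)
    (hS : ∀ p ∈ D, ∀ μ ν, M.MixedActions p.1 p.2 μ ν → 0 ≤ M.shapley T lam f p.1 p.2 μ ν) :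
    Subsolution M (gameIntensity M s α β) (gameCost M s α β) lam (shiftValue hT s f) τ where
  absCont a ha y := by
    have h0 : (s + a : ℝ) ∈ Icc 0 T := ⟨by linarith [ha.1, s.coe_nonneg], by linarith [ha.2]⟩
    have h1 := hf.absCont (s + a) h0 y
    rw [show T - (s + a) = τ - a by linarith] at h1
    refine h1.congr fun t ht => ?_
    rw [uIcc_of_le (by linarith [ha.2])] at ht
    simp only
    rw [shiftValue_eq hT, add_assoc]
    constructor <;> linarith [ht.1, ht.2, ha.1, s.coe_nonneg]
  deriv a ha y := by
    have h0 : (s + a : ℝ) ∈ Icc 0 T := ⟨by linarith [ha.1, s.coe_nonneg], by linarith [ha.2]⟩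
    have hs0 := s.coe_nonneg
    filter_upwards [(ae_restrict_iff' measurableSet_Icc).1 (hf.ae_mem (s + a) h0 y)] with t htD ht
    have hD := htD ⟨ht.1.le, by linarith [ht.2]⟩
    set r : ℝ := s + a + t with hr
    set y' := M.flow y t with hy'
    have hr0 : 0 < r := by linarith [ht.1, ha.1]
    have hrT : r < T := by linarith [ht.2]
    -- At an interior time the one-sided constraint t + h ∈ [0, T] is locally void, so the
    -- derivative within the interval is an ordinary derivative.
    have hnhds : Icc (-r) (T - r) ∈ 𝓝 (0 : ℝ) := Icc_mem_nhds (by linarith) (by linarith)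
    have hd : HasDerivAt (fun h => f (r + h) (M.flow y' h)) (M.flowDeriv T f r y') 0 := by
      have h1 := ((hf.differentiable _ hD).differentiableAt hnhds).hasDerivAt
      rw [← derivWithin_of_mem_nhds hnhds] at h1
      exact h1
    have hd2 : HasDerivAt (fun t' => shiftValue hT s f (a + t') (M.flow y t'))
        (M.flowDeriv T f r y') t := by
      -- The flow from y at time t' is the flow from φ(y, t) at time t' - t, so the derivative at t
      -- along the trajectory is the flow derivative at the point reached.
      have h1 : HasDerivAt (fun t' => f (r + (t' - t)) (M.flow y' (t' - t)))
          (M.flowDeriv T f r y') t := by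
        refine HasDerivAt.comp_sub_const (f := fun h => f (r + h) (M.flow y' h)) t t ?_
        rw [sub_self]
        exact hd
      refine h1.congr_of_eventuallyEq ?_
      filter_upwards [Ioo_mem_nhds ht.1 ht.2] with t' ht'
      rw [shiftValue_eq hT, hy', ← M.flow_add, add_sub_cancel, hr]
      · congr 1
        ring
      · constructor <;> linarith [ht'.1, ht'.2, ha.1]
    -- The derivative depends on time and state alone, but the action laws may depend on the whole
    -- past. The Shapley inequality is therefore used for each past p, with the mixed actions read
    -- off from its action laws.
    refine ⟨_, hd2, fun p hp hleft => ?_⟩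
    have hat : 0 ≤ a + t := by linarith [ht.1, ha.1]
    have hpr : (s + p.time : ℝ) = r := by
      rw [hp, Real.coe_toNNReal _ hat]; ring
    have hpτ : p.time ≤ τ := by
      rw [hp]
      exact Real.toNNReal_le_iff_le_coe.2 (by linarith [ht.2])
    obtain ⟨μ, hμ1, hμ2, hμ⟩ := exists_map_inl (m := α p) (K := M.actA (s + p.time : ℝ≥0) y')
      (by have h := hα p; rw [hleft] at h; exact h)
    obtain ⟨ν, hν1, hν2, hν⟩ := exists_map_inl (m := β p) (K := M.actB (s + p.time : ℝ≥0) y')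
      (by have h := hβ p; rw [hleft] at h; exact h)
    have hmix : M.MixedActions (s + p.time) y' μ ν := ⟨hμ1, hν1, hμ2, hν2⟩
    have hCtrl := exists_controlled hT hV hV₁ hf hτ hα hβ
    have h1 := integral_rate_eq hCtrl hV hf hτ hpτ hleft hmix hμ hν
    obtain ⟨M₂, -, hgrowth⟩ := hV.growth
    have h2 := gameCost_eq hα hβ (integrable_costFun hα hβ hleft (κ := 2 * (T + 1))
      (by linarith) (C := M₂ * V (M.flow y' (T - (s + p.time)))) fun a b hK =>
        (hgrowth _ _ a b hK (by linarith)).1)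
    rw [hleft, hν, measurableEmbedding_inl.integral_map, hμ] at h2
    simp only [measurableEmbedding_inl.integral_map] at h2
    rw [hpr] at h1 h2 hmix
    have h3 := hS _ hD μ ν hmix
    rw [Game.shapley, h1] at h3
    rw [shiftValue_eq hT (by constructor <;> linarith), show (s + (a + t) : ℝ) = r by rw [hr]; ring,
      h2]
    have h4 : ∫ b, ∫ a, M.costExt r (Sum.inl y') (Sum.inl a) (Sum.inl b) ∂μ ∂ν =
      ∫ b, ∫ a, M.cost r y' a b ∂μ ∂ν := rfl
    rw [h4]
    linarith

end GameControl

/-! ### Strategies as kernels of action laws -/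

section Strategies

variable {S A B : Type*} [TopologicalSpace S] [MeasurableSpace S] [MeasurableSpace A]
  [MeasurableSpace B] {M : Game S A B} {Act : Type*} [MeasurableSpace Act]
  {act : ℝ → S → Set Act}

/-- The action law of a feedback strategy. -/
def feedbackKernel (π : M.FeedbackStrategy act) : Kernel (TimePath S) (Ext Act) :=
  ⟨fun p => π.toKernel (p.time, p.path), by
    let _ : MeasurableSpace (ℝ≥0 × Path S) := (pathFiltration S).predictable
    exact π.toKernel.measurable.comp
      (comap_measurable (fun p : TimePath S => (p.time, p.path)))⟩

instance (π : M.FeedbackStrategy act) : IsMarkovKernel (feedbackKernel π) :=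
  ⟨fun p => π.prob p.time p.path⟩

theorem isAdmissible_feedbackKernel (π : M.FeedbackStrategy act) :
    IsAdmissible M act 0 (feedbackKernel π) := by
  intro p
  rw [zero_add]
  exact π.adm p.time p.path

/-- The path without jumps that starts at `y`. -/
def constPath (y : S) : Path S :=
  ⟨(fun k => if k = 0 then Sum.inl y else cem, fun _ => ∞), by simp⟩

/-- Following the flow backwards from y for time u and letting no jump occur reaches y at u.
Properties of a Markov strategy, given along paths, thus hold at every time and state, in particular
at the shifted times s + u. -/
theorem exists_leftState_eq (M : Game S A B) (u : ℝ≥0) (y : S) :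
    ∃ ω, M.leftState ω u = Sum.inl y := by
  refine ⟨constPath (M.flow y (-u)), ?_⟩
  have h : OnPiece (constPath (M.flow y (-u))) u 0 :=
    ⟨Or.inl rfl, by simp [jumpTime, constPath]⟩
  rw [leftState_of_onPiece_of_mark M h (y := M.flow y (-u)) (by simp [mark, constPath]),
    jumpTime_zero, ← M.flow_add]
  simp [M.flow_zero]

theorem isProbabilityMeasure_markovLaw (π : M.MarkovStrategy act) (t : ℝ≥0) (z : Ext S) :
    IsProbabilityMeasure (markovLaw π.markov t z) := by
  rcases z with y | z
  · obtain ⟨ω, hω⟩ := exists_leftState_eq M t y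
    have := π.prob t ω
    rwa [π.eq_markov, hω] at this
  · exact Measure.dirac.isProbabilityMeasure

theorem markovLaw_admissible (π : M.MarkovStrategy act) (t : ℝ≥0) (z : Ext S) :
    markovLaw π.markov t z (admissible act t z) = 1 := by
  rcases z with y | z
  · obtain ⟨ω, hω⟩ := exists_leftState_eq M t y
    have := π.adm t ω
    rwa [π.eq_markov, hω] at this
  · exact Measure.dirac_apply_of_mem rfl

/-- The action law of a Markov strategy for the process started at time `s`. -/
def markovKernel (π : M.MarkovStrategy act) (s : ℝ≥0) (x₀ : S) :
    Kernel (TimePath S) (Ext Act) := by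
  classical
  exact Kernel.piecewise (measurableSet_aliveSet M)
    ((π.markov.comap (fun p => (s + p.time, leftPos M x₀ p))
      ((measurable_time.const_add s).prodMk (measurable_leftPos M x₀))).map Sum.inl)
    (Kernel.const _ (Measure.dirac cem))

theorem markovKernel_apply (π : M.MarkovStrategy act) (s : ℝ≥0) (x₀ : S) (p : TimePath S) :
    markovKernel π s x₀ p =
      markovLaw π.markov (s + p.time) (M.leftState p.path p.time) := by
  classical
  rw [markovKernel, Kernel.piecewise_apply]
  split_ifs with h
  · obtain ⟨y, hy⟩ := mem_aliveSet_iff.1 h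
    rw [Kernel.map_apply _ measurable_inl, Kernel.comap_apply, leftPos_of_inl hy, hy]
    rfl
  · have h1 : M.leftState p.path p.time = cem := by simpa [aliveSet] using h
    rw [h1]
    rfl

instance (π : M.MarkovStrategy act) (s : ℝ≥0) (x₀ : S) :
    IsMarkovKernel (markovKernel π s x₀) :=
  ⟨fun p => by rw [markovKernel_apply]; exact isProbabilityMeasure_markovLaw π _ _⟩

theorem isAdmissible_markovKernel (π : M.MarkovStrategy act) (s : ℝ≥0) (x₀ : S) :
    IsAdmissible M act s (markovKernel π s x₀) := by
  intro p
  rw [markovKernel_apply]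
  exact markovLaw_admissible π (s + p.time) _

end Strategies

/-! ### Comparison with the exponential cost -/

section Comparison

variable {S A B : Type*} [TopologicalSpace S] [MeasurableSpace S] [MeasurableSpace A]
  [MeasurableSpace B] {M : Game S A B} {s : ℝ≥0} {α : Kernel (TimePath S) (Ext A)}
  {β : Kernel (TimePath S) (Ext B)} [IsMarkovKernel α] [IsMarkovKernel β]
  [MeasurableSingletonClass S] {T lam σ : ℝ} {V V₁ : S → ℝ} {D : Set (ℝ × S)} {f : ℝ → S → ℝ}
  {τ : ℝ≥0} {α' : Path S → ℝ≥0 → Measure (Ext A)} {β' : Path S → ℝ≥0 → Measure (Ext B)}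

/-- Along a path without jump at the terminal time, the exponential cost is the discounted
terminal value. -/
theorem riskCost_eq (hT : 0 ≤ T) (hV : M.Drift T V) (hτ : (s + τ : ℝ) = T)
    (hα : IsAdmissible M M.actA s α) (hβ : IsAdmissible M M.actB s β)
    (hα' : ∀ ω u, M.state ω u = M.leftState ω u → α' ω u = α ⟨u, ω⟩)
    (hβ' : ∀ ω u, M.state ω u = M.leftState ω u → β' ω u = β ⟨u, ω⟩)
    (hterm : ∀ x, f T x = σ * Real.exp (lam * M.term T x)) {ω : Path S} {N : ℕ}
    (hN : OnPiece ω τ N) (hne : ∀ k, jumpTime ω (k + 1) ≠ τ) :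
    discount lam (gameCost M s α β) ⟨τ, ω⟩ * leftValue M (fun u => shiftValue hT s f u) ⟨τ, ω⟩ =
      σ * M.riskCost T lam s α' β' ω := by
  have hTs : (T - s : ℝ) = τ := by linarith
  obtain ⟨y, hy⟩ := exists_mark_eq hN.ne_top
  have hs := leftState_of_onPiece_of_mark M hN hy
  have hTmem : (s + τ : ℝ) ∈ Icc 0 T := ⟨by positivity, hτ.le⟩
  obtain ⟨M₂, -, hgrowth⟩ := hV.growth
  have hcost : ∫ t in (s : ℝ)..T, (∫ b, (∫ a, M.costExt t (M.state ω (t - s).toNNReal) a b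
      ∂(α' ω (t - s).toNNReal)) ∂(β' ω (t - s).toNNReal)) =
      ∫ r in (0 : ℝ)..τ, gameCost M s α β ⟨r.toNNReal, ω⟩ := by
    have h1 := intervalIntegral.integral_comp_sub_right (a := (s : ℝ)) (b := T) (fun u =>
      ∫ b, (∫ a, M.costExt (s + u) (M.state ω u.toNNReal) a b
        ∂(α' ω u.toNNReal)) ∂(β' ω u.toNNReal)) (s : ℝ)
    simp only [add_sub_cancel, sub_self, hTs] at h1
    rw [h1]
    refine intervalIntegral.integral_congr_ae ?_
    -- The cost is evaluated at ξ_t and the intensity at ξ_{t-}. They differ only at jump times, a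
    -- null set for the time integral.
    have hcount : (range fun k => (jumpTime ω (k + 1)).toReal).Countable := countable_range _
    filter_upwards [hcount.ae_notMem volume] with u hu hmem
    rw [uIoc_of_le (NNReal.coe_nonneg _)] at hmem
    have hu' : ((u.toNNReal : ℝ≥0) : ℝ) = u := Real.coe_toNNReal _ hmem.1.le
    have huτ : u.toNNReal ≤ τ := Real.toNNReal_le_iff_le_coe.2 hmem.2
    have hst := state_eq_leftState M (ω := ω) (u := u.toNNReal) fun k hk => hu ⟨k, by
      simp only [hk, ENNReal.coe_toReal, hu']⟩
    obtain ⟨k, hk⟩ := exists_onPiece (ω := ω) (u := u.toNNReal)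
      ⟨N + 1, (ENNReal.coe_le_coe.2 huτ).trans hN.2⟩
    obtain ⟨y', hy'⟩ := exists_mark_eq hk.ne_top
    have hleft := leftState_of_onPiece_of_mark M hk hy'
    have h2 := gameCost_eq hα hβ (p := ⟨u.toNNReal, ω⟩) (integrable_costFun hα hβ hleft
      (κ := 2 * (T + 1)) (by linarith) fun a b hK => (hgrowth _ _ a b hK
        (by simp only [hu']; linarith [hmem.2])).1)
    rw [h2, hst, hα' _ _ hst, hβ' _ _ hst]
    simp only [hu']
  have hst := state_eq_leftState M hne
  rw [Game.riskCost, hcost, hTs, Real.toNNReal_coe, hst, hs, leftValue_of_inl (p := ⟨τ, ω⟩) hs,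
    shiftValue_eq hT hTmem, hτ, hterm, Real.exp_add, discount, expWeight]
  simp only [Game.termExt]
  ring

variable [MeasurableEq S]

/-- The sign σ in the terminal condition allows one proof for both inequalities: σ = 1 with f and σ
= -1 with -f. -/
theorem le_integral_riskCost (hT : 0 ≤ T) (hl0 : 0 ≤ lam) (hl1 : lam ≤ 1) (hV : M.Drift T V)
    (hV₁ : M.SecondDrift T V V₁) (hf : M.MemBac T V V₁ D f) (hsT : (s : ℝ) ≤ T)
    (hterm : ∀ x, f T x = σ * Real.exp (lam * M.term T x))
    (hS : ∀ p ∈ D, ∀ μ ν, M.MixedActions p.1 p.2 μ ν → 0 ≤ M.shapley T lam f p.1 p.2 μ ν)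
    (hα : IsAdmissible M M.actA s α) (hβ : IsAdmissible M M.actB s β)
    (hα' : ∀ ω u, M.state ω u = M.leftState ω u → α' ω u = α ⟨u, ω⟩)
    (hβ' : ∀ ω u, M.state ω u = M.leftState ω u → β' ω u = β ⟨u, ω⟩) {x : S}
    {P : Measure (Path S)}
    (hP : M.IsLaw s x (fun ω u => α ⟨u, ω⟩) (fun ω u => β ⟨u, ω⟩) P) :
    Integrable (fun ω => σ * M.riskCost T lam s α' β' ω) P ∧
      f s x ≤ ∫ ω, σ * M.riskCost T lam s α' β' ω ∂P := by
  obtain ⟨τ, hτ⟩ : ∃ τ : ℝ≥0, (s + τ : ℝ) = T :=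
    ⟨(T - s).toNNReal, by rw [Real.coe_toNNReal _ (sub_nonneg.2 hsT)]; ring⟩
  have hI := hP.hasIntensity hα hβ
  obtain ⟨C, hC⟩ := exists_controlled hT hV hV₁ hf hτ hα hβ
  obtain ⟨h1, h2⟩ := (subsolution_of_shapley hT hV hV₁ hf hτ hα hβ hS).le_integral hC hl0 hl1 hI
  have heq : ∀ᵐ ω ∂P, discount lam (gameCost M s α β) ⟨τ, ω⟩ *
      leftValue M (fun u => shiftValue hT s f u) ⟨τ, ω⟩ = σ * M.riskCost T lam s α' β' ω := by
    filter_upwards [hC.ae_exists_onPiece hI, hI.ae_jumpTime_ne τ] with ω ⟨N, hN⟩ hne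
    exact riskCost_eq hT hV hτ hα hβ hα' hβ' hterm hN hne
  rw [integral_congr_ae heq, shiftValue_eq hT ⟨by positivity, by simpa using hsT⟩, add_zero] at h2
  exact ⟨h1.congr heq, h2⟩

omit [MeasurableSingletonClass S] [MeasurableEq S] in
theorem _root_.PDGame.Game.MemBac.neg (hf : M.MemBac T V V₁ D f) :
    M.MemBac T V V₁ D fun t x => -f t x where
  measurable := hf.measurable.neg
  bounded := by simpa only [abs_neg] using hf.bounded
  absCont r hr x := (hf.absCont r hr x).neg
  time_mem := hf.time_mem
  differentiable p hp := (hf.differentiable p hp).neg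
  ae_mem := hf.ae_mem
  deriv_bounded := by
    have h : ∀ t x, M.flowDeriv T (fun t x => -f t x) t x = -M.flowDeriv T f t x :=
      fun t x => derivWithin.fun_neg
    simpa only [h, abs_neg] using hf.deriv_bounded

omit [MeasurableSingletonClass S] [MeasurableEq S] in
theorem shapley_neg (t : ℝ) (x : S) (μ : Measure A) (ν : Measure B) :
    M.shapley T lam (fun t x => -f t x) t x μ ν = -M.shapley T lam f t x μ ν := by
  have h : M.flowDeriv T (fun t x => -f t x) t x = -M.flowDeriv T f t x := derivWithin.fun_neg
  simp only [Game.shapley, h, VectorMeasure.integral_fun_neg, integral_neg]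
  ring

/-- The Shapley operator is linear in the value function, so a supersolution f turns into the
subsolution -f with terminal value -exp(lam g). -/
theorem integral_riskCost_le (hT : 0 ≤ T) (hl0 : 0 ≤ lam) (hl1 : lam ≤ 1) (hV : M.Drift T V)
    (hV₁ : M.SecondDrift T V V₁) (hf : M.MemBac T V V₁ D f) (hsT : (s : ℝ) ≤ T)
    (hterm : ∀ x, f T x = Real.exp (lam * M.term T x))
    (hα : IsAdmissible M M.actA s α) (hβ : IsAdmissible M M.actB s β)
    (hα' : ∀ ω u, M.state ω u = M.leftState ω u → α' ω u = α ⟨u, ω⟩)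
    (hβ' : ∀ ω u, M.state ω u = M.leftState ω u → β' ω u = β ⟨u, ω⟩) {x : S}
    {P : Measure (Path S)}
    (hP : M.IsLaw s x (fun ω u => α ⟨u, ω⟩) (fun ω u => β ⟨u, ω⟩) P) :
    ((∀ p ∈ D, ∀ μ ν, M.MixedActions p.1 p.2 μ ν → 0 ≤ M.shapley T lam f p.1 p.2 μ ν) →
      Integrable (M.riskCost T lam s α' β') P ∧ f s x ≤ ∫ ω, M.riskCost T lam s α' β' ω ∂P) ∧
    ((∀ p ∈ D, ∀ μ ν, M.MixedActions p.1 p.2 μ ν → M.shapley T lam f p.1 p.2 μ ν ≤ 0) →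
      Integrable (M.riskCost T lam s α' β') P ∧ ∫ ω, M.riskCost T lam s α' β' ω ∂P ≤ f s x) := by
  constructor
  · intro hS
    have h := le_integral_riskCost (σ := 1) hT hl0 hl1 hV hV₁ hf hsT (by simpa using hterm) hS
      hα hβ hα' hβ' hP
    simpa only [one_mul] using h
  · intro hS
    have h := le_integral_riskCost (σ := -1) hT hl0 hl1 hV hV₁ hf.neg hsT (by simpa using hterm)
      (fun p hp μ ν hμν => by rw [shapley_neg]; exact neg_nonneg.2 (hS p hp μ ν hμν))
      hα hβ hα' hβ' hP
    simp only [neg_one_mul, integral_neg, neg_le_neg_iff] at h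
    exact ⟨integrable_neg_iff.1 h.1, h.2⟩

end Comparison

end PDGame

end

theorem corollary3p1 {S A B : Type*}
    [TopologicalSpace S] [TopologicalSpace.MetrizableSpace S] [SecondCountableTopology S]
    [MeasurableSpace S] [BorelSpace S] [StandardBorelSpace S]
    [MeasurableSpace A] [StandardBorelSpace A] [MeasurableSpace B] [StandardBorelSpace B]
    (M : PDGame.Game S A B) (T lam : ℝ) (hT : 0 < T) (hlam : 0 < lam) (hlam1 : lam ≤ 1)
    (V V₁ : S → ℝ) (hV : M.Drift T V) (hV₁ : M.SecondDrift T V V₁)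
    (D : Set (ℝ × S)) (f : ℝ → S → ℝ) (hf : M.MemBac T V V₁ D f)
    (hterm : ∀ x, f T x = Real.exp (lam * M.term T x)) :
    ((∀ p ∈ D, ∀ μ ν, M.MixedActions p.1 p.2 μ ν → 0 ≤ M.shapley T lam f p.1 p.2 μ ν) →
      (∀ (π₁ : M.FeedbackStrategy M.actA) (π₂ : M.FeedbackStrategy M.actB) (x : S)
        (P : Measure (PDGame.Path S)), M.IsFeedbackLaw x π₁ π₂ P →
        Integrable (M.feedbackCost T lam π₁ π₂) P ∧
          f 0 x ≤ ∫ ω, M.feedbackCost T lam π₁ π₂ ω ∂P) ∧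
      (∀ (π₁ : M.MarkovStrategy M.actA) (π₂ : M.MarkovStrategy M.actB) (t : ℝ≥0) (x : S)
        (P : Measure (PDGame.Path S)), (t : ℝ) ≤ T → M.IsMarkovLaw t x π₁ π₂ P →
        Integrable (M.markovCost T lam t π₁ π₂) P ∧
          f t x ≤ ∫ ω, M.markovCost T lam t π₁ π₂ ω ∂P)) ∧
    ((∀ p ∈ D, ∀ μ ν, M.MixedActions p.1 p.2 μ ν → M.shapley T lam f p.1 p.2 μ ν ≤ 0) →
      (∀ (π₁ : M.FeedbackStrategy M.actA) (π₂ : M.FeedbackStrategy M.actB) (x : S)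
        (P : Measure (PDGame.Path S)), M.IsFeedbackLaw x π₁ π₂ P →
        Integrable (M.feedbackCost T lam π₁ π₂) P ∧
          ∫ ω, M.feedbackCost T lam π₁ π₂ ω ∂P ≤ f 0 x) ∧
      (∀ (π₁ : M.MarkovStrategy M.actA) (π₂ : M.MarkovStrategy M.actB) (t : ℝ≥0) (x : S)
        (P : Measure (PDGame.Path S)), (t : ℝ) ≤ T → M.IsMarkovLaw t x π₁ π₂ P →
        Integrable (M.markovCost T lam t π₁ π₂) P ∧
          ∫ ω, M.markovCost T lam t π₁ π₂ ω ∂P ≤ f t x)) := by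
  have hfeedback : ∀ (π₁ : M.FeedbackStrategy M.actA) (π₂ : M.FeedbackStrategy M.actB) (x : S)
      (P : Measure (PDGame.Path S)), M.IsFeedbackLaw x π₁ π₂ P → _ := fun π₁ π₂ x P hP =>
    PDGame.integral_riskCost_le (s := 0) (α := PDGame.feedbackKernel π₁)
      (β := PDGame.feedbackKernel π₂) (α' := fun ω t => π₁.toKernel (t, ω))
      (β' := fun ω t => π₂.toKernel (t, ω)) hT.le hlam.le hlam1 hV hV₁ hf (by simpa using hT.le)
      hterm (PDGame.isAdmissible_feedbackKernel π₁) (PDGame.isAdmissible_feedbackKernel π₂)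
      (fun _ _ _ => rfl) (fun _ _ _ => rfl) hP
  have hmarkov : ∀ (π₁ : M.MarkovStrategy M.actA) (π₂ : M.MarkovStrategy M.actB) (t : ℝ≥0) (x : S)
      (P : Measure (PDGame.Path S)), (t : ℝ) ≤ T → M.IsMarkovLaw t x π₁ π₂ P → _ :=
    fun π₁ π₂ t x P ht hP =>
    PDGame.integral_riskCost_le (s := t) (α := PDGame.markovKernel π₁ t x)
      (β := PDGame.markovKernel π₂ t x)
      (α' := fun ω u => PDGame.markovLaw π₁.markov (t + u) (M.state ω u))
      (β' := fun ω u => PDGame.markovLaw π₂.markov (t + u) (M.state ω u))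
      hT.le hlam.le hlam1 hV hV₁ hf ht hterm (PDGame.isAdmissible_markovKernel π₁ t x)
      (PDGame.isAdmissible_markovKernel π₂ t x)
      -- The cost applies the Markov law to ξ_u and the process law applies it to ξ_{u-}; they agree
      -- whenever these states coincide.
      (fun ω u h => by rw [PDGame.markovKernel_apply, h])
      (fun ω u h => by rw [PDGame.markovKernel_apply, h])
      (by simp only [PDGame.markovKernel_apply]; exact hP)
  refine ⟨fun hS => ⟨fun π₁ π₂ x P hP => ?_, fun π₁ π₂ t x P ht hP => ?_⟩,
    fun hS => ⟨fun π₁ π₂ x P hP => ?_, fun π₁ π₂ t x P ht hP => ?_⟩⟩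
  · have h := (hfeedback π₁ π₂ x P hP).1 hS
    rw [NNReal.coe_zero] at h
    exact h
  · exact (hmarkov π₁ π₂ t x P ht hP).1 hS
  · have h := (hfeedback π₁ π₂ x P hP).2 hS
    rw [NNReal.coe_zero] at h
    exact h
  · exact (hmarkov π₁ π₂ t x P ht hP).2 hS
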